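/- **Task.** Let $d,m:\mathbb N\to\mathbb N$ be nondecreasing. An input of the $k$-hop composition task with $N$ facts ($N,k\ge 1$) consists of a list of $N$ facts $f(x)=y$ ($f$ from a vocabulary of $m(N)$ function names, $x,y$ from a domain of $d(N)$ objects), at most one fact for each pair $(f,x)$, and a query $f_1(\cdots f_k(x)\cdots)$ whose value is determined by the facts. The answer is this value; the input size is $N+k$. Let $w:\mathbb N\to\mathbb N$ with $1\le w(N)\le N$ for all $N\ge1$. **Systems.** A multi-agent system has nested finite CoT alphabets $\Xi_n$ with $|\Xi_n|$ polynomial in $n$, containing the input symbols (facts, function names, objects) for size $n$. To every input with $N$ facts it assigns a labelled DAG with $w(N)$ agents. Agent $i$ has nodes $T_i^{(1)},\dots,T_i^{(D_i)}$, $D_i\ge1$. Every edge goes from time $t$ to time $t+1$ and carries a symbol of $\Xi_{N+k}$: a CoT edge from an agent to itself, or a communication edge to another agent. Each node has either no outgoing edge, or one outgoing edge, or communication edges with one common label to all other agents; each node with $t>1$ has exactly one incoming edge. Initially agent $i$'s context is its block of the list of facts (the list is cut into $w(N)$ consecutive blocks, of equal size up to rounding), the query, and an identifier $\mathrm{ID}_i$.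 At each node in turn, a token RECEIVE$_\sigma$ is appended for an incoming communication edge labelled $\sigma$, and then a token $\sigma$, SEND$_\sigma$ID$_j$ or BROADCAST$_\sigma$ for an outgoing CoT edge, message to agent $j$, or broadcast; at the very end EOS is appended. The system is implemented by causally masked unique hard attention transformers (rightmost tie-breaking, ReLU MLPs, arbitrary positional embeddings, arbitrary width): for each $n$ one transformer, run by all agents, with numbers of layers and attention heads bounded independently of $n$, has all these strings in its context window for all inputs of size $N+k\le n$, and predicts (as the unique maximiser of its output scores) every token arising from outgoing edges and the final EOS. A token generated at a node may be overridden by a message arriving at the next node, but a generated SEND or BROADCAST is never suppressed. The system solves the task if, for a manager agent that depends only on $(N,k)$, the label of the manager's last CoT edge is always the answer. For a run, *depth* is the number of edges of a longest path, *size* the number of nodes, and *communication budget* the number of nodes with an outgoing communication edge. **Proposition.** 1. (Realizability.) There is an absolute constant $C$ such that for all $w,d,m$ as above, with $d,m$ polynomially bounded, there is a multi-agent system solving the $k$-hop composition task whose runs, for all $N,k\ge1$ and all inputs, have depth at most $Ck$, communication budget at most $Ck$, and size at most $C\,w(N)\,k$. For 2 and 3 assume $d(n)\ge n$ and $m(n)\ge1$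 for all $n$. 2. (Communication budget is optimal.) For every $p$ there are $c>0$ and $K$ such that the following holds for all $w,d,m$ and every multi-agent system that solves the task and has $|\Xi_n|\le(n+2)^p$ for all $n$. Let $k\ge1$, $w(N)\ge2$ and $N\ge(k+1)^K$, and suppose that all runs on inputs with parameters $(N,k)$ have depth at most $(N+k+2)^p$. Then some input with parameters $(N,k)$ has communication budget at least $ck$. In particular this holds for two agents. 3. (Depth is optimal up to a logarithmic factor.) For every $p$ there are $c>0$ and $K$ such that for all $w,d,m$ and every multi-agent system that solves the task and has $|\Xi_n|\le(n+2)^p$ for all $n$: if $k\ge1$, $w(N)\ge2$ and $N\ge K\,k\,w(N)$, then some input with parameters $(N,k)$ has depth at least $ck/\log(N+k)$. -/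

import Mathlib

open scoped Matrix

namespace KHopAgents

/-! ## Alphabets -/

/-- Symbols.  `fact f x y`, `fn f` and `obj x` are the input symbols (the fact `f(x) = y`, a function
name, an object); the symbols `aux a` are the further chain-of-thought symbols. -/
inductive Sym : Type
  | fact (f x y : ℕ)
  | fn (f : ℕ)
  | obj (x : ℕ)
  | aux (a : ℕ)

/-- The input alphabet `Σ_n`, for a vocabulary of `m n` function names and a domain of `d n` objects. -/
def inputAlphabet (d m : ℕ → ℕ) (n : ℕ) : Set Sym :=
  {s | (∃ f x y, f < m n ∧ x < d n ∧ y < d n ∧ s = Sym.fact f x y) ∨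
    (∃ f, f < m n ∧ s = Sym.fn f) ∨ (∃ x, x < d n ∧ s = Sym.obj x)}

/-- Tokens processed by an agent: symbols, agent identifiers, `RECEIVE_s`, `SEND_s_ID_j`,
`BROADCAST_s` and the end-of-sequence token. -/
inductive Token : Type
  | sym (s : Sym)
  | ident (i : ℕ)
  | receive (s : Sym)
  | send (s : Sym) (j : ℕ)
  | broadcast (s : Sym)
  | eos

/-- The tokens `SEND_s_ID_j` and `BROADCAST_s`. -/
def Token.IsComm : Token → Prop
  | .send _ _ => True
  | .broadcast _ => True
  | _ => False

/-- The token alphabet over a set `X` of symbols and `n` agent identifiers. -/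
def tokenAlphabet (X : Finset Sym) (n : ℕ) : Set Token :=
  {a | match a with
    | .sym s => s ∈ X
    | .ident i => i < n
    | .receive s => s ∈ X
    | .send s j => s ∈ X ∧ j < n
    | .broadcast s => s ∈ X
    | .eos => True}

/-! ## Causally masked unique hard attention transformers -/

/-- Functions computed by ReLU multilayer perceptrons. -/
inductive IsMLP : {a b : ℕ} → ((Fin a → ℝ) → (Fin b → ℝ)) → Prop
  | affine {a b : ℕ} (W : Matrix (Fin b) (Fin a) ℝ) (v : Fin b → ℝ) :
      IsMLP (fun x => W *ᵥ x + v)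
  | hidden {a h b : ℕ} (W : Matrix (Fin h) (Fin a) ℝ) (v : Fin h → ℝ)
      (g : (Fin h → ℝ) → (Fin b → ℝ)) :
      IsMLP g → IsMLP (fun x => g (fun i => max 0 ((W *ᵥ x + v) i)))

open Classical in
/-- The rightmost position among `0, …, i` at which `s` is maximal. -/
noncomputable def rightmostArgmax (s : ℕ → ℝ) : ℕ → ℕ
  | 0 => 0
  | i + 1 => if s (rightmostArgmax s i) ≤ s (i + 1) then i + 1 else rightmostArgmax s i

theorem rightmostArgmax_spec (s : ℕ → ℝ) (i : ℕ) :
    rightmostArgmax s i ≤ i ∧ ∀ j ≤ i, s j ≤ s (rightmostArgmax s i) ∧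
      (rightmostArgmax s i < j → s j < s (rightmostArgmax s i)) := by
  induction i with
  | zero =>
    refine ⟨le_refl _, fun j hj => ?_⟩
    obtain rfl : j = 0 := by omega
    exact ⟨le_refl _, fun h => absurd h (by simp [rightmostArgmax])⟩
  | succ i ih =>
    obtain ⟨h1, h2⟩ := ih
    by_cases h : s (rightmostArgmax s i) ≤ s (i + 1)
    · have e : rightmostArgmax s (i + 1) = i + 1 := by simp [rightmostArgmax, h]
      rw [e]
      refine ⟨le_refl _, fun j hj => ⟨?_, fun h' => by omega⟩⟩
      rcases Nat.lt_or_ge i j with h3 | h3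
      · obtain rfl : j = i + 1 := by omega
        exact le_refl _
      · exact le_trans (h2 j h3).1 h
    · have e : rightmostArgmax s (i + 1) = rightmostArgmax s i := by simp [rightmostArgmax, h]
      rw [e]
      refine ⟨by omega, fun j hj => ?_⟩
      rcases Nat.lt_or_ge i j with h3 | h3
      · obtain rfl : j = i + 1 := by omega
        exact ⟨le_of_lt (not_le.mp h), fun _ => not_le.mp h⟩
      · exact h2 j h3

/-- A transformer layer of width `dim`: multi-head attention followed by an MLP. -/
structure Layer (dim : ℕ) where
  heads : ℕ
  headDim : ℕ
  WQ : Fin heads → Matrix (Fin dim) (Fin headDim) ℝ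
  WK : Fin heads → Matrix (Fin dim) (Fin headDim) ℝ
  WV : Fin heads → Matrix (Fin dim) (Fin headDim) ℝ
  WO : Matrix (Fin heads × Fin headDim) (Fin dim) ℝ
  mlp : (Fin dim → ℝ) → (Fin dim → ℝ)
  mlp_isMLP : IsMLP mlp

/-- The position attended to by head `h` from position `i`: among the positions `j ≤ i`, the one with
the largest attention score, the rightmost one in case of a tie. -/
noncomputable def Layer.attended {dim : ℕ} (ℓ : Layer dim) (X : ℕ → Fin dim → ℝ)
    (h : Fin ℓ.heads) (i : ℕ) : ℕ :=
  rightmostArgmax (fun j => (X i ᵥ* ℓ.WQ h) ⬝ᵥ (X j ᵥ* ℓ.WK h)) i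

/-- The layer applied to a sequence of vectors.  By causal masking the output at position `i` depends
only on the positions `0, …, i`. -/
noncomputable def Layer.apply {dim : ℕ} (ℓ : Layer dim) (X : ℕ → Fin dim → ℝ) :
    ℕ → Fin dim → ℝ :=
  fun i => ℓ.mlp ((fun q : Fin ℓ.heads × Fin ℓ.headDim =>
    (X (ℓ.attended X q.1 i) ᵥ* ℓ.WV q.1) q.2) ᵥ* ℓ.WO)

/-- A causally masked unique hard attention transformer on tokens. -/
structure UHAT where
  dim : ℕ
  contextSize : ℕ
  emb : Token → Fin dim → ℝ
  pos : ℕ → Fin dim → ℝ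
  layers : List (Layer dim)
  unemb : Token → Fin dim → ℝ

/-- Token embedding plus positional embedding (positions from the length of `u` on are never read). -/
def UHAT.embed (T : UHAT) (u : List Token) : ℕ → Fin T.dim → ℝ :=
  fun i => T.emb (u.getD i Token.eos) + T.pos i

/-- The output of the last layer. -/
noncomputable def UHAT.output (T : UHAT) (u : List Token) : ℕ → Fin T.dim → ℝ :=
  T.layers.foldl (fun X ℓ => ℓ.apply X) (T.embed u)

/-- The score of the token `a` as the continuation of `u`, read off at the last position of `u`. -/
noncomputable def UHAT.logit (T : UHAT) (u : List Token) (a : Token) : ℝ :=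
  T.output u (u.length - 1) ⬝ᵥ T.unemb a

/-- On the context `u`, greedy decoding over the token alphabet `V` yields the token `a`. -/
def UHAT.Predicts (T : UHAT) (V : Set Token) (u : List Token) (a : Token) : Prop :=
  a ∈ V ∧ ∀ b ∈ V, b ≠ a → T.logit u b < T.logit u a

/-! ## Communication graphs -/

/-- The outgoing edges of a node: none, one CoT edge, one communication edge, or communication edges
with one label to every other agent. -/
inductive Action (w : ℕ) : Type
  | idle
  | cot (s : Sym)
  | send (s : Sym) (j : Fin w)
  | broadcast (s : Sym)

/-- The token written by an agent for its outgoing edges. -/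
def Action.token {w : ℕ} : Action w → Option Token
  | .idle => none
  | .cot s => some (.sym s)
  | .send s j => some (.send s j)
  | .broadcast s => some (.broadcast s)

/-- The symbol, if any, that agent `i` communicates to agent `j` when `i` performs an action. -/
def Action.message {w : ℕ} (i j : Fin w) : Action w → Option Sym
  | .idle => none
  | .cot _ => none
  | .send s j' => if i ≠ j ∧ j' = j then some s else none
  | .broadcast s => if i ≠ j then some s else none

/-- Node `(i, t)` (agent `i` at time `t`) of a system with lifetimes `len`. -/
def IsNode {w : ℕ} (len : Fin w → ℕ) (v : Fin w × ℕ) : Prop := 1 ≤ v.2 ∧ v.2 ≤ len v.1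

/-- A communication edge from node `u` to node `v`. -/
def CommEdge {w : ℕ} (out : Fin w → ℕ → Action w) (u v : Fin w × ℕ) : Prop :=
  v.2 = u.2 + 1 ∧ ∃ s, (out u.1 u.2).message u.1 v.1 = some s

/-- A CoT edge from node `u` to node `v`. -/
def CoTEdge {w : ℕ} (out : Fin w → ℕ → Action w) (u v : Fin w × ℕ) : Prop :=
  v.2 = u.2 + 1 ∧ v.1 = u.1 ∧ ∃ s, out u.1 u.2 = Action.cot s

/-- The labelled DAG of a run of `w` agents: agent `i` has the nodes `(i, 1), …, (i, len i)`, and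
`out i t` describes the outgoing edges of the node `(i, t)`. -/
structure AgentGraph (w : ℕ) where
  len : Fin w → ℕ
  out : Fin w → ℕ → Action w
  len_pos : ∀ i, 1 ≤ len i
  out_idle : ∀ i t, ¬ IsNode len (i, t) → out i t = Action.idle
  send_ne : ∀ i t s j, out i t = Action.send s j → j ≠ i
  target_isNode : ∀ u v, CommEdge out u v ∨ CoTEdge out u v → IsNode len v
  incoming : ∀ v, IsNode len v → 2 ≤ v.2 → ∃! u, CommEdge out u v ∨ CoTEdge out u v

namespace AgentGraph

variable {w : ℕ} (G : AgentGraph w)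

def Edge (u v : Fin w × ℕ) : Prop := CommEdge G.out u v ∨ CoTEdge G.out u v

/-- Computation depth: the number of edges of a longest directed path. -/
noncomputable def depth : ℕ :=
  sSup {n | ∃ p : List (Fin w × ℕ), (∀ v ∈ p, IsNode G.len v) ∧ p.IsChain G.Edge ∧ p.length = n + 1}

/-- Size: the number of nodes. -/
noncomputable def size : ℕ := {v | IsNode G.len v}.ncard

/-- Communication budget: the number of nodes with an outgoing communication edge. -/
noncomputable def comm : ℕ := {u | ∃ v, CommEdge G.out u v}.ncard

/-- The label of the last CoT edge of agent `i` is `s`. -/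
def LastCoT (i : Fin w) (s : Sym) : Prop :=
  ∃ t, G.out i t = Action.cot s ∧ ∀ t' > t, ∀ s', G.out i t' ≠ Action.cot s'

/-- The label of the incoming communication edge of the node `(i, t)`, if there is one. -/
def received (i : Fin w) (t : ℕ) : Option Sym :=
  (List.finRange w).findSome? (fun j => (G.out j (t - 1)).message j i)

/-- The tokens of agent `i` before its outgoing edges at node `(i, t)`, after an initial context. -/
def before (init : List Token) (i : Fin w) : ℕ → List Token
  | 0 => init
  | t + 1 => before init i t ++ (G.out i t).token.toList ++
      ((G.received i (t + 1)).map Token.receive).toList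

/-- All tokens of agent `i`, without the end-of-sequence token. -/
def tokens (init : List Token) (i : Fin w) : List Token :=
  G.before init i (G.len i) ++ (G.out i (G.len i)).token.toList

/-- The transformer `T` implements the run `G` on the initial contexts `init`: the strings of all
agents fit into the context; every token of an outgoing edge, and the final end-of-sequence token,
is predicted; and where an agent has no outgoing edge because an incoming message overrides the token
it generates, that token is not itself a communication (a generated message is always delivered). -/
def Implements (T : UHAT) (V : Set Token) (init : Fin w → List Token) : Prop :=
  ∀ i : Fin w,
    (G.tokens (init i) i).length + 1 ≤ T.contextSize ∧
    (∀ t, IsNode G.len (i, t) → ∀ a, (G.out i t).token = some a →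
      T.Predicts V (G.before (init i) i t) a) ∧
    T.Predicts V (G.tokens (init i) i) Token.eos ∧
    (∀ t, IsNode G.len (i, t) → t < G.len i → G.out i t = Action.idle →
      ∀ a, a.IsComm → ¬ T.Predicts V (G.before (init i) i t) a)

end AgentGraph

/-! ## The `k`-hop composition task -/

/-- `y` is the value of the term `f₁(⋯(f_k(x))⋯)`, the list being `[f₁, …, f_k]`, where the relation
`R f x y` says that the fact `f(x) = y` is given. -/
def EvalsTo {F D : Type} (R : F → D → D → Prop) : List F → D → D → Prop
  | [], x, y => y = x
  | f :: q, x, y => ∃ z, EvalsTo R q x z ∧ R f z y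

/-- An input of the `k`-hop composition task with `N` facts `fn r (arg r) = val r`, at most one for
each function and argument, listed in an arbitrary order; a query `f₁(⋯(f_k(x))⋯)`, where `f₁` is
`query 0` and `x` is `start`; and its value `answer`, determined by the facts. -/
structure KHop (d m : ℕ → ℕ) (N k : ℕ) where
  fn : Fin N → Fin (m N)
  arg : Fin N → Fin (d N)
  val : Fin N → Fin (d N)
  key_injective : Function.Injective fun r => (fn r, arg r)
  query : Fin k → Fin (m N)
  start : Fin (d N)
  answer : Fin (d N)
  evalsTo_answer : EvalsTo (fun f x y => ∃ r, fn r = f ∧ arg r = x ∧ val r = y)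
    (List.ofFn query) start answer

namespace KHop

variable {d m : ℕ → ℕ} {N k : ℕ} (x : KHop d m N k)

/-- The facts of agent `i` of `w`: consecutive blocks of size `N / w`, rounded. -/
def chunk (w : ℕ) (i : Fin w) : List Sym :=
  ((List.finRange N).filter fun r : Fin N => i.val * N / w ≤ r.val ∧ r.val < (i.val + 1) * N / w).map
    fun r => Sym.fact (x.fn r) (x.arg r) (x.val r)

/-- The initial context of agent `i` of `w`: its facts, the query, and its identifier. -/
def context (w : ℕ) (i : Fin w) : List Token :=
  (x.chunk w i ++ (List.ofFn fun j => Sym.fn (x.query j)) ++ [Sym.obj x.start]).map Token.sym ++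
    [Token.ident i]

end KHop

/-- A multi-agent system for the inputs of the `k`-hop task, with `w N` agents on `N` facts: nested
CoT alphabets `Ξ n` of size polynomial in `n` that contain the input alphabets, and a run for every
input, all of whose labels lie in the alphabet that belongs to the input size `N + k`. -/
structure MultiAgentSystem (w d m : ℕ → ℕ) where
  Ξ : ℕ → Finset Sym
  Ξ_mono : Monotone Ξ
  Ξ_input : ∀ n, inputAlphabet d m n ⊆ (Ξ n : Set Sym)
  Ξ_poly : ∃ p : ℕ, ∀ n, (Ξ n).card ≤ (n + 2) ^ p
  graph : ∀ {N k : ℕ}, KHop d m N k → AgentGraph (w N)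
  label_mem : ∀ {N k : ℕ} (x : KHop d m N k) (i : Fin (w N)) (t : ℕ) (s : Sym),
    (graph x).out i t = Action.cot s ∨ (∃ j, (graph x).out i t = Action.send s j) ∨
      (graph x).out i t = Action.broadcast s → s ∈ Ξ (N + k)

namespace MultiAgentSystem

variable {w d m : ℕ → ℕ} (A : MultiAgentSystem w d m)

/-- For every size `n` one transformer implements the runs on all inputs of size at most `n`, with
numbers of layers and heads bounded independently of `n`. -/
def Expressible : Prop :=
  ∃ L H : ℕ, ∀ n : ℕ, ∃ T : UHAT, T.layers.length ≤ L ∧ (∀ ℓ ∈ T.layers, ℓ.heads ≤ H) ∧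
    ∀ N k : ℕ, 1 ≤ N → 1 ≤ k → N + k ≤ n → ∀ x : KHop d m N k,
      (A.graph x).Implements T (tokenAlphabet (A.Ξ n) n) (x.context (w N))

/-- The system computes `k`-hop composition: for all sizes there is a designated manager agent whose
last CoT edge is labelled with the value of the query, on every input of these sizes. -/
def Computes : Prop :=
  ∀ N k : ℕ, 1 ≤ N → 1 ≤ k → ∃ M : Fin (w N), ∀ x : KHop d m N k,
    (A.graph x).LastCoT M (Sym.obj x.answer)

end MultiAgentSystem

end KHopAgents

/-!
# Communication and depth of multi-agent `k`-hop composition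

**Lower bounds.** Communication predicted at a node is never suppressed, and a predicted symbol is
suppressed only by an incoming message. Hence an agent's behaviour is a function of its initial context and
of the messages that it receives, and runs can be cut and pasted (`AgentGraph.out_eq_of_messages_eq`): if
two runs agree on all communication across a cut of the set of agents, then the runs of the two sides
combine to the run on the combined input. The inputs for which this is used have a single function, whose
facts are pointers between `k + 1` layers of `c` objects. The layers are placed alternately on the two sides
of the cut, and all pointers off a chosen path lead to a sink. Combining the sides of two different paths
gives a walk that misses the end of the first path (`path_eq_of_mixed`), so the `c ^ k` paths need different
transcripts (`pow_le_of_crossing_le`). A transcript of `b` communications has at most `(N + k) ^ O(b)`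
values, if times are polynomially bounded. Cutting the list of facts into two large parts allows `c ≥ √N`
and gives `b = Ω(k)`. Cutting off the manager allows `c = 2`, and the manager takes part in at most two
communications at each time, so that the depth is `Ω(k / log (N + k))`.

**Realizability.** One-hot encodings turn a sequence of lookups, each of which finds the rightmost position
in a relation to what has been found before, into a transformer with two heads, a first layer that merges
token and position, and one layer for each lookup (`exists_uhat_of_lookups`). Five lookups find the fact
that an agent needs for the next hop. Agent `0`, the manager, evaluates the query from the inside, with two
rounds for each hop. In the first one it broadcasts the current object; in the second one the agent that has
the fact replies with the value, while agent `0` broadcasts that the next hop starts. Every node after the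
first one of an agent needs exactly one incoming edge. Therefore agent `1` sends an empty message to agent
`0` in the first round, and if agent `0` has the fact itself, then all agents write notes in the second
round. As there may be no agent `1` and agents do not know their number, agent `0` first tries to answer the
query alone; this succeeds if it is the only agent. An agent that merely waits for a message predicts the
end of the sequence or a note, which the message overrides.
-/

namespace KHopAgents

/-! ### Runs are determined by contexts and messages -/

theorem Action.token_injective {w : ℕ} : Function.Injective (Action.token (w := w)) := by
  intro a b h
  cases a <;> cases b <;> simp_all [Action.token, Fin.ext_iff]

/-- The token of an action that communicates. -/
theorem Action.exists_token_of_message {w : ℕ} {a : Action w} {i j : Fin w} {s : Sym}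
    (h : a.message i j = some s) : ∃ b, a.token = some b ∧ b.IsComm := by
  cases a <;> simp_all [Action.message, Action.token, Token.IsComm]

theorem Action.ne_of_message {w : ℕ} {a : Action w} {i j : Fin w} {s : Sym}
    (h : a.message i j = some s) : i ≠ j := by
  cases a <;> simp_all [Action.message]

theorem UHAT.Predicts.unique {T : UHAT} {V : Set Token} {u : List Token} {a b : Token}
    (ha : T.Predicts V u a) (hb : T.Predicts V u b) : a = b := by
  by_contra h
  exact lt_asymm (ha.2 b hb.1 (Ne.symm h)) (hb.2 a ha.1 h)

namespace AgentGraph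

variable {w : ℕ}

/-- Since every later node has an incoming edge, the actions at time `t` determine the nodes at time
`t + 1`. -/
theorem isNode_iff (G : AgentGraph w) (i : Fin w) (t : ℕ) :
    IsNode G.len (i, t + 1) ↔ t = 0 ∨ (∃ j s, (G.out j t).message j i = some s) ∨
      ∃ s, G.out i t = Action.cot s := by
  constructor
  · intro h
    rcases Nat.eq_zero_or_pos t with h0 | h0
    · exact Or.inl h0
    · obtain ⟨u, hu, -⟩ := G.incoming _ h (by simp; omega)
      obtain ⟨j, t'⟩ := u
      rcases hu with ⟨e, s, hs⟩ | ⟨e, e2, s, hs⟩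
      · obtain rfl : t = t' := by simpa using e
        exact Or.inr (Or.inl ⟨j, s, hs⟩)
      · obtain rfl : t = t' := by simpa using e
        obtain rfl : i = j := e2
        exact Or.inr (Or.inr ⟨s, hs⟩)
  · rintro (rfl | ⟨j, s, h⟩ | ⟨s, h⟩)
    · exact ⟨le_refl _, G.len_pos i⟩
    · exact G.target_isNode (j, t) _ (Or.inl ⟨rfl, s, h⟩)
    · exact G.target_isNode (i, t) _ (Or.inr ⟨rfl, rfl, s, h⟩)

/-- A node with an incoming message has no incoming CoT edge. -/
theorem ne_cot_of_message (G : AgentGraph w) {i j : Fin w} {t : ℕ} {s s' : Sym}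
    (h : (G.out j t).message j i = some s) : G.out i t ≠ Action.cot s' := by
  intro h'
  rcases Nat.eq_zero_or_pos t with rfl | h0
  · have := G.out_idle j 0 (by simp [IsNode])
    simp [this, Action.message] at h
  have e1 : CommEdge G.out (j, t) (i, t + 1) := ⟨rfl, s, h⟩
  have e2 : CoTEdge G.out (i, t) (i, t + 1) := ⟨rfl, rfl, s', h'⟩
  have hn := G.target_isNode _ _ (Or.inl e1)
  have := (G.incoming _ hn (by simp; omega)).unique (Or.inl e1) (Or.inr e2)
  exact Action.ne_of_message h (congrArg Prod.fst this)

theorem before_congr (G G' : AgentGraph w) (init : List Token) (i : Fin w) (t : ℕ)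
    (h1 : ∀ t' < t, G.out i t' = G'.out i t')
    (h2 : ∀ t' < t, ∀ j, (G.out j t').message j i = (G'.out j t').message j i) :
    G.before init i t = G'.before init i t := by
  induction t with
  | zero => rfl
  | succ t ih =>
    have e : G.received i (t + 1) = G'.received i (t + 1) := by
      unfold received
      congr 1
      funext j
      exact h2 t (Nat.lt_succ_self t) j
    simp only [before]
    rw [ih (fun t' h => h1 t' (by omega)) (fun t' h => h2 t' (by omega)), e,
      h1 t (Nat.lt_succ_self t)]

/-- In an implemented run the predicted communications are exactly the performed ones. -/
theorem Implements.token_eq_of_isComm {G : AgentGraph w} {T : UHAT} {V : Set Token}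
    {init : Fin w → List Token} (hG : G.Implements T V init) {i : Fin w} {t : ℕ}
    (hn : IsNode G.len (i, t)) {a : Token} (ha : a.IsComm)
    (hp : T.Predicts V (G.before (init i) i t) a) : (G.out i t).token = some a := by
  obtain ⟨-, h1, h2, h3⟩ := hG i
  rcases h : G.out i t with _ | s | ⟨s, j⟩ | s
  · exfalso
    rcases lt_or_eq_of_le hn.2 with hl | hl
    · exact h3 t hn hl h a ha hp
    · simp only at hl
      subst hl
      simp only [tokens, h, Action.token, Option.toList_none, List.append_nil] at h2
      rw [hp.unique h2] at ha
      exact ha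
  all_goals
    have := h1 t hn _ (by rw [h]; rfl)
    rw [hp.unique this]
    rfl

/-- In an implemented run a predicted symbol is written unless a message arrives. -/
theorem Implements.eq_cot {G : AgentGraph w} {T : UHAT} {V : Set Token}
    {init : Fin w → List Token} (hG : G.Implements T V init) {i : Fin w} {t : ℕ}
    (hn : IsNode G.len (i, t)) {s : Sym}
    (hp : T.Predicts V (G.before (init i) i t) (.sym s))
    (hm : ∀ j, (G.out j t).message j i = none) : G.out i t = Action.cot s := by
  obtain ⟨-, h1, h2, h3⟩ := hG i
  rcases h : G.out i t with _ | s' | ⟨s', j⟩ | s'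
  · exfalso
    rcases lt_or_eq_of_le hn.2 with hl | hl
    · have hn' : IsNode G.len (i, t + 1) := ⟨by simp, hl⟩
      rcases (G.isNode_iff i t).1 hn' with h0 | ⟨j, s, hj⟩ | ⟨s, hs⟩
      · have := hn.1
        simp [h0] at this
      · simp [hm j] at hj
      · simp [h] at hs
    · simp only at hl
      subst hl
      simp only [tokens, h, Action.token, Option.toList_none, List.append_nil] at h2
      exact absurd (hp.unique h2) (by simp)
  all_goals
    have := hp.unique (h1 t hn _ (by rw [h]; rfl))
    simp_all

/-- Cut and paste.  Agent `i` of the run `Z` has the same initial context as in the run `G i`; the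
runs of sender and receiver agree on every message.  Then every agent of `Z` behaves as in its own
run `G i`. -/
theorem out_eq_of_messages_eq {T : UHAT} {V : Set Token} (Z : AgentGraph w)
    (G : Fin w → AgentGraph w) (iZ : Fin w → List Token) (iG : Fin w → Fin w → List Token)
    (hZ : Z.Implements T V iZ) (hG : ∀ i, (G i).Implements T V (iG i))
    (hi : ∀ i, iZ i = iG i i)
    (hm : ∀ i j t, ((G i).out i t).message i j = ((G j).out i t).message i j) (t : ℕ) :
    ∀ i, Z.out i t = (G i).out i t := by
  induction t using Nat.strong_induction_on with
  | _ t ih =>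
  have hprev : ∀ t' < t, ∀ i j, (Z.out j t').message j i = ((G i).out j t').message j i := by
    intro t' ht' i j
    rw [ih t' ht' j, hm]
  have hb : ∀ i, Z.before (iZ i) i t = (G i).before (iG i i) i t := by
    intro i
    rw [hi]
    exact before_congr _ _ _ _ _ (fun t' h => ih t' h i) (fun t' h j => hprev t' h i j)
  have hnode : ∀ i, IsNode Z.len (i, t) ↔ IsNode (G i).len (i, t) := by
    intro i
    rcases t with _ | t
    · simp [IsNode]
    · rw [isNode_iff, isNode_iff, ih t (Nat.lt_succ_self t) i]
      simp only [hprev t (Nat.lt_succ_self t)]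
  -- A predicted communication is never suppressed, so communications depend on the own context only.
  have hcomm : ∀ i a, a.IsComm →
      ((Z.out i t).token = some a ↔ ((G i).out i t).token = some a) := by
    intro i a ha
    by_cases hn : IsNode Z.len (i, t)
    · have hn' := (hnode i).1 hn
      constructor
      · intro h
        apply (hG i).token_eq_of_isComm hn' ha
        rw [← hb]
        exact (hZ i).2.1 t hn a h
      · intro h
        apply hZ.token_eq_of_isComm hn ha
        rw [hb]
        exact (hG i i).2.1 t hn' a h
    · rw [Z.out_idle i t hn, (G i).out_idle i t (fun h => hn ((hnode i).2 h))]
  have hmsg : ∀ i j, (Z.out i t).message i j = ((G i).out i t).message i j := by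
    intro i j
    by_cases h : ∃ a, a.IsComm ∧ (Z.out i t).token = some a
    · obtain ⟨a, ha, h⟩ := h
      rw [Action.token_injective (h.trans ((hcomm i a ha).1 h).symm)]
    · have h' : ¬ ∃ a, a.IsComm ∧ ((G i).out i t).token = some a := fun ⟨a, ha, h2⟩ =>
        h ⟨a, ha, (hcomm i a ha).2 h2⟩
      have aux : ∀ b : Action w, (¬ ∃ a, a.IsComm ∧ b.token = some a) →
          b.message i j = none := by
        intro b hb
        by_contra hne
        obtain ⟨s, hs⟩ := Option.ne_none_iff_exists'.1 hne
        obtain ⟨c, hc, hc'⟩ := Action.exists_token_of_message hs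
        exact hb ⟨c, hc', hc⟩
      rw [aux _ h, aux _ h']
  -- A CoT token is written exactly if no message arrives.
  have hcot : ∀ i s, Z.out i t = Action.cot s ↔ (G i).out i t = Action.cot s := by
    intro i s
    have hin : ∀ j, (Z.out j t).message j i = ((G i).out j t).message j i := by
      intro j
      rw [hmsg, hm]
    by_cases hn : IsNode Z.len (i, t)
    · have hn' := (hnode i).1 hn
      constructor
      · intro h
        apply (hG i).eq_cot hn'
        · rw [← hb]
          exact (hZ i).2.1 t hn _ (by rw [h]; rfl)
        · intro j
          rw [← hin]
          by_contra hne
          obtain ⟨s', hs⟩ := Option.ne_none_iff_exists'.1 hne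
          exact Z.ne_cot_of_message hs h
      · intro h
        apply hZ.eq_cot hn
        · rw [hb]
          exact (hG i i).2.1 t hn' _ (by rw [h]; rfl)
        · intro j
          rw [hin]
          by_contra hne
          obtain ⟨s', hs⟩ := Option.ne_none_iff_exists'.1 hne
          exact (G i).ne_cot_of_message hs h
    · rw [Z.out_idle i t hn, (G i).out_idle i t (fun h => hn ((hnode i).2 h))]
  intro i
  have aux : ∀ a b : Action w, (∀ c, c.IsComm → (a.token = some c ↔ b.token = some c)) →
      (∀ s, a = Action.cot s ↔ b = Action.cot s) → a = b := by
    intro a b h1 h2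
    rcases a with _ | s | ⟨s, j⟩ | s
    · rcases b with _ | s | ⟨s, j⟩ | s
      · rfl
      · exact (h2 s).2 rfl
      · exact Action.token_injective ((h1 (.send s j) trivial).2 rfl)
      · exact Action.token_injective ((h1 (.broadcast s) trivial).2 rfl)
    · exact ((h2 s).1 rfl).symm
    · exact Action.token_injective ((h1 (.send s j) trivial).1 rfl).symm
    · exact Action.token_injective ((h1 (.broadcast s) trivial).1 rfl).symm
  exact aux _ _ (hcomm i) (hcot i)

theorem LastCoT.unique {G : AgentGraph w} {i : Fin w} {s s' : Sym} (h : G.LastCoT i s)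
    (h' : G.LastCoT i s') : s = s' := by
  obtain ⟨t, h1, h2⟩ := h
  obtain ⟨t', h1', h2'⟩ := h'
  rcases lt_trichotomy t t' with hl | rfl | hl
  · exact absurd h1' (h2 t' hl s')
  · rw [h1] at h1'
    exact Action.cot.inj h1'
  · exact absurd h1 (h2' t hl s)

/-! ### Depth and times -/

/-- Edges advance time by one, so that lifetimes bound the lengths of paths. -/
theorem path_length_le (G : AgentGraph w) {B : ℕ} (hB : ∀ i, G.len i ≤ B)
    {p : List (Fin w × ℕ)} (h1 : ∀ v ∈ p, IsNode G.len v) (h2 : p.IsChain G.Edge) {n : ℕ}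
    (h3 : p.length = n + 1) : n ≤ B := by
  have key : ∀ m (hm : m < p.length), m ≤ (p[m]).2 := by
    intro m
    induction m with
    | zero => intro _; exact Nat.zero_le _
    | succ m ih =>
      intro hm
      have h := List.isChain_iff_getElem.1 h2 m (by omega)
      have e : (p[m + 1]).2 = (p[m]).2 + 1 := by
        rcases h with h | h
        · exact h.1
        · exact h.1
      have := ih (by omega)
      omega
  exact (key n (by omega)).trans ((h1 p[n] (List.getElem_mem _)).2.trans (hB _))

theorem depth_le_of_len_le (G : AgentGraph w) {B : ℕ} (h : ∀ i, G.len i ≤ B) : G.depth ≤ B :=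
  csSup_le' fun _ ⟨_, h1, h2, h3⟩ => G.path_length_le h h1 h2 h3

/-- The supremum in the definition of the depth is over a bounded set, hence attained. -/
theorem bddAbove_path (G : AgentGraph w) :
    BddAbove {n | ∃ p : List (Fin w × ℕ), (∀ v ∈ p, IsNode G.len v) ∧ p.IsChain G.Edge ∧
      p.length = n + 1} :=
  ⟨∑ i, G.len i, fun _ ⟨_, h1, h2, h3⟩ => G.path_length_le (fun i =>
    Finset.single_le_sum (f := G.len) (fun _ _ => Nat.zero_le _) (Finset.mem_univ i)) h1 h2 h3⟩

/-- Following incoming edges backwards from a node at time `t` gives a path of `t - 1` edges. -/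
theorem le_depth (G : AgentGraph w) {i : Fin w} {t : ℕ} (h : IsNode G.len (i, t)) :
    t ≤ G.depth + 1 := by
  suffices H : ∀ t i, IsNode G.len (i, t + 1) → ∃ p : List (Fin w × ℕ),
      (∀ v ∈ p, IsNode G.len v) ∧ p.IsChain G.Edge ∧ p.length = t + 1 ∧
        ∃ hp : p ≠ [], p.getLast hp = (i, t + 1) by
    obtain ⟨t, rfl⟩ := Nat.exists_eq_add_of_le' h.1
    obtain ⟨p, h1, h2, h3, -⟩ := H t i h
    exact Nat.succ_le_succ (le_csSup G.bddAbove_path ⟨p, h1, h2, h3⟩)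
  intro t
  induction t with
  | zero => exact fun i h => ⟨[(i, 1)], by simpa using h, by simp, by simp, by simp⟩
  | succ t ih =>
    intro i h
    obtain ⟨⟨j, t'⟩, hu, -⟩ := G.incoming _ h (by simp)
    have ht : t' = t + 1 := by
      rcases hu with hu | hu
      · have := hu.1; simp at this; omega
      · have := hu.1; simp at this; omega
    subst ht
    have hn : IsNode G.len (j, t + 1) := by
      by_contra hn
      have := G.out_idle j _ hn
      rcases hu with ⟨-, s, hs⟩ | ⟨-, e, s, hs⟩
      · simp [this, Action.message] at hs
      · simp [this] at hs
    obtain ⟨p, h1, h2, h3, hp, h4⟩ := ih j hn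
    refine ⟨p ++ [(i, t + 1 + 1)], ?_, ?_, by simp [h3], by simp, by simp⟩
    · intro v hv
      rcases List.mem_append.1 hv with hv | hv
      · exact h1 v hv
      · rw [List.mem_singleton.1 hv]; exact h
    · rw [List.isChain_append]
      refine ⟨h2, by simp, ?_⟩
      intro x hx y hy
      rw [List.getLast?_eq_some_getLast hp, h4] at hx
      simp at hx hy
      subst hx hy
      exact hu

theorem isNode_of_message (G : AgentGraph w) {i j : Fin w} {t : ℕ} {s : Sym}
    (h : (G.out i t).message i j = some s) : IsNode G.len (i, t) := by
  by_contra hn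
  simp [G.out_idle i t hn, Action.message] at h

end AgentGraph

/-! ### Blocks of facts -/

theorem block_disjoint {N w : ℕ} {i j r : ℕ} (h1 : i * N / w ≤ r)
    (h2 : r < (j + 1) * N / w) : i ≤ j := by
  by_contra h
  have : (j + 1) * N / w ≤ i * N / w := Nat.div_le_div_right (Nat.mul_le_mul_right _ (by omega))
  omega

theorem exists_block {N w : ℕ} (r : ℕ) (hw : 1 ≤ w) (hr : r < N) :
    ∃ i < w, i * N / w ≤ r ∧ r < (i + 1) * N / w := by
  have h : ∀ n, r < n * N / w → ∃ i < n, i * N / w ≤ r ∧ r < (i + 1) * N / w := by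
    intro n
    induction n with
    | zero => simp
    | succ n ih =>
      intro h
      by_cases hn : r < n * N / w
      · obtain ⟨i, h1, h2⟩ := ih hn
        exact ⟨i, by omega, h2⟩
      · exact ⟨n, by omega, by omega, h⟩
  exact h w (by rwa [Nat.mul_div_cancel_left _ (by omega)])

/-- The agent whose block of facts contains the position `r`. -/
noncomputable def owner {N w : ℕ} (hw : 1 ≤ w) (r : Fin N) : Fin w :=
  ⟨(exists_block r.1 hw r.2).choose, (exists_block r.1 hw r.2).choose_spec.1⟩

theorem owner_eq_iff {N w : ℕ} (hw : 1 ≤ w) (r : Fin N) (i : Fin w) :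
    owner hw r = i ↔ i.1 * N / w ≤ r.1 ∧ r.1 < (i.1 + 1) * N / w := by
  have h := (exists_block r.1 hw r.2).choose_spec.2
  constructor
  · rintro rfl
    exact h
  · intro h'
    apply Fin.ext
    exact le_antisymm (block_disjoint h.1 h'.2) (block_disjoint h'.1 h.2)

/-! ### A fooling set of paths -/

open Classical in
/-- The pointer function of the path `v`: it sends the vertex of the path in layer `j < k` to the
vertex of the path in layer `j + 1`, and everything else to the sink. -/
noncomputable def pathFun {N c : ℕ} (k : ℕ) (vertex : ℕ → Fin c → Fin N) (sink : Fin N)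
    (v : ℕ → Fin c) (r : Fin N) : Fin N :=
  if h : ∃ j < k, r = vertex j (v j) then vertex (h.choose + 1) (v (h.choose + 1)) else sink

section pathFun

variable {N c k : ℕ} {vertex : ℕ → Fin c → Fin N} {sink : Fin N}

theorem exists_of_pathFun_ne {v : ℕ → Fin c} {r : Fin N}
    (h : pathFun k vertex sink v r ≠ sink) : ∃ j < k, r = vertex j (v j) ∧
      pathFun k vertex sink v r = vertex (j + 1) (v (j + 1)) := by
  unfold pathFun at *
  split_ifs at h ⊢ with h'
  · exact ⟨h'.choose, h'.choose_spec.1, h'.choose_spec.2, rfl⟩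
  · exact absurd rfl h

variable (hinj : ∀ i ≤ k, ∀ j ≤ k, ∀ a b, vertex i a = vertex j b → i = j ∧ a = b)
  (hsink : ∀ j ≤ k, ∀ a, vertex j a ≠ sink)
include hinj

theorem pathFun_vertex {v : ℕ → Fin c} {j : ℕ} (hj : j < k) :
    pathFun k vertex sink v (vertex j (v j)) = vertex (j + 1) (v (j + 1)) := by
  have h : ∃ i < k, vertex j (v j) = vertex i (v i) := ⟨j, hj, rfl⟩
  have e := (hinj j hj.le _ h.choose_spec.1.le _ _ h.choose_spec.2).1
  rw [pathFun, dif_pos h, ← e]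

theorem pathFun_iterate (v : ℕ → Fin c) {j : ℕ} (hj : j ≤ k) :
    (pathFun k vertex sink v)^[j] (vertex 0 (v 0)) = vertex j (v j) := by
  induction j with
  | zero => rfl
  | succ j ih => rw [Function.iterate_succ_apply', ih (by omega), pathFun_vertex hinj (by omega)]

include hsink

/-- Fooling property.  The layers belong alternately to two parties, the last hop starts at a vertex of
the second party (`own = false`).  If the pointers of the first party are taken from the path `v` and
those of the second party from the path `v'`, then the end of `v` is reached only if the two paths are
equal. -/
theorem path_eq_of_mixed (own : Fin N → Bool)
    (hown : ∀ j ≤ k, ∀ a, own (vertex j a) = decide ((k + j) % 2 = 0))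
    (v v' : ℕ → Fin c) (h0 : v 0 = v' 0)
    (h : (fun r => if own r then pathFun k vertex sink v r else
      pathFun k vertex sink v' r)^[k] (vertex 0 (v 0)) = vertex k (v k)) :
    ∀ j ≤ k, v j = v' j := by
  set F : Fin N → Fin N := fun r => if own r then pathFun k vertex sink v r else
      pathFun k vertex sink v' r with hF
  have hFs : F sink = sink := by
    have : ∀ v, pathFun k vertex sink v sink = sink := by
      intro v
      by_contra hne
      obtain ⟨j, hj, e, -⟩ := exists_of_pathFun_ne hne
      exact hsink j hj.le _ e.symm
    simp [hF, this]
  have hu : ∀ j ≤ k, F^[j] (vertex 0 (v 0)) ≠ sink := by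
    intro j hj e
    apply hsink k le_rfl (v k)
    rw [← h, ← Nat.sub_add_cancel hj, Function.iterate_add_apply, e, Function.iterate_fixed hFs]
  have step : ∀ j < k, ∀ a, F^[j] (vertex 0 (v 0)) = vertex j a →
      (decide ((k + j) % 2 = 0) = true → a = v j ∧
        F^[j + 1] (vertex 0 (v 0)) = vertex (j + 1) (v (j + 1))) ∧
      (decide ((k + j) % 2 = 0) = false → a = v' j ∧
        F^[j + 1] (vertex 0 (v 0)) = vertex (j + 1) (v' (j + 1))) := by
    intro j hj a ha
    have hne := hu (j + 1) hj
    rw [Function.iterate_succ_apply', ha] at hne ⊢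
    simp only [hF, hown j hj.le] at hne ⊢
    constructor
    · intro hs
      simp only [hs, if_true] at hne ⊢
      obtain ⟨i, hi, e1, e2⟩ := exists_of_pathFun_ne hne
      obtain ⟨rfl, rfl⟩ := hinj _ hj.le _ hi.le _ _ e1
      exact ⟨rfl, e2⟩
    · intro hs
      simp only [hs, Bool.false_eq_true, if_false] at hne ⊢
      obtain ⟨i, hi, e1, e2⟩ := exists_of_pathFun_ne hne
      obtain ⟨rfl, rfl⟩ := hinj _ hj.le _ hi.le _ _ e1
      exact ⟨rfl, e2⟩
  have main : ∀ j ≤ k, F^[j] (vertex 0 (v 0)) = vertex j (v j) ∧ v j = v' j := by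
    intro j
    induction j with
    | zero => exact fun _ => ⟨rfl, h0⟩
    | succ j ih =>
      intro hj
      obtain ⟨ih1, ih2⟩ := ih (by omega)
      obtain ⟨s1, s2⟩ := step j (by omega) _ ih1
      rcases Nat.lt_or_ge (j + 1) k with hlt | hge
      · rcases Nat.mod_two_eq_zero_or_one (k + j) with hm | hm
        · have e := (s1 (by simp [hm])).2
          have := ((step (j + 1) hlt _ e).2 (by
            rw [decide_eq_false_iff_not]; omega)).1
          exact ⟨e, this⟩
        · have e := (s2 (by simp [hm])).2
          have := ((step (j + 1) hlt _ e).1 (by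
            rw [decide_eq_true_iff]; omega)).1
          exact ⟨by rw [e, this], this.symm⟩
      · obtain rfl : k = j + 1 := by omega
        have e := (s2 (by rw [decide_eq_false_iff_not]; omega)).2
        exact ⟨h, (hinj _ le_rfl _ le_rfl _ _ (h.symm.trans e)).2⟩
  exact fun j hj => (main j hj).2

end pathFun

/-! ### Inputs with a single function -/

/-- The input whose facts are the values of a function `F` on the first `N` objects, listed in
order. -/
def functionInput {d m : ℕ → ℕ} {N : ℕ} (hd : N ≤ d N) (hm : 1 ≤ m N) (k : ℕ) (start : Fin N)
    (F : Fin N → Fin N) : KHop d m N k where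
  fn _ := ⟨0, hm⟩
  arg r := r.castLE hd
  val r := (F r).castLE hd
  key_injective r s h := by simpa using h
  query _ := ⟨0, hm⟩
  start := start.castLE hd
  answer := (F^[k] start).castLE hd
  evalsTo_answer := by
    rw [List.ofFn_const]
    generalize hy : F^[k] start = y
    induction k generalizing y with
    | zero =>
      subst hy
      rfl
    | succ k ih =>
      rw [Function.iterate_succ_apply'] at hy
      subst hy
      exact ⟨_, ih _ rfl, F^[k] start, rfl, rfl, rfl⟩

theorem functionInput_context_congr {d m : ℕ → ℕ} {N : ℕ} (hd : N ≤ d N) (hm : 1 ≤ m N) (k : ℕ)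
    (start : Fin N) {F F' : Fin N → Fin N} {w : ℕ} (hw : 1 ≤ w) {i : Fin w}
    (h : ∀ r, owner hw r = i → F r = F' r) :
    (functionInput hd hm k start F).context w i = (functionInput hd hm k start F').context w i := by
  have e : (functionInput hd hm k start F).chunk w i =
      (functionInput hd hm k start F').chunk w i := by
    unfold KHop.chunk
    apply List.map_congr_left
    intro r hr
    have := h r ((owner_eq_iff hw r i).2 (by simpa using (List.mem_filter.1 hr).2))
    simp [functionInput, this]
  unfold KHop.context
  rw [e]
  rfl

/-! ### Counting transcripts -/

/-- Sets of at most `b` elements are encoded by `b` entries, each an element or blank. -/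
theorem card_le_pow_of_injective {α U : Type*} [Fintype α] [Fintype U] (f : α → Finset U)
    (hf : Function.Injective f) {b : ℕ} (hb : ∀ a, (f a).card ≤ b) :
    Fintype.card α ≤ (Fintype.card U + 1) ^ b := by
  classical
  have h : Function.Injective (fun a (i : Fin b) => (f a).toList[i.1]?) := by
    intro a a' h
    apply hf
    have key : ∀ a u, u ∈ f a ↔ ∃ i : Fin b, (f a).toList[i.1]? = some u := by
      intro a u
      rw [← Finset.mem_toList, List.mem_iff_getElem?]
      constructor
      · rintro ⟨i, hi⟩
        obtain ⟨hi', -⟩ := List.getElem?_eq_some_iff.1 hi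
        rw [Finset.length_toList] at hi'
        exact ⟨⟨i, hi'.trans_le (hb a)⟩, hi⟩
      · rintro ⟨i, hi⟩
        exact ⟨i, hi⟩
    ext u
    rw [key, key]
    simp only [funext_iff] at h
    simp only [h]
  simpa using Fintype.card_le_of_injective _ h

/-! ### Communication across a cut -/

/-- The nodes with a communication edge that crosses the cut given by the set `S` of agents. -/
def AgentGraph.crossing {w : ℕ} (G : AgentGraph w) (S : Set (Fin w)) : Set (Fin w × ℕ) :=
  {u | ∃ v, CommEdge G.out u v ∧ ¬ (u.1 ∈ S ↔ v.1 ∈ S)}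

/-- The action with a given label, a message to `j` or, for `none`, a broadcast. -/
def commAction {w : ℕ} (s : Sym) : Option (Fin w) → Action w
  | none => .broadcast s
  | some j => .send s j

theorem Action.exists_commAction {w : ℕ} {a : Action w} {i j : Fin w} {s : Sym}
    (h : a.message i j = some s) : ∃ o, a = commAction s o := by
  rcases a with _ | s' | ⟨s', j'⟩ | s'
  · simp [Action.message] at h
  · simp [Action.message] at h
  · refine ⟨some j', ?_⟩
    simp only [Action.message] at h
    split_ifs at h
    cases h
    rfl
  · refine ⟨none, ?_⟩
    simp only [Action.message] at h
    split_ifs at h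
    cases h
    rfl

theorem commAction_injective {w : ℕ} {s s' : Sym} {o o' : Option (Fin w)}
    (h : commAction s o = commAction s' o') : s = s' ∧ o = o' := by
  cases o <;> cases o' <;> simp_all [commAction]

namespace AgentGraph

variable {w : ℕ}

/-- The communications across the cut `S` with labels in `X` at times up to `B`: sender, time, label
and target. -/
noncomputable def transcript (G : AgentGraph w) (S : Set (Fin w)) (X : Finset Sym) (B : ℕ) :
    Finset (Fin w × Fin (B + 1) × {s // s ∈ X} × Option (Fin w)) :=
  Set.Finite.toFinset (s := {q | (q.1, q.2.1.1) ∈ G.crossing S ∧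
    G.out q.1 q.2.1.1 = commAction q.2.2.1.1 q.2.2.2}) (Set.toFinite _)

theorem finite_setOf_commEdge (G : AgentGraph w) : {u | ∃ v, CommEdge G.out u v}.Finite := by
  apply Set.Finite.subset (s := (Set.univ : Set (Fin w)) ×ˢ Set.Iic (∑ i, G.len i))
  · exact Set.finite_univ.prod (Set.finite_Iic _)
  · rintro ⟨i, t⟩ ⟨v, -, s, hs⟩
    refine ⟨trivial, (G.isNode_of_message hs).2.trans ?_⟩
    exact Finset.single_le_sum (f := G.len) (fun _ _ => Nat.zero_le _) (Finset.mem_univ i)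

theorem crossing_subset (G : AgentGraph w) (S : Set (Fin w)) :
    G.crossing S ⊆ {u | ∃ v, CommEdge G.out u v} :=
  fun _ ⟨v, h, _⟩ => ⟨v, h⟩

theorem crossing_finite (G : AgentGraph w) (S : Set (Fin w)) : (G.crossing S).Finite :=
  G.finite_setOf_commEdge.subset (G.crossing_subset S)

theorem card_transcript_le (G : AgentGraph w) (S : Set (Fin w)) (X : Finset Sym) (B : ℕ) :
    (G.transcript S X B).card ≤ (G.crossing S).ncard := by
  rw [← Set.ncard_coe_finset]
  refine Set.ncard_le_ncard_of_injOn (fun q => (q.1, q.2.1.1)) ?_ ?_ (G.crossing_finite S)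
  · intro q hq
    exact (Set.Finite.mem_toFinset _ |>.1 hq).1
  · rintro ⟨i, t, s, o⟩ hq ⟨i', t', s', o'⟩ hq' h
    have h1 := (Set.Finite.mem_toFinset _ |>.1 hq).2
    have h2 := (Set.Finite.mem_toFinset _ |>.1 hq').2
    simp only [Prod.mk.injEq] at h
    obtain ⟨rfl, h⟩ := h
    obtain rfl := Fin.ext h
    obtain ⟨e1, e2⟩ := commAction_injective (h1.symm.trans h2)
    simp only at e1 e2
    rw [Subtype.ext e1, e2]

/-- Runs with the same transcript have the same messages across the cut. -/
theorem message_eq_of_transcript_eq {G G' : AgentGraph w} {S : Set (Fin w)} {X : Finset Sym} {B : ℕ}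
    (h : G.transcript S X B = G'.transcript S X B)
    (hX : ∀ i t s, (∃ o, G.out i t = commAction s o) → s ∈ X)
    (hX' : ∀ i t s, (∃ o, G'.out i t = commAction s o) → s ∈ X)
    (hB : ∀ i t, IsNode G.len (i, t) → t ≤ B) (hB' : ∀ i t, IsNode G'.len (i, t) → t ≤ B)
    {i j : Fin w} (hij : ¬ (i ∈ S ↔ j ∈ S)) (t : ℕ) :
    (G.out i t).message i j = (G'.out i t).message i j := by
  have aux : ∀ (G G' : AgentGraph w), G.transcript S X B = G'.transcript S X B →
      (∀ i t s, (∃ o, G.out i t = commAction s o) → s ∈ X) →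
      (∀ i t, IsNode G.len (i, t) → t ≤ B) → ∀ s, (G.out i t).message i j = some s →
      (G'.out i t).message i j = some s := by
    intro G G' h hX hB s hs
    obtain ⟨o, ho⟩ := Action.exists_commAction hs
    have hmem : (i, (⟨t, Nat.lt_succ_of_le (hB i t (G.isNode_of_message hs))⟩ : Fin (B + 1)),
        (⟨s, hX i t s ⟨o, ho⟩⟩ : {s // s ∈ X}), o) ∈ G.transcript S X B :=
      (Set.Finite.mem_toFinset _).2 ⟨⟨(j, t + 1), ⟨rfl, s, hs⟩, hij⟩, ho⟩
    rw [h] at hmem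
    have := (Set.Finite.mem_toFinset _ |>.1 hmem).2
    simp only at this
    rw [this, ← ho, hs]
  ext s
  exact ⟨aux G G' h hX hB s, aux G' G h.symm hX' hB' s⟩

end AgentGraph

/-- The main counting bound.  The agents are split into the set `S`, which contains the manager, and
its complement, and both sides have room for `k + 1` layers of `c` facts and one more fact.  Then the
transcripts of the communication across the cut distinguish the `c ^ k` paths through the layers. -/
theorem pow_le_of_crossing_le {w d m : ℕ → ℕ} (A : MultiAgentSystem w d m) (hE : A.Expressible)
    {N k : ℕ} (hN : 1 ≤ N) (hk : 1 ≤ k) (hd : N ≤ d N) (hm : 1 ≤ m N) (hw : 1 ≤ w N)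
    {M : Fin (w N)} (hM : ∀ x : KHop d m N k, (A.graph x).LastCoT M (Sym.obj x.answer))
    {S : Set (Fin (w N))} (hMS : M ∈ S) {c : ℕ}
    (hS : (k + 1) * c + 1 ≤ {r : Fin N | owner hw r ∈ S}.ncard)
    (hS' : (k + 1) * c + 1 ≤ {r : Fin N | owner hw r ∉ S}.ncard) {B b : ℕ}
    (hB : ∀ (x : KHop d m N k) i t, IsNode (A.graph x).len (i, t) → t ≤ B)
    (hb : ∀ x : KHop d m N k, ((A.graph x).crossing S).ncard ≤ b) :
    c ^ k ≤ (w N * ((B + 1) * ((A.Ξ (N + k)).card * (w N + 1))) + 1) ^ b := by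
  classical
  rcases Nat.eq_zero_or_pos c with rfl | hc
  · rw [zero_pow (by omega)]
    exact Nat.zero_le _
  -- Place the layers alternately on the two sides, so that layer `k - 1`, where the last hop starts,
  -- is not on the manager's side, and the sink on the manager's side.
  have emb : ∀ P : Set (Fin N), (k + 1) * c + 1 ≤ P.ncard →
      Nonempty (Option (Fin (k + 1) × Fin c) ↪ P) := by
    intro P hP
    apply Function.Embedding.nonempty_of_card_le
    rw [← Nat.card_eq_fintype_card (α := P), Nat.card_coe_set_eq]
    simpa using hP
  obtain ⟨e1⟩ := emb _ hS
  obtain ⟨e2⟩ := emb _ hS'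
  let vertex : ℕ → Fin c → Fin N := fun j a =>
    if (k + j) % 2 = 0 then (e1 (some (Fin.ofNat (k + 1) j, a))).1
    else (e2 (some (Fin.ofNat (k + 1) j, a))).1
  let sink : Fin N := (e1 none).1
  have hval : ∀ j ≤ k, (Fin.ofNat (k + 1) j).1 = j := fun j hj => by
    simp only [Fin.val_ofNat]
    exact Nat.mod_eq_of_lt (by omega)
  let own : Fin N → Bool := fun r => decide (owner hw r ∈ S)
  have hown : ∀ j ≤ k, ∀ a, own (vertex j a) = decide ((k + j) % 2 = 0) := by
    intro j _ a
    by_cases h : (k + j) % 2 = 0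
    · simp only [vertex, own, h, if_true, decide_true, decide_eq_true_eq]
      exact (e1 _).2
    · simp only [vertex, own, h, if_false, decide_false, decide_eq_false_iff_not]
      exact (e2 _).2
  have hinj : ∀ i ≤ k, ∀ j ≤ k, ∀ a b, vertex i a = vertex j b → i = j ∧ a = b := by
    intro i hi j hj a b h
    have hp : decide ((k + i) % 2 = 0) = decide ((k + j) % 2 = 0) := by
      rw [← hown i hi a, ← hown j hj b, h]
    have hp' : (k + i) % 2 = 0 ↔ (k + j) % 2 = 0 := by simpa using hp
    by_cases h' : (k + j) % 2 = 0
    · simp only [vertex, h', hp'.2 h', if_true] at h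
      have := e1.injective (Subtype.ext h)
      simp only [Option.some.injEq, Prod.mk.injEq] at this
      refine ⟨?_, this.2⟩
      rw [← hval i hi, this.1, hval j hj]
    · have h'' : ¬ (k + i) % 2 = 0 := fun h => h' (hp'.1 h)
      simp only [vertex, h', h'', if_false] at h
      have := e2.injective (Subtype.ext h)
      simp only [Option.some.injEq, Prod.mk.injEq] at this
      refine ⟨?_, this.2⟩
      rw [← hval i hi, this.1, hval j hj]
  have hsink : ∀ j ≤ k, ∀ a, vertex j a ≠ sink := by
    intro j _ a h
    simp only [vertex, sink] at h
    split_ifs at h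
    · exact absurd (e1.injective (Subtype.ext h)) (by simp)
    · have h2 : owner hw (e1 none).1 ∉ S := h ▸ (e2 _).2
      exact h2 (e1 none).2
  -- The inputs of the fooling set.
  let path : (Fin k → Fin c) → ℕ → Fin c := fun p j =>
    if h : 1 ≤ j ∧ j ≤ k then p ⟨j - 1, by omega⟩ else ⟨0, hc⟩
  let start : Fin N := vertex 0 ⟨0, hc⟩
  let input : (Fin N → Fin N) → KHop d m N k := fun F => functionInput hd hm k start F
  let F : (Fin k → Fin c) → Fin N → Fin N := fun p => pathFun k vertex sink (path p)
  have hX : ∀ (x : KHop d m N k) i t s, (∃ o, (A.graph x).out i t = commAction s o) →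
      s ∈ A.Ξ (N + k) := by
    rintro x i t s ⟨o | j, ho⟩
    · exact A.label_mem x i t s (Or.inr (Or.inr ho))
    · exact A.label_mem x i t s (Or.inr (Or.inl ⟨j, ho⟩))
  have key : Function.Injective fun p : Fin k → Fin c =>
      (A.graph (input (F p))).transcript S (A.Ξ (N + k)) B := by
    intro p p' hpp
    -- Agents in `S` get the facts of the first input, the others those of the second one.
    let Fz : Fin N → Fin N := fun r => if own r then F p r else F p' r
    obtain ⟨L, H, hLH⟩ := hE
    obtain ⟨T, -, -, hT⟩ := hLH (N + k)
    have hout := AgentGraph.out_eq_of_messages_eq (A.graph (input Fz))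
      (fun i => if i ∈ S then A.graph (input (F p)) else A.graph (input (F p')))
      ((input Fz).context (w N))
      (fun i => if i ∈ S then (input (F p)).context (w N) else (input (F p')).context (w N))
      (hT N k hN hk le_rfl _)
      (by
        intro i
        by_cases h : i ∈ S
        · simpa only [h, if_true] using hT N k hN hk le_rfl _
        · simpa only [h, if_false] using hT N k hN hk le_rfl _)
      (by
        intro i
        by_cases h : i ∈ S
        · simp only [h, if_true]
          apply functionInput_context_congr hd hm k start hw
          rintro r rfl
          simp [Fz, own, h]
        · simp only [h, if_false]
          apply functionInput_context_congr hd hm k start hw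
          rintro r rfl
          simp [Fz, own, h])
      (by
        intro i j t
        by_cases h : i ∈ S <;> by_cases h' : j ∈ S
        · simp only [h, h', if_true]
        · simp only [h, h', if_true, if_false]
          exact AgentGraph.message_eq_of_transcript_eq hpp (hX _) (hX _) (hB _) (hB _)
            (by simp [h, h']) t
        · simp only [h, h', if_true, if_false]
          exact AgentGraph.message_eq_of_transcript_eq hpp.symm (hX _) (hX _) (hB _) (hB _)
            (by simp [h, h']) t
        · simp only [h, h', if_false])
    have hlast : (A.graph (input (F p))).LastCoT M (Sym.obj (input Fz).answer) := by
      obtain ⟨t, h1, h2⟩ := hM (input Fz)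
      simp only [hout _ M, hMS, if_true] at h1 h2
      exact ⟨t, h1, h2⟩
    have hans := hlast.unique (hM (input (F p)))
    have hans' : Fz^[k] start = (F p)^[k] start := by
      have : ((input Fz).answer : ℕ) = (input (F p)).answer := Sym.obj.inj hans
      exact Fin.ext this
    have h0 : ∀ p, path p 0 = ⟨0, hc⟩ := fun p => by simp [path]
    have hpath := path_eq_of_mixed hinj hsink own hown (path p) (path p')
      ((h0 p).trans (h0 p').symm) (by
        have h1 := pathFun_iterate (sink := sink) hinj (path p) le_rfl
        rw [h0 p] at h1 ⊢
        rw [← h1]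
        exact hans')
    funext q
    have := hpath (q.1 + 1) q.2
    simpa [path, q.2] using this
  have := card_le_pow_of_injective _ key (b := b)
    (fun p => (AgentGraph.card_transcript_le _ _ _ _).trans (hb _))
  simpa using this

/-! ### The two lower bounds -/

theorem ncard_fin_interval {N a b : ℕ} (hb : b ≤ N) :
    {r : Fin N | a ≤ r.1 ∧ r.1 < b}.ncard = b - a := by
  rw [← Nat.card_Ico, ← Set.ncard_coe_finset]
  apply Set.ncard_congr (fun r _ => r.1)
  · intro r hr
    simpa using hr
  · intro r s _ _ h
    exact Fin.ext h
  · intro r hr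
    have hr' : a ≤ r ∧ r < b := by simpa using hr
    exact ⟨⟨r, by omega⟩, hr', rfl⟩

/-- A block has at least `N / w` facts. -/
theorem le_ncard_owner_eq {N w : ℕ} (hw : 1 ≤ w) (i : Fin w) :
    N / w ≤ {r : Fin N | owner hw r = i}.ncard := by
  simp only [owner_eq_iff]
  rw [ncard_fin_interval]
  · rw [Nat.le_sub_iff_add_le (Nat.div_le_div_right (Nat.mul_le_mul_right _ (by omega))), add_comm,
      add_mul, one_mul]
    exact Nat.div_add_div_le_add_div
  · exact Nat.div_le_of_le_mul (Nat.mul_le_mul_right _ i.2)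

theorem owner_lt_iff {N w s : ℕ} (hw : 1 ≤ w) (r : Fin N) :
    (owner hw r).1 < s ↔ r.1 < s * N / w := by
  obtain ⟨h1, h2⟩ := (owner_eq_iff hw r _).1 rfl
  constructor
  · intro h
    exact h2.trans_le (Nat.div_le_div_right (Nat.mul_le_mul_right _ h))
  · intro h
    by_contra hs
    have : s * N / w ≤ (owner hw r).1 * N / w :=
      Nat.div_le_div_right (Nat.mul_le_mul_right _ (not_lt.1 hs))
    omega

/-- The first half of the agents, and also the second half, has at least a third of the facts. -/
theorem le_ncard_owner_half {N w : ℕ} (hw : 1 ≤ w) (hw2 : 2 ≤ w) :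
    N / 3 ≤ {r : Fin N | (owner hw r).1 < w / 2}.ncard ∧
      N / 3 ≤ {r : Fin N | ¬ (owner hw r).1 < w / 2}.ncard := by
  simp only [owner_lt_iff]
  have h1 : w / 2 * N / w ≤ N / 2 := by
    rw [Nat.le_div_iff_mul_le (by norm_num)]
    calc w / 2 * N / w * 2 ≤ w / 2 * N * 2 / w := by
          rw [mul_comm _ 2, mul_comm _ 2]
          exact Nat.mul_div_le_mul_div_assoc _ _ _
      _ ≤ w * N / w := Nat.div_le_div_right (by
          have : w / 2 * 2 ≤ w := Nat.div_mul_le_self _ _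
          nlinarith)
      _ = N := Nat.mul_div_cancel_left _ (by omega)
  have h2 : N / 3 ≤ w / 2 * N / w := by
    rw [Nat.le_div_iff_mul_le (by omega)]
    have h3 : w ≤ 3 * (w / 2) := by omega
    calc N / 3 * w ≤ N / 3 * (3 * (w / 2)) := Nat.mul_le_mul_left _ h3
      _ = (N / 3 * 3) * (w / 2) := by ring
      _ ≤ N * (w / 2) := Nat.mul_le_mul_right _ (Nat.div_mul_le_self _ _)
      _ = w / 2 * N := mul_comm _ _
  constructor
  · have := ncard_fin_interval (N := N) (a := 0) (b := w / 2 * N / w) (by omega)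
    simp only [Nat.zero_le, true_and] at this
    rw [this]
    omega
  · have := ncard_fin_interval (N := N) (a := w / 2 * N / w) (b := N) le_rfl
    have e : {r : Fin N | ¬ r.1 < w / 2 * N / w} =
        {r : Fin N | w / 2 * N / w ≤ r.1 ∧ r.1 < N} := by
      ext r
      simp
    rw [e, this]
    omega

/-- The number of possible communications is polynomial in the input size. -/
theorem alphabet_bound {n w B X p : ℕ} (hn : 2 ≤ n) (hw : w + 1 ≤ n) (hB : B + 1 ≤ n ^ (p + 1))
    (hX : X ≤ n ^ p) : w * ((B + 1) * (X * (w + 1))) + 1 ≤ n ^ (2 * p + 4) := by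
  have h1 : w * ((B + 1) * (X * (w + 1))) ≤ n * (n ^ (p + 1) * (n ^ p * n)) :=
    Nat.mul_le_mul (by omega) (Nat.mul_le_mul hB (Nat.mul_le_mul hX hw))
  have h2 : n * (n ^ (p + 1) * (n ^ p * n)) = n ^ (2 * p + 3) := by ring
  have h3 : n ^ (2 * p + 4) = n ^ (2 * p + 3) * n := pow_succ _ _
  have h4 : 1 ≤ n ^ (2 * p + 3) := Nat.one_le_pow _ _ (by omega)
  nlinarith

/-- Cut the agents into two halves of the list of facts.  There is room for layers of `c ≥ √N` facts, so
there are at least `N ^ (k / 2)` paths, whereas `b` communications have at most `N ^ O(b)` transcripts. -/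
theorem communication_lower_bound (p : ℕ) : ∃ c : ℝ, 0 < c ∧ ∃ K : ℕ, ∀ (w d m : ℕ → ℕ),
    (∀ N, 1 ≤ N → 1 ≤ w N ∧ w N ≤ N) → (∀ n, n ≤ d n) → (∀ n, 1 ≤ m n) →
      ∀ A : MultiAgentSystem w d m, A.Expressible → A.Computes →
        (∀ n, (A.Ξ n).card ≤ (n + 2) ^ p) →
        ∀ N k : ℕ, 1 ≤ k → 2 ≤ w N → (k + 1) ^ K ≤ N →
          (∀ x : KHop d m N k, (A.graph x).depth ≤ (N + k + 2) ^ p) →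
          ∃ x : KHop d m N k, c * k ≤ ((A.graph x).comm : ℝ) := by
  refine ⟨1 / (16 * p + 32), by positivity, 10, ?_⟩
  intro w d m hw hd hm A hE hC hX N k hk hw2 hNk hdepth
  by_contra! hcon
  have hk2 : 144 * (k + 1) ^ 2 ≤ N := by
    have : 2 ^ 8 ≤ (k + 1) ^ 8 := Nat.pow_le_pow_left (by omega) 8
    have e : (k + 1) ^ 10 = (k + 1) ^ 8 * (k + 1) ^ 2 := by ring
    nlinarith [Nat.zero_le ((k + 1) ^ 2)]
  have hkN : k + 1 ≤ N := by nlinarith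
  have hN : 576 ≤ N := by nlinarith
  obtain ⟨hw1, hwN⟩ := hw N (by omega)
  obtain ⟨M, hM⟩ := hC N k (by omega) hk
  set b := ⌊(1 / (16 * p + 32) : ℝ) * k⌋₊ with hb
  set c := N / (6 * (k + 1)) with hc
  have hc1 : (k + 1) * c ≤ N / 6 := by
    rw [Nat.le_div_iff_mul_le (by norm_num)]
    calc (k + 1) * c * 6 = N / (6 * (k + 1)) * (6 * (k + 1)) := by rw [hc]; ring
      _ ≤ N := Nat.div_mul_le_self _ _
  have hc2 : N < 6 * (k + 1) * (c + 1) := by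
    rw [hc]
    exact Nat.lt_mul_div_succ N (by omega)
  have hc3 : N ≤ c ^ 2 := by
    have h1 : 1 ≤ c := by
      rw [hc, Nat.le_div_iff_mul_le (by omega)]
      nlinarith
    have h2 : N ≤ 12 * (k + 1) * c := by nlinarith
    have h3 : N * N ≤ (12 * (k + 1) * c) * (12 * (k + 1) * c) := Nat.mul_le_mul h2 h2
    have h4 : 144 * (k + 1) ^ 2 * N ≤ 144 * (k + 1) ^ 2 * c ^ 2 := by nlinarith
    exact Nat.le_of_mul_le_mul_left h4 (by positivity)
  have hroom : (k + 1) * c + 1 ≤ N / 3 := by omega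
  have hcross : ∀ (S : Set (Fin (w N))) (x : KHop d m N k), ((A.graph x).crossing S).ncard ≤ b :=
    fun S x => (Set.ncard_le_ncard ((A.graph x).crossing_subset S)
      (A.graph x).finite_setOf_commEdge).trans (Nat.le_floor (hcon x).le)
  have hB : ∀ (x : KHop d m N k) i t, IsNode (A.graph x).len (i, t) → t ≤ (N + k + 2) ^ p + 1 :=
    fun x i t h => ((A.graph x).le_depth h).trans (Nat.succ_le_succ (hdepth x))
  obtain ⟨hA, hA'⟩ := le_ncard_owner_half (N := N) hw1 hw2
  have hcount : c ^ k ≤ (w N * (((N + k + 2) ^ p + 1 + 1) *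
      ((A.Ξ (N + k)).card * (w N + 1))) + 1) ^ b := by
    by_cases hMS : M.1 < w N / 2
    · exact pow_le_of_crossing_le A hE (by omega) hk (hd N) (hm N) hw1 hM
        (S := {i | i.1 < w N / 2}) hMS (hroom.trans hA) (hroom.trans hA') hB (hcross _)
    · exact pow_le_of_crossing_le A hE (by omega) hk (hd N) (hm N) hw1 hM
        (S := {i | ¬ i.1 < w N / 2}) hMS (hroom.trans hA')
        (hroom.trans (by simpa using hA)) hB (hcross _)
  have hQ := alphabet_bound (n := N + k + 2) (w := w N) (B := (N + k + 2) ^ p + 1) (p := p)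
    (by omega) (by omega) (by
      have : 1 ≤ (N + k + 2) ^ p := Nat.one_le_pow _ _ (by omega)
      rw [pow_succ]
      nlinarith) (hX (N + k))
  have hQ2 : (N + k + 2) ^ (2 * p + 4) ≤ N ^ (4 * p + 8) := by
    have e : N ^ (4 * p + 8) = (N ^ 2) ^ (2 * p + 4) := by
      rw [← pow_mul]
      congr 1
      ring
    rw [e]
    exact Nat.pow_le_pow_left (by nlinarith) _
  have hfin : N ^ k ≤ N ^ ((8 * p + 16) * b) :=
    calc N ^ k ≤ (c ^ 2) ^ k := Nat.pow_le_pow_left hc3 k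
      _ = (c ^ k) ^ 2 := by rw [← pow_mul, ← pow_mul, mul_comm]
      _ ≤ ((N ^ (4 * p + 8)) ^ b) ^ 2 :=
        Nat.pow_le_pow_left (hcount.trans (Nat.pow_le_pow_left (hQ.trans hQ2) b)) 2
      _ = N ^ ((8 * p + 16) * b) := by
        rw [← pow_mul, ← pow_mul]
        congr 1
        ring
  have hkb : k ≤ (8 * p + 16) * b := (Nat.pow_le_pow_iff_right (by omega)).1 hfin
  have hbr : (b : ℝ) ≤ 1 / (16 * p + 32) * k := Nat.floor_le (by positivity)
  have hkb' : (k : ℝ) ≤ (8 * p + 16) * b := by exact_mod_cast hkb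
  have hk' : (1 : ℝ) ≤ k := by exact_mod_cast hk
  have h2 : (8 * p + 16 : ℝ) * b ≤ k / 2 := by
    calc (8 * p + 16 : ℝ) * b ≤ (8 * p + 16) * (1 / (16 * p + 32) * k) := by gcongr
      _ = k / 2 := by field_simp; ring
  linarith

/-- In a run of depth `D` at most `2 (D + 1)` nodes send a message to or from a given agent, since every
node of the agent has one outgoing action and at most one incoming edge. -/
theorem AgentGraph.ncard_crossing_singleton_le {w : ℕ} (G : AgentGraph w) (i : Fin w) {D : ℕ}
    (hD : G.depth ≤ D) : (G.crossing {i}).ncard ≤ 2 * (D + 1) := by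
  classical
  have e : ((Finset.univ : Finset Bool) ×ˢ Finset.Icc 1 (D + 1)).card = 2 * (D + 1) := by simp
  rw [← e, ← Set.ncard_coe_finset]
  refine Set.ncard_le_ncard_of_injOn (fun u => (decide (u.1 = i), u.2)) ?_ ?_
    (Finset.finite_toSet _)
  · rintro ⟨j, t⟩ ⟨v, ⟨-, s, hs⟩, -⟩
    have hn := G.isNode_of_message hs
    have := G.le_depth hn
    have := hn.1
    simp only [Finset.coe_product, Set.mem_prod, Finset.mem_coe, Finset.mem_univ, true_and,
      Finset.mem_Icc]
    simp only at this
    omega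
  · rintro ⟨j, t⟩ ⟨⟨j2, t2⟩, h1, h2⟩ ⟨j', t'⟩ ⟨⟨j2', t2'⟩, h1', h2'⟩ h
    simp only [Prod.mk.injEq, decide_eq_decide] at h
    obtain ⟨h, rfl⟩ := h
    by_cases hj : j = i
    · rw [hj, h.1 hj]
    · have hj' : ¬ j' = i := fun h' => hj (h.2 h')
      simp only [Set.mem_singleton_iff, hj, hj', false_iff, not_not] at h2 h2'
      subst h2 h2'
      have et : t2 = t + 1 := h1.1
      have et' : t2' = t + 1 := h1'.1
      subst et et'
      have hn := G.target_isNode _ _ (Or.inl h1)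
      have ht : 1 ≤ t := by
        obtain ⟨-, s, hs⟩ := h1
        exact (G.isNode_of_message hs).1
      exact (G.incoming _ hn (by simp; omega)).unique (Or.inl h1) (Or.inl h1')

/-- Cut off the manager alone.  In depth `D` it takes part in `O(D)` communications, which have
`(N + k) ^ O(D)` transcripts, and layers of two facts give `2 ^ k` paths. -/
theorem depth_lower_bound (p : ℕ) : ∃ c : ℝ, 0 < c ∧ ∃ K : ℕ, ∀ (w d m : ℕ → ℕ),
    (∀ N, 1 ≤ N → 1 ≤ w N ∧ w N ≤ N) → (∀ n, n ≤ d n) → (∀ n, 1 ≤ m n) →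
      ∀ A : MultiAgentSystem w d m, A.Expressible → A.Computes →
        (∀ n, (A.Ξ n).card ≤ (n + 2) ^ p) →
        ∀ N k : ℕ, 1 ≤ k → 2 ≤ w N → K * (k * w N) ≤ N →
          ∃ x : KHop d m N k,
            c * k / Real.log ((N : ℝ) + k) ≤ ((A.graph x).depth : ℝ) := by
  refine ⟨1 / (32 * (2 * p + 4)), by positivity, 5, ?_⟩
  intro w d m hw hd hm A hE hC hX N k hk hw2 hNk
  by_contra! hcon
  have hN10 : 10 ≤ N := by nlinarith
  obtain ⟨hw1, hwN⟩ := hw N (by omega)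
  obtain ⟨M, hM⟩ := hC N k (by omega) hk
  set L := Real.log ((N : ℝ) + k) with hL
  have hNk' : (10 : ℝ) + 1 ≤ (N : ℝ) + k := by
    have h1 : (10 : ℝ) ≤ N := by exact_mod_cast hN10
    have h2 : (1 : ℝ) ≤ k := by exact_mod_cast hk
    linarith
  have hL1 : 1 ≤ L := by
    rw [hL, Real.le_log_iff_exp_le (by linarith)]
    exact Real.exp_one_lt_d9.le.trans (by linarith)
  set D := ⌊(1 / (32 * (2 * p + 4)) : ℝ) * k / L⌋₊ with hD
  have hdepth : ∀ x : KHop d m N k, (A.graph x).depth ≤ D := fun x => Nat.le_floor (hcon x).le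
  have hDr : (D : ℝ) ≤ (1 / (32 * (2 * p + 4)) : ℝ) * k / L := Nat.floor_le (by positivity)
  -- The manager has a CoT edge, so the depth is positive.
  have hD1 : 1 ≤ D := by
    refine le_trans ?_ (hdepth (functionInput (hd N) (hm N) k ⟨0, by omega⟩ id))
    obtain ⟨t, ht, -⟩ := hM (functionInput (hd N) (hm N) k ⟨0, by omega⟩ id)
    have hn : IsNode (A.graph (functionInput (hd N) (hm N) k ⟨0, by omega⟩ id)).len (M, t) := by
      by_contra hn
      rw [(A.graph _).out_idle M t hn] at ht
      cases ht
    have h1 := (A.graph _).le_depth (((A.graph _).isNode_iff M t).2 (Or.inr (Or.inr ⟨_, ht⟩)))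
    have := hn.1
    simp only at this
    omega
  have hDk : D ≤ k := by
    have h1 : (1 / (32 * (2 * p + 4)) : ℝ) * k / L ≤ k := by
      apply (div_le_self (by positivity) hL1).trans
      apply mul_le_of_le_one_left (by positivity)
      rw [div_le_one (by positivity)]
      have : (0 : ℝ) ≤ p := by positivity
      linarith
    exact_mod_cast hDr.trans h1
  have hroom : (k + 1) * 2 + 1 ≤ N / w N := by
    rw [Nat.le_div_iff_mul_le (by omega)]
    have h5 : (k + 1) * 2 + 1 ≤ 5 * k := by omega
    calc ((k + 1) * 2 + 1) * w N ≤ 5 * k * w N := Nat.mul_le_mul_right _ h5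
      _ ≤ N := by linarith
  -- Some agent is not the manager.
  obtain ⟨M', hM'⟩ : ∃ M' : Fin (w N), M' ≠ M :=
    have : Nontrivial (Fin (w N)) := Fin.nontrivial_iff_two_le.2 hw2
    exists_ne M
  have hcount := pow_le_of_crossing_le A hE (by omega) hk (hd N) (hm N) hw1 hM
    (S := {M}) rfl (c := 2) (hroom.trans (le_ncard_owner_eq hw1 M))
    ((hroom.trans (le_ncard_owner_eq hw1 M')).trans (Set.ncard_le_ncard (by
      rintro r (rfl : owner hw1 r = M')
      exact hM') (Set.toFinite _)))
    (B := D + 1) (b := 2 * (D + 1))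
    (fun x i t h => ((A.graph x).le_depth h).trans (Nat.succ_le_succ (hdepth x)))
    (fun x => AgentGraph.ncard_crossing_singleton_le _ M (hdepth x))
  have hQ := alphabet_bound (n := N + k + 2) (w := w N) (B := D + 1) (p := p)
    (by omega) (by omega) (by
      have : 1 ≤ (N + k + 2) ^ p := Nat.one_le_pow _ _ (by omega)
      rw [pow_succ]
      nlinarith) (hX (N + k))
  have hQ2 : (N + k + 2) ^ (2 * p + 4) ≤ (N + k) ^ (2 * (2 * p + 4)) := by
    rw [pow_mul (N + k)]
    exact Nat.pow_le_pow_left (by nlinarith) _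
  have hfin : 2 ^ k ≤ (N + k) ^ (2 * (2 * p + 4) * (4 * D)) := by
    refine (hcount.trans (Nat.pow_le_pow_left (hQ.trans hQ2) _)).trans ?_
    rw [← pow_mul]
    exact Nat.pow_le_pow_right (by omega) (Nat.mul_le_mul_left _ (by omega))
  have hlog : (k : ℝ) * Real.log 2 ≤ (2 * (2 * p + 4) * (4 * D)) * L := by
    have h1 : ((2 : ℝ) ^ k) ≤ ((N : ℝ) + k) ^ (2 * (2 * p + 4) * (4 * D)) := by
      exact_mod_cast hfin
    have h2 := Real.log_le_log (by positivity) h1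
    rw [Real.log_pow, Real.log_pow] at h2
    push_cast at h2
    exact h2
  have hk' : (1 : ℝ) ≤ k := by exact_mod_cast hk
  have h2 : (2 * (2 * p + 4) * (4 * D) : ℝ) * L ≤ k / 4 := by
    calc (2 * (2 * p + 4) * (4 * D) : ℝ) * L
        ≤ (2 * (2 * p + 4) * (4 * ((1 / (32 * (2 * p + 4)) : ℝ) * k / L))) * L := by gcongr
      _ = k / 4 := by field_simp; ring
  have := Real.log_two_gt_d9
  nlinarith

/-! ### Transformers from lookups -/

theorem rightmostArgmax_le (s : ℕ → ℝ) (i : ℕ) : rightmostArgmax s i ≤ i :=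
  (rightmostArgmax_spec s i).1

theorem rightmostArgmax_congr {s s' : ℕ → ℝ} {i : ℕ} (h : ∀ j ≤ i, s j = s' j) :
    rightmostArgmax s i = rightmostArgmax s' i := by
  induction i with
  | zero => rfl
  | succ i ih =>
    have e := ih fun j hj => h j (by omega)
    simp only [rightmostArgmax, e, h (i + 1) le_rfl,
      h _ ((rightmostArgmax_le s' i).trans (Nat.le_succ i))]

open Classical in
/-- The rightmost position `j ≤ i` with the property `P`, or `i` if there is none. -/
noncomputable def rightmost (P : ℕ → Prop) (i : ℕ) : ℕ :=
  rightmostArgmax (fun j => if P j then 1 else 0) i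

theorem rightmost_le (P : ℕ → Prop) (i : ℕ) : rightmost P i ≤ i :=
  rightmostArgmax_le _ i

theorem rightmost_spec {P : ℕ → Prop} {i j : ℕ} (hj : j ≤ i) (h : P j) : P (rightmost P i) := by
  classical
  by_contra hn
  have := ((rightmostArgmax_spec (fun j => if P j then (1 : ℝ) else 0) i).2 j hj).1
  unfold rightmost at hn
  simp only [h, if_true, if_neg hn] at this
  linarith

theorem rightmostArgmax_eq_rightmost {s : ℕ → ℝ} {P : ℕ → Prop} {i : ℕ}
    (h1 : ∀ j ≤ i, P j → s j = 1) (h0 : ∀ j ≤ i, ¬ P j → s j = 0) :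
    rightmostArgmax s i = rightmost P i := by
  apply rightmostArgmax_congr
  intro j hj
  by_cases h : P j
  · simp [h, h1 j hj h]
  · simp [h, h0 j hj h]

/-- What a transformer sees of a position: its index and its token. -/
abbrev View := ℕ × Token

/-- The view of position `j` of the token list `u`. -/
def view (u : List Token) (j : ℕ) : View := (j, u.getD j .eos)

/-- A lookup rule: which views are acceptable, given the views collected so far. -/
abbrev Lookup := List View → View → Prop

/-- The views collected at position `i`: first its own view, then for each lookup rule the view of the
rightmost acceptable position up to `i` (of position `i` itself if no position is acceptable). -/
noncomputable def registers (Ps : List Lookup) (u : List Token) (i : ℕ) : List View :=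
  Ps.foldl (fun r P => r ++ [view u (rightmost (fun j => P r (view u j)) i)]) [view u i]

/-- A one-hidden-layer network that evaluates an arbitrary binary operation on a pair of one-hot
vectors living in disjoint blocks of coordinates: there is one hidden unit for each pair. -/
theorem exists_mlp_of_pair {R : Type*} {dim : ℕ} (F : Finset R) (φ : Bool → R → Fin dim)
    (hφ : ∀ b b', ∀ r ∈ F, ∀ r' ∈ F, φ b r = φ b' r' → b = b' ∧ r = r') (U : R → R → R) :
    ∃ g : (Fin dim → ℝ) → (Fin dim → ℝ), IsMLP g ∧ ∀ r ∈ F, ∀ r' ∈ F,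
      g (Pi.single (φ false r) 1 + Pi.single (φ true r') 1) =
        Pi.single (φ false (U r r')) 1 := by
  classical
  let e := (F ×ˢ F).equivFin.symm
  have he : ∀ i, (e i).1.1 ∈ F ∧ (e i).1.2 ∈ F := fun i => Finset.mem_product.1 (e i).2
  let W : Matrix (Fin (F ×ˢ F).card) (Fin dim) ℝ := fun i =>
    Pi.single (φ false (e i).1.1) 1 + Pi.single (φ true (e i).1.2) 1
  let W' : Matrix (Fin dim) (Fin (F ×ˢ F).card) ℝ := fun a i =>
    (Pi.single (φ false (U (e i).1.1 (e i).1.2)) 1 : Fin dim → ℝ) a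
  let v : Fin (F ×ˢ F).card → ℝ := fun _ => -1
  refine ⟨_, IsMLP.hidden W v _ (IsMLP.affine W' 0), ?_⟩
  intro r hr r' hr'
  have hne : ∀ r ∈ F, ∀ r' ∈ F, φ false r ≠ φ true r' := fun r hr r' hr' h =>
    absurd (hφ _ _ r hr r' hr' h).1 (by simp)
  have hinj : ∀ b, ∀ r ∈ F, ∀ r' ∈ F, (φ b r = φ b r' ↔ r = r') := fun b r hr r' hr' =>
    ⟨fun h => (hφ _ _ r hr r' hr' h).2, fun h => by rw [h]⟩
  have hunit : (fun i => max 0 ((W *ᵥ (Pi.single (φ false r) 1 + Pi.single (φ true r') 1) +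
      v) i)) = Pi.single (e.symm ⟨(r, r'), Finset.mk_mem_product hr hr'⟩) (1 : ℝ) := by
    funext i
    obtain ⟨h1, h2⟩ := he i
    have hi : i = e.symm ⟨(r, r'), Finset.mk_mem_product hr hr'⟩ ↔
        (e i).1.1 = r ∧ (e i).1.2 = r' := by
      rw [Equiv.eq_symm_apply, Subtype.ext_iff, Prod.ext_iff]
    have hW : (W *ᵥ (Pi.single (φ false r) 1 + Pi.single (φ true r') 1)) i =
        W i (φ false r) + W i (φ true r') := by
      rw [Matrix.mulVec_add, Matrix.mulVec_single_one, Matrix.mulVec_single_one]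
      rfl
    have hW1 : W i (φ false r) = if (e i).1.1 = r then 1 else 0 := by
      simp only [W, Pi.add_apply, Pi.single_apply, hinj false _ hr _ h1, hne _ hr _ h2, if_false,
        add_zero, eq_comm]
    have hW2 : W i (φ true r') = if (e i).1.2 = r' then 1 else 0 := by
      simp only [W, Pi.add_apply, Pi.single_apply, hinj true _ hr' _ h2, (hne _ h1 _ hr').symm,
        if_false, zero_add, eq_comm]
    rw [Pi.single_apply, Pi.add_apply, hW, hW1, hW2]
    simp only [hi, v]
    by_cases h3 : (e i).1.1 = r <;> by_cases h4 : (e i).1.2 = r' <;> simp [h3, h4]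
  rw [hunit, Matrix.mulVec_single_one, add_zero]
  funext a
  rw [Matrix.col_apply]
  simp [W']

/-- A layer with two heads whose outputs are added. -/
noncomputable def twoHeadLayer {dim : ℕ} (Q K V : Fin 2 → Matrix (Fin dim) (Fin dim) ℝ)
    (g : (Fin dim → ℝ) → (Fin dim → ℝ)) (hg : IsMLP g) : Layer dim where
  heads := 2
  headDim := dim
  WQ := Q
  WK := K
  WV := V
  WO := fun q a => if q.2 = a then 1 else 0
  mlp := g
  mlp_isMLP := hg

theorem twoHeadLayer_apply {dim : ℕ} (Q K V : Fin 2 → Matrix (Fin dim) (Fin dim) ℝ)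
    (g : (Fin dim → ℝ) → (Fin dim → ℝ)) (hg : IsMLP g) (X : ℕ → Fin dim → ℝ) (i : ℕ) :
    (twoHeadLayer Q K V g hg).apply X i = g
      (X (rightmostArgmax (fun j => (X i ᵥ* Q 0) ⬝ᵥ (X j ᵥ* K 0)) i) ᵥ* V 0 +
        X (rightmostArgmax (fun j => (X i ᵥ* Q 1) ⬝ᵥ (X j ᵥ* K 1)) i) ᵥ* V 1) := by
  have h : ∀ (f : Fin 2 → Fin dim → ℝ), ((fun q : Fin 2 × Fin dim => f q.1 q.2) ᵥ*
      (fun q a => if q.2 = a then 1 else 0 : Matrix (Fin 2 × Fin dim) (Fin dim) ℝ)) =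
      f 0 + f 1 := by
    intro f
    funext a
    simp only [Matrix.vecMul, dotProduct, Pi.add_apply]
    rw [Fintype.sum_prod_type]
    simp
  exact congrArg g (h fun b =>
    X (rightmostArgmax (fun j => (X i ᵥ* Q b) ⬝ᵥ (X j ᵥ* K b)) i) ᵥ* V b)

/-- Token lists over a finite alphabet give finitely many lists of views of bounded length. -/
theorem finite_registers {V : Set Token} (hV : V.Finite) (c L : ℕ) :
    {r : List View | r.length ≤ L ∧ ∀ v ∈ r, v.1 < c ∧ v.2 ∈ V}.Finite := by
  have : Finite (Set.Iio c ×ˢ V : Set View) := (Set.finite_Iio c).prod hV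
  refine ((List.finite_length_le (Set.Iio c ×ˢ V : Set View) L).image
    (List.map Subtype.val)).subset ?_
  rintro r ⟨h1, h2⟩
  refine ⟨r.attach.map fun v => ⟨v.1, h2 v.1 v.2⟩, ?_, ?_⟩
  · simpa using h1
  · rw [List.map_map]
    exact List.attach_map_subtype_val r

/-- Two disjoint families of coordinates, each indexed by `F`. -/
theorem exists_codes {R : Type*} (F : Finset R) : ∃ (dim : ℕ) (φ : Bool → R → Fin dim),
    ∀ b b', ∀ r ∈ F, ∀ r' ∈ F, φ b r = φ b' r' → b = b' ∧ r = r' := by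
  classical
  let e := Fintype.equivFin (Bool × F)
  refine ⟨Fintype.card (Bool × F) + 1,
    fun b r => if h : r ∈ F then (e (b, ⟨r, h⟩)).castSucc else Fin.last _, ?_⟩
  intro b b' r hr r' hr' h
  simpa [hr, hr'] using h

/-- Every adaptive sequence of lookups is carried out by a transformer with one layer for each lookup and
one layer that merges token and position.  The vectors are one-hot encodings of the lists of views
collected so far; one head fetches the own vector, the other one the vector that is looked up. -/
theorem exists_uhat_of_lookups (Ps : List Lookup) (out : List View → Token) {V : Set Token}
    (hV : V.Finite) (heos : Token.eos ∈ V) (c : ℕ) :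
    ∃ T : UHAT, T.contextSize = c ∧ T.layers.length = Ps.length + 1 ∧
      (∀ ℓ ∈ T.layers, ℓ.heads ≤ 2) ∧ ∀ u : List Token, u ≠ [] → u.length ≤ c → (∀ a ∈ u, a ∈ V) →
        out (registers Ps u (u.length - 1)) ∈ V →
          T.Predicts V u (out (registers Ps u (u.length - 1))) := by
  classical
  let F : Finset (List View) := (finite_registers hV c (Ps.length + 1)).toFinset
  have hF : ∀ r, r ∈ F ↔ r.length ≤ Ps.length + 1 ∧ ∀ v ∈ r, v.1 < c ∧ v.2 ∈ V :=
    fun r => Set.Finite.mem_toFinset _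
  obtain ⟨dim, φ, hφ⟩ := exists_codes F
  have hne : ∀ r ∈ F, ∀ r' ∈ F, φ false r ≠ φ true r' := fun r hr r' hr' h =>
    absurd (hφ _ _ r hr r' hr' h).1 (by simp)
  have hinj : ∀ b, ∀ r ∈ F, ∀ r' ∈ F, (φ b r = φ b r' ↔ r = r') := fun b r hr r' hr' =>
    ⟨fun h => (hφ _ _ r hr r' hr' h).2, fun h => by rw [h]⟩
  let e : List View → Fin dim → ℝ := fun r => Pi.single (φ false r) 1
  let hd : List View → View := fun r => r.headD (0, .eos)
  -- The merging layer and the lookup layers.  The embedding puts the token into the first block of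
  -- coordinates and the position into the second one.
  obtain ⟨g0, hg0, hg0'⟩ := exists_mlp_of_pair F φ hφ
    (fun r r' => [((hd r').1, (hd r).2)])
  obtain ⟨g1, hg1, hg1'⟩ := exists_mlp_of_pair F φ hφ (fun r r' => r ++ [hd r'])
  let P0 : Matrix (Fin dim) (Fin dim) ℝ := fun a b => if a = b ∧ ∃ r ∈ F, a = φ true r then 1 else 0
  let layer0 : Layer dim := twoHeadLayer (fun _ => P0) (fun _ => 1) ![1, 0] g0 hg0
  let SM : Lookup → Matrix (Fin dim) (Fin dim) ℝ := fun P a b =>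
    if ∃ r ∈ F, ∃ r' ∈ F, a = φ false r ∧ b = φ false r' ∧ P r (hd r') then 1 else 0
  let shift : Matrix (Fin dim) (Fin dim) ℝ := fun a b =>
    if ∃ r ∈ F, a = φ false r ∧ b = φ true r then 1 else 0
  let layer : Lookup → Layer dim := fun P =>
    twoHeadLayer ![1, SM P] (fun _ => 1) ![1, shift] g1 hg1
  let T : UHAT :=
    { dim := dim
      contextSize := c
      emb := fun a => Pi.single (φ false [(0, a)]) 1
      pos := fun i => Pi.single (φ true [(i, .eos)]) 1
      layers := layer0 :: Ps.map layer
      unemb := fun a b => if ∃ r ∈ F, b = φ false r ∧ out r = a then 1 else 0 }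
  refine ⟨T, rfl, by simp [T], ?_, ?_⟩
  · intro ℓ hℓ
    simp only [T, List.mem_cons, List.mem_map] at hℓ
    rcases hℓ with rfl | ⟨P, -, rfl⟩ <;> exact le_rfl
  intro u hu huc huV hout
  have hmem : ∀ i < u.length, u.getD i .eos ∈ V := by
    intro i hi
    rw [List.getD_eq_getElem _ _ hi]
    exact huV _ (List.getElem_mem hi)
  have hview : ∀ i < u.length, (view u i).1 < c ∧ (view u i).2 ∈ V := fun i hi =>
    ⟨hi.trans_le huc, hmem i hi⟩
  have hc : 0 < c := (List.length_pos_iff.2 hu).trans_le huc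
  have hsingle : ∀ v : View, v.1 < c → v.2 ∈ V → [v] ∈ F := fun v h1 h2 =>
    (hF _).2 ⟨by simp, by simpa using ⟨h1, h2⟩⟩
  -- The merging layer.
  have h0 : ∀ i < u.length, layer0.apply (T.embed u) i = e [view u i] := by
    intro i hi
    have hx : ∀ j, T.embed u j = Pi.single (φ false [(0, u.getD j .eos)]) 1 +
      Pi.single (φ true [(j, .eos)]) 1 := fun j => rfl
    have ht : ∀ j < u.length, [((0 : ℕ), u.getD j .eos)] ∈ F := fun j hj =>
      hsingle _ hc (hmem j hj)
    have hp : ∀ j < u.length, [(j, Token.eos)] ∈ F := fun j hj =>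
      hsingle _ (hj.trans_le huc) heos
    have hatt : rightmostArgmax (fun j => (T.embed u i ᵥ* P0) ⬝ᵥ
        (T.embed u j ᵥ* (1 : Matrix (Fin dim) (Fin dim) ℝ))) i = i := by
      have h1 : (T.embed u i ᵥ* P0) = Pi.single (φ true [(i, .eos)]) 1 := by
        rw [hx, Matrix.add_vecMul, Matrix.single_one_vecMul, Matrix.single_one_vecMul]
        funext b
        have hn : ¬ ∃ r ∈ F, φ false [((0 : ℕ), u.getD i .eos)] = φ true r := by
          rintro ⟨r, hr, h⟩
          exact hne _ (ht i hi) _ hr h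
        have hy : ∃ r ∈ F, φ true [(i, Token.eos)] = φ true r := ⟨_, hp i hi, rfl⟩
        rw [Pi.add_apply, Matrix.row_apply, Matrix.row_apply]
        simp only [P0, hn, hy, and_false, and_true, if_false, zero_add, Pi.single_apply]
        simp only [eq_comm]
      have hs : ∀ j ≤ i, (T.embed u i ᵥ* P0) ⬝ᵥ
          (T.embed u j ᵥ* (1 : Matrix (Fin dim) (Fin dim) ℝ)) =
          (Pi.single (φ true [(j, .eos)]) 1 : Fin dim → ℝ) (φ true [(i, .eos)]) := by
        intro j hj
        rw [h1, hx, Matrix.vecMul_one, single_one_dotProduct, Pi.add_apply,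
          Pi.single_eq_of_ne (hne _ (ht j (by omega)) _ (hp i hi)).symm, zero_add]
      rw [rightmostArgmax_eq_rightmost (P := fun j => j = i)]
      · exact rightmost_spec (P := fun j => j = i) le_rfl rfl
      · rintro j hj rfl
        rw [hs j hj, Pi.single_eq_same]
      · intro j hj hji
        rw [hs j hj, Pi.single_eq_of_ne]
        intro h
        have := (hinj true _ (hp i hi) _ (hp j (by omega))).1 h
        simp only [List.cons.injEq, Prod.mk.injEq, and_true] at this
        exact hji this.symm
    simp only [layer0, twoHeadLayer_apply, hatt]
    simp only [Matrix.cons_val_zero, Matrix.cons_val_one, Matrix.vecMul_one, Matrix.vecMul_zero,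
      add_zero]
    rw [hx, hg0' _ (ht i hi) _ (hp i hi)]
    rfl
  -- A lookup layer.
  have h1 : ∀ (P : Lookup) (X : ℕ → Fin dim → ℝ) (ρ : ℕ → List View),
      (∀ i < u.length, X i = e (ρ i) ∧ ρ i ∈ F ∧ (ρ i).head? = some (view u i)) →
      ∀ i < u.length, (layer P).apply X i =
        e (ρ i ++ [view u (rightmost (fun j => P (ρ i) (view u j)) i)]) := by
    intro P X ρ hX i hi
    have hhd : ∀ j < u.length, hd (ρ j) = view u j := by
      intro j hj
      simp only [hd]
      rw [List.headD_eq_head?_getD, (hX j hj).2.2]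
      rfl
    have hatt0 : rightmostArgmax (fun j => (X i ᵥ* (1 : Matrix (Fin dim) (Fin dim) ℝ)) ⬝ᵥ
        (X j ᵥ* (1 : Matrix (Fin dim) (Fin dim) ℝ))) i = i := by
      have hs : ∀ j ≤ i, (X i ᵥ* (1 : Matrix (Fin dim) (Fin dim) ℝ)) ⬝ᵥ
          (X j ᵥ* (1 : Matrix (Fin dim) (Fin dim) ℝ)) =
          (Pi.single (φ false (ρ j)) 1 : Fin dim → ℝ) (φ false (ρ i)) := by
        intro j hj
        rw [Matrix.vecMul_one, Matrix.vecMul_one, (hX i hi).1, (hX j (by omega)).1,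
          single_one_dotProduct]
      rw [rightmostArgmax_eq_rightmost (P := fun j => j = i)]
      · exact rightmost_spec (P := fun j => j = i) le_rfl rfl
      · rintro j hj rfl
        rw [hs j hj, Pi.single_eq_same]
      · intro j hj hji
        have hj' : j < u.length := by omega
        rw [hs j hj, Pi.single_eq_of_ne]
        intro h
        have h2 := (hX i hi).2.2
        rw [(hinj false _ (hX i hi).2.1 _ (hX j hj').2.1).1 h, (hX j hj').2.2] at h2
        exact hji (congrArg Prod.fst (Option.some.inj h2))
    have hatt1 : rightmostArgmax (fun j => (X i ᵥ* SM P) ⬝ᵥ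
        (X j ᵥ* (1 : Matrix (Fin dim) (Fin dim) ℝ))) i =
        rightmost (fun j => P (ρ i) (view u j)) i := by
      have hs : ∀ j ≤ i, (X i ᵥ* SM P) ⬝ᵥ (X j ᵥ* (1 : Matrix (Fin dim) (Fin dim) ℝ)) =
          SM P (φ false (ρ i)) (φ false (ρ j)) := by
        intro j hj
        rw [Matrix.vecMul_one, (hX i hi).1, (hX j (by omega)).1, dotProduct_single_one,
          Matrix.single_one_vecMul]
        rfl
      apply rightmostArgmax_eq_rightmost
      · intro j hj h
        have hj' : j < u.length := by omega
        rw [hs j hj]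
        exact if_pos ⟨ρ i, (hX i hi).2.1, ρ j, (hX j hj').2.1, rfl, rfl, by rwa [hhd j hj']⟩
      · intro j hj hn
        have hj' : j < u.length := by omega
        rw [hs j hj]
        refine if_neg ?_
        rintro ⟨r, hr, r', hr', e1, e2, h⟩
        rw [← (hinj false _ (hX i hi).2.1 _ hr).1 e1, ← (hinj false _ (hX j hj').2.1 _ hr').1 e2,
          hhd j hj'] at h
        exact hn h
    have hsh : ∀ j < u.length, X j ᵥ* shift = Pi.single (φ true (ρ j)) 1 := by
      intro j hj
      rw [(hX j hj).1, Matrix.single_one_vecMul]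
      funext b
      simp only [shift, Pi.single_apply, Matrix.row]
      congr 1
      apply propext
      constructor
      · rintro ⟨r, hr, e1, e2⟩
        rw [e2, (hinj false _ (hX j hj).2.1 _ hr).1 e1]
      · intro h
        exact ⟨ρ j, (hX j hj).2.1, rfl, h⟩
    have hj := (rightmost_le (fun j => P (ρ i) (view u j)) i).trans_lt hi
    simp only [layer, twoHeadLayer_apply, Matrix.cons_val_zero, Matrix.cons_val_one, hatt0, hatt1]
    rw [hsh _ hj, Matrix.vecMul_one, (hX i hi).1, hg1' _ (hX i hi).2.1 _ (hX _ hj).2.1, hhd _ hj]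
  -- All lookup layers.
  have h2 : ∀ (Qs : List Lookup) (X : ℕ → Fin dim → ℝ) (ρ : ℕ → List View),
      (∀ i < u.length, X i = e (ρ i) ∧ (ρ i).length + Qs.length ≤ Ps.length + 1 ∧
        (∀ v ∈ ρ i, v.1 < c ∧ v.2 ∈ V) ∧ (ρ i).head? = some (view u i)) →
      ∀ i < u.length, ((Qs.map layer).foldl (fun X ℓ => ℓ.apply X) X i = e (Qs.foldl
          (fun r P => r ++ [view u (rightmost (fun j => P r (view u j)) i)]) (ρ i))) ∧
        Qs.foldl (fun r P => r ++ [view u (rightmost (fun j => P r (view u j)) i)]) (ρ i) ∈ F := by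
    intro Qs
    induction Qs with
    | nil =>
      intro X ρ hX i hi
      obtain ⟨h1, h2, h3, -⟩ := hX i hi
      exact ⟨h1, (hF _).2 ⟨by simpa using h2, h3⟩⟩
    | cons P Qs ih =>
      intro X ρ hX i hi
      simp only [List.map_cons, List.foldl_cons]
      refine ih ((layer P).apply X)
        (fun i => ρ i ++ [view u (rightmost (fun j => P (ρ i) (view u j)) i)]) ?_ i hi
      intro i hi
      obtain ⟨-, e2, e3, e4⟩ := hX i hi
      refine ⟨h1 P X ρ (fun i hi => ?_) i hi, ?_, ?_, ?_⟩
      · obtain ⟨e1, e2, e3, e4⟩ := hX i hi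
        refine ⟨e1, (hF _).2 ⟨?_, e3⟩, e4⟩
        omega
      · simp only [List.length_append, List.length_cons, List.length_nil] at e2 ⊢
        omega
      · intro v hv
        rcases List.mem_append.1 hv with hv | hv
        · exact e3 v hv
        · rw [List.mem_singleton.1 hv]
          exact hview _ ((rightmost_le _ i).trans_lt hi)
      · rw [List.head?_append, e4]
        rfl
  have hlast : u.length - 1 < u.length := Nat.sub_lt (List.length_pos_iff.2 hu) one_pos
  obtain ⟨hX, hXF⟩ := h2 Ps (layer0.apply (T.embed u)) (fun i => [view u i])
    (fun i hi => ⟨h0 i hi, by simp; omega, by simpa using hview i hi, rfl⟩) _ hlast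
  have hlogit : ∀ a, T.logit u a =
      if out (registers Ps u (u.length - 1)) = a then 1 else 0 := by
    intro a
    have : T.output u (u.length - 1) = e (registers Ps u (u.length - 1)) := hX
    rw [UHAT.logit, this, single_one_dotProduct]
    simp only [T]
    congr 1
    apply propext
    constructor
    · rintro ⟨r, hr, h1, h2⟩
      rw [← (hinj false _ hXF _ hr).1 h1] at h2
      exact h2
    · intro h
      exact ⟨_, hXF, rfl, h⟩
  refine ⟨hout, fun b _ hb => ?_⟩
  rw [hlogit, hlogit, if_pos rfl, if_neg (Ne.symm hb)]
  exact one_pos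

theorem finite_tokenAlphabet (X : Finset Sym) (n : ℕ) : (tokenAlphabet X n).Finite := by
  have h : tokenAlphabet X n ⊆ Token.sym '' X ∪ Token.ident '' Set.Iio n ∪ Token.receive '' X ∪
      (fun q : Sym × ℕ => Token.send q.1 q.2) '' ((X : Set Sym) ×ˢ Set.Iio n) ∪
      Token.broadcast '' X ∪ {Token.eos} := by
    intro a ha
    cases a <;> simp_all [tokenAlphabet]
  refine Set.Finite.subset ?_ h
  have hX := X.finite_toSet
  have hn := Set.finite_Iio n
  exact (((((hX.image _).union (hn.image _)).union (hX.image _)).union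
    ((hX.prod hn).image _)).union (hX.image _)).union (Set.finite_singleton _)

/-! ### Runs given by a schedule of rounds -/

/-- One time step in which every agent has exactly one incoming edge: either every agent writes a
symbol, or the boss broadcasts `σ` while agent `r` sends `ρ` to the boss. -/
inductive Round (w : ℕ) : Type
  | quiet (lab : Fin w → Sym)
  | exchange (σ : Sym) (r : Fin w) (ρ : Sym)

/-- What an agent does in a round. -/
def Round.action {w : ℕ} (boss : Fin w) : Round w → Fin w → Action w
  | .quiet lab, i => .cot (lab i)
  | .exchange σ r ρ, i => if i = boss then .broadcast σ else if i = r then .send ρ boss else .idle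

/-- A schedule: `T` rounds at the times `1, …, T`, and possibly one last edge into the boss at time
`T + 1`, a message from another agent or a CoT edge. -/
structure Schedule (w : ℕ) where
  boss : Fin w
  T : ℕ
  round : ℕ → Round w
  final : Option (Fin w × Sym)
  ne_boss : ∀ t ≤ T, ∀ σ r ρ, round t = .exchange σ r ρ → r ≠ boss

namespace Schedule

variable {w : ℕ} (Z : Schedule w)

/-- What an agent does at time `T + 1`. -/
def finalAction (i : Fin w) : Action w :=
  match Z.final with
  | none => .idle
  | some (r, σ) => if i = r then (if r = Z.boss then .cot σ else .send σ Z.boss) else .idle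

/-- What an agent does at time `t`. -/
def out (i : Fin w) (t : ℕ) : Action w :=
  if 1 ≤ t ∧ t ≤ Z.T then (Z.round t).action Z.boss i
  else if t = Z.T + 1 then Z.finalAction i else .idle

/-- The lifetimes: only a last edge prolongs the life of the boss by one. -/
def len (i : Fin w) : ℕ := if i = Z.boss ∧ Z.final.isSome then Z.T + 2 else Z.T + 1

theorem out_of_le {t : ℕ} (h1 : 1 ≤ t) (h2 : t ≤ Z.T) (i : Fin w) :
    Z.out i t = (Z.round t).action Z.boss i := by
  rw [out, if_pos ⟨h1, h2⟩]

theorem out_final (i : Fin w) : Z.out i (Z.T + 1) = Z.finalAction i := by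
  rw [out, if_neg (by omega), if_pos rfl]

theorem out_eq_idle {t : ℕ} (h : t = 0 ∨ Z.T + 1 < t) (i : Fin w) : Z.out i t = .idle := by
  rw [out, if_neg (by omega), if_neg (by omega)]

theorem le_len (i : Fin w) : Z.T + 1 ≤ Z.len i := by
  unfold len
  split_ifs <;> omega

theorem len_le (i : Fin w) : Z.len i ≤ Z.T + 2 := by
  unfold len
  split_ifs <;> omega

/-- The agent at the source of the edge into agent `i` from a round. -/
def source (boss : Fin w) : Round w → Fin w → Fin w
  | .quiet _, i => i
  | .exchange _ r _, i => if i = boss then r else boss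

theorem edge_round_iff {t : ℕ} (h1 : 1 ≤ t) (h2 : t ≤ Z.T) (u : Fin w × ℕ) (i : Fin w) :
    (CommEdge Z.out u (i, t + 1) ∨ CoTEdge Z.out u (i, t + 1)) ↔
      u = (source Z.boss (Z.round t) i, t) := by
  obtain ⟨j, t'⟩ := u
  simp only [CommEdge, CoTEdge, Nat.add_right_cancel_iff, Prod.mk.injEq]
  by_cases ht : t = t'
  · subst ht
    simp only [true_and, and_true, Z.out_of_le h1 h2]
    rcases hr : Z.round t with lab | ⟨σ, r, ρ⟩
    · simp [Round.action, Action.message, source, eq_comm]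
    · have hne := Z.ne_boss t h2 σ r ρ hr
      simp only [Round.action, source]
      by_cases hj : j = Z.boss
      · subst hj
        by_cases hi : i = Z.boss
        · subst hi
          simp [Action.message, hne.symm]
        · simp [Action.message, hi, Ne.symm hi]
      · by_cases hjr : j = r
        · subst hjr
          by_cases hi : i = Z.boss
          · subst hi
            simp [Action.message, hj]
          · simp [Action.message, hj, hi, Ne.symm hi]
        · by_cases hi : i = Z.boss <;> simp [Action.message, hj, hjr, hi]
  · simp [ht, Ne.symm ht]

theorem edge_final_iff (u : Fin w × ℕ) (i : Fin w) :
    (CommEdge Z.out u (i, Z.T + 1 + 1) ∨ CoTEdge Z.out u (i, Z.T + 1 + 1)) ↔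
      i = Z.boss ∧ ∃ r σ, Z.final = some (r, σ) ∧ u = (r, Z.T + 1) := by
  obtain ⟨j, t'⟩ := u
  simp only [CommEdge, CoTEdge, Nat.add_right_cancel_iff, Prod.mk.injEq]
  by_cases ht : Z.T + 1 = t'
  · subst ht
    simp only [true_and, and_true, Z.out_final, finalAction]
    rcases Z.final with _ | ⟨r, σ⟩
    · simp [Action.message]
    · simp only [Option.some.injEq, Prod.mk.injEq]
      by_cases hj : j = r
      · subst hj
        by_cases hjb : j = Z.boss
        · subst hjb
          simp [Action.message]
        · by_cases hi : i = Z.boss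
          · subst hi
            simp [Action.message, hjb]
          · simp [Action.message, hjb, hi, Ne.symm hi]
      · simp only [hj, if_false]
        simp [Action.message, hj]
  · simp [ht, Ne.symm ht]

theorem not_edge {u v : Fin w × ℕ} (h : u.2 = 0 ∨ Z.T + 1 < u.2) :
    ¬ (CommEdge Z.out u v ∨ CoTEdge Z.out u v) := by
  simp [CommEdge, CoTEdge, Z.out_eq_idle h, Action.message]

/-- The run of a schedule. -/
def graph : AgentGraph w where
  len := Z.len
  out := Z.out
  len_pos i := le_trans (by omega) (Z.le_len i)
  out_idle i t h := by
    have h1 := Z.le_len i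
    simp only [IsNode, not_and_or, not_le] at h
    exact Z.out_eq_idle (by omega) i
  send_ne i t s j h := by
    unfold out at h
    split_ifs at h with h1 h2
    · rcases hr : Z.round t with lab | ⟨σ, r, ρ⟩
      · simp [hr, Round.action] at h
      · simp only [hr, Round.action] at h
        split_ifs at h with h3 h4
        simp only [Action.send.injEq] at h
        rw [← h.2]
        exact Ne.symm h3
    · unfold finalAction at h
      split at h
      · simp at h
      · split_ifs at h with h3 h4
        simp only [Action.send.injEq] at h
        rw [← h.2, h3]
        exact Ne.symm h4
  target_isNode u v h := by
    have hu : 1 ≤ u.2 ∧ u.2 ≤ Z.T + 1 := by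
      by_contra hn
      exact Z.not_edge (by omega) h
    obtain ⟨i, t⟩ := v
    have ht : t = u.2 + 1 := by
      rcases h with h | h <;> exact h.1
    subst ht
    refine ⟨by simp, ?_⟩
    rcases Nat.lt_or_ge Z.T u.2 with hlt | hge
    · have e : u.2 = Z.T + 1 := by omega
      rw [e] at h ⊢
      obtain ⟨hi, r, σ, hf, -⟩ := (Z.edge_final_iff u i).1 h
      simp [len, hi, hf]
    · have := Z.le_len i
      simp only
      omega
  incoming v hv h2 := by
    obtain ⟨i, t⟩ := v
    simp only at h2
    obtain ⟨t, rfl⟩ : ∃ t', t = t' + 1 := ⟨t - 1, by omega⟩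
    have hl : t + 1 ≤ Z.len i := hv.2
    rcases Nat.lt_or_ge Z.T t with hlt | hge
    · have hl' := Z.len_le i
      obtain rfl : t = Z.T + 1 := by omega
      unfold len at hl
      split_ifs at hl with hb
      · obtain ⟨⟨r, σ⟩, hf⟩ := Option.isSome_iff_exists.1 hb.2
        refine ⟨(r, Z.T + 1), (Z.edge_final_iff _ _).2 ⟨hb.1, r, σ, hf, rfl⟩, ?_⟩
        intro u hu
        obtain ⟨-, r', σ', hf', e⟩ := (Z.edge_final_iff _ _).1 hu
        rw [hf] at hf'
        simp only [Option.some.injEq, Prod.mk.injEq] at hf'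
        rw [e, ← hf'.1]
      · omega
    · exact ⟨_, (Z.edge_round_iff (by omega) hge _ i).2 rfl,
        fun u hu => (Z.edge_round_iff (by omega) hge u i).1 hu⟩

/-! ### Costs -/

theorem depth_le : Z.graph.depth ≤ Z.T + 2 := Z.graph.depth_le_of_len_le Z.len_le

theorem size_le : Z.graph.size ≤ w * (Z.T + 2) := by
  have h : {v | IsNode Z.graph.len v} ⊆
      ((Finset.univ ×ˢ Finset.Icc 1 (Z.T + 2) : Finset (Fin w × ℕ)) : Set (Fin w × ℕ)) := by
    rintro ⟨i, t⟩ ⟨h1, h2⟩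
    have := Z.len_le i
    have h3 : t ≤ Z.len i := h2
    simp only at h1
    simp only [Finset.coe_product, Set.mem_prod, Finset.mem_coe, Finset.mem_univ, true_and,
      Finset.mem_Icc]
    omega
  have := Set.ncard_le_ncard h (Finset.finite_toSet _)
  rw [Set.ncard_coe_finset] at this
  simpa [AgentGraph.size] using this

theorem target_eq_boss {u v : Fin w × ℕ} (h : CommEdge Z.out u v) (hu : u.1 ≠ Z.boss) :
    v.1 = Z.boss := by
  obtain ⟨-, s, hs⟩ := h
  unfold out at hs
  split_ifs at hs
  · rcases hr : Z.round u.2 with lab | ⟨σ, r, ρ⟩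
    · simp [hr, Round.action, Action.message] at hs
    · simp only [hr, Round.action, hu, if_false] at hs
      split_ifs at hs
      · simp only [Action.message] at hs
        split_ifs at hs with h
        exact h.2.symm
      · simp [Action.message] at hs
  · unfold finalAction at hs
    split at hs
    · simp [Action.message] at hs
    · split_ifs at hs with h1 h2
      · simp [Action.message] at hs
      · simp only [Action.message] at hs
        split_ifs at hs with h
        exact h.2.symm
      · simp [Action.message] at hs
  · simp [Action.message] at hs

/-- All communication is between the boss and other agents. -/
theorem comm_le : Z.graph.comm ≤ 2 * (Z.T + 3) := by
  have h : {u | ∃ v, CommEdge Z.graph.out u v} ⊆ Z.graph.crossing {Z.boss} := by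
    rintro u ⟨v, hv⟩
    refine ⟨v, hv, fun h => ?_⟩
    have hne : u.1 ≠ v.1 := Action.ne_of_message hv.2.choose_spec
    by_cases hu : u.1 = Z.boss
    · exact hne (hu.trans (h.1 hu).symm)
    · exact hu (h.2 (Z.target_eq_boss hv hu))
  exact (Set.ncard_le_ncard h (Z.graph.crossing_finite _)).trans
    (Z.graph.ncard_crossing_singleton_le Z.boss Z.depth_le)

/-! ### Contexts -/

theorem findSome?_finRange_eq {β : Type*} {f : Fin w → Option β} {i : Fin w} {b : β}
    (h : f i = some b) (h' : ∀ j ≠ i, f j = none) : (List.finRange w).findSome? f = some b := by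
  have hs : ((List.finRange w).findSome? f).isSome := by
    rw [List.findSome?_isSome_iff]
    exact ⟨i, List.mem_finRange i, by simp [h]⟩
  obtain ⟨c, hc⟩ := Option.isSome_iff_exists.1 hs
  obtain ⟨j, -, hj⟩ := List.exists_of_findSome?_eq_some hc
  by_cases hji : j = i
  · rw [hji, h] at hj
    rw [hc, hj]
  · rw [h' j hji] at hj
    cases hj

theorem before_one (init : List Token) (i : Fin w) : Z.graph.before init i 1 = init := by
  have h0 : ∀ j, Z.graph.out j 0 = .idle := Z.out_eq_idle (Or.inl rfl)
  simp only [AgentGraph.before, AgentGraph.received, h0]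
  simp [Action.token, Action.message]

theorem before_succ_quiet {t : ℕ} (h1 : 1 ≤ t) (h2 : t ≤ Z.T) {lab : Fin w → Sym}
    (hr : Z.round t = .quiet lab) (init : List Token) (i : Fin w) :
    Z.graph.before init i (t + 1) = Z.graph.before init i t ++ [.sym (lab i)] := by
  have h0 : ∀ j, Z.graph.out j t = .cot (lab j) := fun j => by
    change Z.out j t = _
    rw [Z.out_of_le h1 h2, hr]
    rfl
  rw [AgentGraph.before, AgentGraph.received]
  simp only [Nat.add_sub_cancel, h0]
  simp [Action.token, Action.message]

/-- What an agent appends to its context in an exchange. -/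
def exchangeTokens (boss : Fin w) (σ : Sym) (r : Fin w) (ρ : Sym) (i : Fin w) : List Token :=
  if i = boss then [.broadcast σ, .receive ρ]
  else if i = r then [.send ρ boss, .receive σ] else [.receive σ]

theorem before_succ_exchange {t : ℕ} (h1 : 1 ≤ t) (h2 : t ≤ Z.T) {σ ρ : Sym} {r : Fin w}
    (hr : Z.round t = .exchange σ r ρ) (init : List Token) (i : Fin w) :
    Z.graph.before init i (t + 1) =
      Z.graph.before init i t ++ exchangeTokens Z.boss σ r ρ i := by
  have h0 : ∀ j, Z.graph.out j t =
      if j = Z.boss then .broadcast σ else if j = r then .send ρ Z.boss else .idle := fun j => by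
    change Z.out j t = _
    rw [Z.out_of_le h1 h2, hr]
    rfl
  have hne := Z.ne_boss t h2 σ r ρ hr
  have hrec : Z.graph.received i (t + 1) = some (if i = Z.boss then ρ else σ) := by
    unfold AgentGraph.received
    simp only [Nat.add_sub_cancel, h0]
    by_cases hi : i = Z.boss
    · apply findSome?_finRange_eq (i := r)
      · simp [hi, hne, Action.message]
      · intro j hj
        by_cases hjb : j = Z.boss <;> simp [hjb, hj, hi, Action.message]
    · apply findSome?_finRange_eq (i := Z.boss)
      · simp [hi, Action.message, Ne.symm hi]
      · intro j hj
        by_cases hjr : j = r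
        · simp [hjr, hne, Action.message, Ne.symm hi]
        · simp [hj, hjr, Action.message]
  rw [AgentGraph.before, hrec, h0, exchangeTokens]
  by_cases hi : i = Z.boss
  · simp [hi, Action.token]
  · by_cases hir : i = r <;> simp [hi, hir, hne, Action.token]

theorem before_final_cot {σ : Sym} (hf : Z.final = some (Z.boss, σ)) (init : List Token) :
    Z.graph.before init Z.boss (Z.T + 2) = Z.graph.before init Z.boss (Z.T + 1) ++ [.sym σ] := by
  have h0 : ∀ j, Z.graph.out j (Z.T + 1) = if j = Z.boss then .cot σ else .idle := fun j => by
    change Z.out j _ = _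
    rw [Z.out_final, finalAction, hf]
    by_cases hj : j = Z.boss <;> simp [hj]
  have hrec : Z.graph.received Z.boss (Z.T + 2) = none := by
    unfold AgentGraph.received
    rw [List.findSome?_eq_none_iff]
    intro j _
    change (Z.graph.out j (Z.T + 1)).message j Z.boss = none
    rw [h0]
    by_cases hj : j = Z.boss <;> simp [hj, Action.message]
  rw [AgentGraph.before, hrec, h0]
  simp [Action.token]

theorem before_final_send {r : Fin w} {σ : Sym} (hr : r ≠ Z.boss) (hf : Z.final = some (r, σ))
    (init : List Token) :
    Z.graph.before init Z.boss (Z.T + 2) =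
      Z.graph.before init Z.boss (Z.T + 1) ++ [.receive σ] := by
  have h0 : ∀ j, Z.graph.out j (Z.T + 1) = if j = r then .send σ Z.boss else .idle := fun j => by
    change Z.out j _ = _
    rw [Z.out_final, finalAction, hf]
    by_cases hj : j = r <;> simp [hj, hr]
  have hrec : Z.graph.received Z.boss (Z.T + 2) = some σ := by
    unfold AgentGraph.received
    simp only [Nat.add_succ_sub_one, h0]
    apply findSome?_finRange_eq (i := r)
    · simp [hr, Action.message]
    · intro j hj
      simp [hj, Action.message]
  rw [AgentGraph.before, hrec, h0]
  simp [Action.token, hr.symm]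

end Schedule

/-- The context at a node extends the initial context by at most two tokens for each time step, and all
of these carry labels of the run. -/
theorem AgentGraph.before_eq_append {w : ℕ} (G : AgentGraph w) {X : Set Sym}
    (hX : ∀ i t s, G.out i t = .cot s ∨ (∃ j, G.out i t = .send s j) ∨ G.out i t = .broadcast s →
      s ∈ X) (init : List Token) (i : Fin w) (t : ℕ) :
    ∃ tail, G.before init i t = init ++ tail ∧ tail.length ≤ 2 * t ∧ ∀ a ∈ tail, ∃ s ∈ X,
      a = .sym s ∨ a = .receive s ∨ a = .broadcast s ∨ ∃ j : Fin w, a = .send s j := by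
  induction t with
  | zero => exact ⟨[], by simp [before]⟩
  | succ t ih =>
    obtain ⟨tail, h1, h2, h3⟩ := ih
    refine ⟨tail ++ (G.out i t).token.toList ++
      ((G.received i (t + 1)).map Token.receive).toList, ?_, ?_, ?_⟩
    · simp [before, h1]
    · have e1 : (G.out i t).token.toList.length ≤ 1 := Option.length_toList_le
      have e2 : ((G.received i (t + 1)).map Token.receive).toList.length ≤ 1 :=
        Option.length_toList_le
      simp only [List.length_append]
      omega
    · intro a ha
      rcases List.mem_append.1 ha with ha | ha
      · rcases List.mem_append.1 ha with ha | ha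
        · exact h3 a ha
        · rw [Option.mem_toList] at ha
          rcases h : G.out i t with _ | s | ⟨s, j⟩ | s
          · simp [h, Action.token] at ha
          all_goals
            simp only [h, Action.token, Option.some.injEq] at ha
            subst ha
            refine ⟨s, hX i t s (by simp [h]), by simp⟩
      · simp only [Option.mem_toList, Option.map_eq_some_iff] at ha
        obtain ⟨s, hs, rfl⟩ := ha
        obtain ⟨j, -, hj⟩ := List.exists_of_findSome?_eq_some hs
        refine ⟨s, ?_, by simp⟩
        rw [Nat.add_sub_cancel] at hj
        obtain ⟨o, ho⟩ := Action.exists_commAction hj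
        cases o with
        | none => exact hX j t s (Or.inr (Or.inr ho))
        | some j' => exact hX j t s (Or.inr (Or.inl ⟨j', ho⟩))

/-! ### The protocol -/

/-- The messages and notes of the protocol.  The number `s` counts hops, starting from `1`: the next hop to
be done is the `s`-th one, and `x` is the object to which it applies.
`solo s x`: note of agent `0`, which has done all hops before the `s`-th on its own.
`miss s`: agent `0` has been unable to do some hop before the `s`-th on its own.
`wait s`: note of the other agents during these attempts.
`ask s x`: agent `0` asks for the fact needed for the `s`-th hop.
`reply s x`: the hop before the `s`-th has led to `x`.
`ready s`: the agents proceed to the `s`-th hop.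
`ping`: a message without content, sent by agent `1`. -/
inductive Msg : Type
  | solo (s x : ℕ)
  | miss (s : ℕ)
  | wait (s : ℕ)
  | reply (s x : ℕ)
  | ask (s x : ℕ)
  | ready (s : ℕ)
  | ping

namespace Msg

/-- Messages as symbols. -/
def sym : Msg → Sym
  | solo s x => .aux (Nat.pair 0 (Nat.pair s x))
  | miss s => .aux (Nat.pair 1 (Nat.pair s 0))
  | wait s => .aux (Nat.pair 2 (Nat.pair s 0))
  | reply s x => .aux (Nat.pair 3 (Nat.pair s x))
  | ask s x => .aux (Nat.pair 4 (Nat.pair s x))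
  | ready s => .aux (Nat.pair 5 (Nat.pair s 0))
  | ping => .aux (Nat.pair 6 (Nat.pair 0 0))

theorem sym_injective : Function.Injective sym := by
  intro a b h
  cases a <;> cases b <;> simp_all [sym, Nat.pair_eq_pair]

/-- The number of the hop that a message refers to. -/
def step : Msg → ℕ
  | solo s _ | miss s | wait s | reply s _ | ask s _ | ready s => s
  | ping => 0

/-- The object that a message refers to. -/
def object : Msg → ℕ
  | solo _ x | reply _ x | ask _ x => x
  | _ => 0

end Msg

open Classical in
/-- The message encoded by a symbol. -/
noncomputable def Sym.msg (σ : Sym) : Option Msg :=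
  if h : ∃ μ : Msg, μ.sym = σ then some h.choose else none

@[simp]
theorem Msg.msg_sym (μ : Msg) : μ.sym.msg = some μ := by
  have h : ∃ ν : Msg, ν.sym = μ.sym := ⟨μ, rfl⟩
  rw [Sym.msg, dif_pos h, Msg.sym_injective h.choose_spec]

@[simp]
theorem Sym.msg_obj (x : ℕ) : (Sym.obj x).msg = none := by
  rw [Sym.msg, dif_neg]
  rintro ⟨μ, h⟩
  cases μ <;> cases h

/-- The message carried by a token. -/
noncomputable def Token.msg : Token → Option Msg
  | .sym σ | .receive σ | .broadcast σ => σ.msg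
  | _ => none

open Classical in
/-- The message that determines the next hop: the last one, or the last but one if the last one has no
content. -/
noncomputable def focus (last prev : Token) : Option Msg :=
  if last.msg = some .ping then prev.msg else last.msg

/-- The number of the next hop. -/
noncomputable def focusStep (last prev : Token) : ℕ := (focus last prev).elim 0 Msg.step

/-- The object to which the next hop applies. -/
noncomputable def focusObject (last prev : Token) : ℕ := (focus last prev).elim 0 Msg.object

open Classical in
/-- The next token of agent `id`, whose last two tokens are `last` and `prev`.  The query starts at `start`
and has the next hop if `more` holds, and `found` is the value of the fact for this hop, if the agent has this
fact.  An agent without a task predicts the end of the sequence, which messages may override. -/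
noncomputable def protocol (id : ℕ) (last prev : Token) (start : ℕ) (more : Prop)
    (found : Option ℕ) : Token :=
  match last with
  | .ident _ => if id = 0 then .sym (Msg.solo 1 start).sym else .sym (Msg.wait 0).sym
  | .sym σ =>
    match σ.msg with
    | some (.solo s x) =>
      if more then
        match found with
        | some y => .sym (Msg.solo (s + 1) y).sym
        | none => .sym (Msg.miss (s + 1)).sym
      else .sym (.obj x)
    | some (.miss s) => if more then .sym (Msg.miss (s + 1)).sym else .sym (Msg.reply 1 start).sym
    | some (.wait s) =>
      if s = 0 ∨ more then .sym (Msg.wait (s + 1)).sym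
      else if id = 1 then .send Msg.ping.sym 0 else .eos
    | some (.reply s x) => if more then .broadcast (Msg.ask s x).sym else .sym (.obj x)
    | some (.ready _) => if more ∧ id = 1 then .send Msg.ping.sym 0 else .eos
    | _ => .eos
  | .receive σ =>
    match σ.msg with
    | some (.reply s x) => if more then .broadcast (Msg.ask s x).sym else .sym (.obj x)
    | some (.ready _) => if more ∧ id = 1 then .send Msg.ping.sym 0 else .eos
    | some (.ask s _) =>
      match found with
      | some y => .send (Msg.reply (s + 1) y).sym 0
      | none => .sym (Msg.ready (s + 1)).sym
    | some .ping =>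
      match prev.msg with
      | some (.ask s _) =>
        match found with
        | some y => .sym (Msg.reply (s + 1) y).sym
        | none => .broadcast (Msg.ready (s + 1)).sym
      | _ => .eos
    | _ => .eos
  | _ => .eos

/-! ### The protocol in terms of lookups -/

/-- The `n`-th view in a list. -/
def reg (r : List View) (n : ℕ) : View := r.getD n (0, .eos)

/-- The function name for the next hop, found by its distance from the end of the query.  It is the first
object or function name that precedes the identifier by this distance. -/
def isQuery : Lookup := fun r v =>
  v.1 + focusStep (reg r 0).2 (reg r 1).2 + 1 = (reg r 2).1 ∧ ∃ f, v.2 = .sym (.fn f)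

/-- The fact for the next hop. -/
def isFact : Lookup := fun r v =>
  isQuery r (reg r 4) ∧ ∃ f y, (reg r 4).2 = .sym (.fn f) ∧
    v.2 = .sym (.fact f (focusObject (reg r 0).2 (reg r 1).2) y)

/-- The lookups of the protocol: the previous token, the identifier, the start of the query (just before the
identifier), the function name and the fact for the next hop. -/
def protocolLookups : List Lookup :=
  [fun r v => v.1 + 1 = (reg r 0).1, fun _ v => ∃ i, v.2 = .ident i,
    fun r v => v.1 + 1 = (reg r 2).1, isQuery, isFact]

open Classical in
/-- The next token in terms of the views that the lookups have found. -/
noncomputable def protocolOutput (r : List View) : Token :=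
  protocol (match (reg r 2).2 with | .ident i => i | _ => 0) (reg r 0).2 (reg r 1).2
    (match (reg r 3).2 with | .sym (.obj x) => x | _ => 0) (isQuery r (reg r 4))
    (if isFact r (reg r 5) then match (reg r 5).2 with | .sym (.fact _ _ y) => some y | _ => none
      else none)

/-- The tokens that may follow the initial context. -/
def Token.IsPlain (a : Token) : Prop :=
  (∀ i, a ≠ .ident i) ∧ ∀ f x y, a ≠ .sym (.fact f x y)

section context

variable {d m : ℕ → ℕ} {N k w : ℕ} (x : KHop d m N k) (i : Fin w) (tail : List Token)

theorem KHop.fact_mem_chunk {σ : Sym} : σ ∈ x.chunk w i ↔ ∃ r : Fin N,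
    (i.val * N / w ≤ r.val ∧ r.val < (i.val + 1) * N / w) ∧
      Sym.fact (x.fn r) (x.arg r) (x.val r) = σ := by
  simp [KHop.chunk, List.mem_map, List.mem_filter]

theorem context_length : (x.context w i ++ tail).length =
    (x.chunk w i).length + k + 2 + tail.length := by
  simp [KHop.context]
  omega

theorem view_chunk {j : ℕ} (hj : j < (x.chunk w i).length) :
    ∃ σ ∈ x.chunk w i, (view (x.context w i ++ tail) j).2 = .sym σ := by
  refine ⟨(x.chunk w i)[j], List.getElem_mem hj, ?_⟩
  simp [view, KHop.context, List.getElem?_append_left, hj]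

theorem view_query {j : ℕ} (hj : j < k) :
    (view (x.context w i ++ tail) ((x.chunk w i).length + j)).2 =
      .sym (.fn (x.query ⟨j, hj⟩)) := by
  simp [view, KHop.context, List.getElem?_append_left, List.getElem?_append_right, hj]

theorem view_start :
    (view (x.context w i ++ tail) ((x.chunk w i).length + k)).2 = .sym (.obj x.start) := by
  simp [view, KHop.context]

theorem view_ident :
    (view (x.context w i ++ tail) ((x.chunk w i).length + k + 1)).2 = .ident i := by
  simp only [view, KHop.context, List.map_append, List.append_assoc]
  rw [List.getD_append_right _ _ _ _ (by simp; omega), List.getD_append_right _ _ _ _ (by simp; omega),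
    List.getD_append_right _ _ _ _ (by simp; omega)]
  simp [show (x.chunk w i).length + k + 1 - (x.chunk w i).length - k - 1 = 0 by omega]

theorem view_tail (ht : ∀ a ∈ tail, a.IsPlain) {j : ℕ} (hj : (x.chunk w i).length + k + 1 < j) :
    (view (x.context w i ++ tail) j).2.IsPlain := by
  have hl : (x.context w i).length ≤ j := by
    have := context_length x i []
    simp at this
    omega
  simp only [view]
  rw [List.getD_append_right _ _ _ _ hl]
  rcases Nat.lt_or_ge (j - (x.context w i).length) tail.length with h | h
  · rw [List.getD_eq_getElem _ _ h]
    exact ht _ (List.getElem_mem h)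
  · rw [List.getD_eq_default _ _ h]
    exact ⟨by simp, by simp⟩

/-- On the contexts that occur, the lookups find what the protocol needs. -/
theorem protocolOutput_registers (ht : ∀ a ∈ tail, a.IsPlain) {last prev : Token}
    (hlast : (x.context w i ++ tail).getD ((x.chunk w i).length + k + 1 + tail.length) .eos = last)
    (hprev : (x.context w i ++ tail).getD ((x.chunk w i).length + k + tail.length) .eos = prev)
    (found : Option ℕ)
    (hfound : ∀ y, found = some y ↔ ∃ (j : Fin k) (r : Fin N), j.1 + focusStep last prev = k ∧
      (i.val * N / w ≤ r.val ∧ r.val < (i.val + 1) * N / w) ∧ x.fn r = x.query j ∧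
        (x.arg r : ℕ) = focusObject last prev ∧ (x.val r : ℕ) = y) :
    protocolOutput (registers protocolLookups (x.context w i ++ tail)
        ((x.context w i ++ tail).length - 1)) =
      protocol i last prev x.start (1 ≤ focusStep last prev ∧ focusStep last prev ≤ k) found := by
  set u := x.context w i ++ tail with hu
  set c := (x.chunk w i).length with hc
  have hlen : u.length - 1 = c + k + 1 + tail.length := by
    rw [hu, context_length]
    omega
  set p := u.length - 1 with hp
  have hident : ∀ j n, (view u j).2 = .ident n → j = c + k + 1 := by
    intro j n h
    by_contra hj
    rcases Nat.lt_or_ge j c with h1 | h1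
    · obtain ⟨σ, -, h2⟩ := view_chunk x i tail h1
      simp [← hu, h] at h2
    · rcases Nat.lt_or_ge j (c + k) with h2 | h2
      · have := view_query x i tail (j := j - c) (by omega)
        rw [← hc, show c + (j - c) = j by omega, ← hu, h] at this
        cases this
      · rcases Nat.eq_or_lt_of_le h2 with h3 | h3
        · have := view_start x i tail
          rw [← hc, h3, ← hu, h] at this
          cases this
        · exact (view_tail x i tail ht (j := j) (by omega)).1 n h
  have hfact : ∀ j f a y, (view u j).2 = .sym (.fact f a y) → Sym.fact f a y ∈ x.chunk w i := by
    intro j f a y h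
    rcases Nat.lt_or_ge j c with h1 | h1
    · obtain ⟨σ, h3, h2⟩ := view_chunk x i tail h1
      rw [← hu, h] at h2
      cases h2
      exact h3
    · rcases Nat.lt_or_ge j (c + k) with h2 | h2
      · have := view_query x i tail (j := j - c) (by omega)
        rw [← hc, show c + (j - c) = j by omega, ← hu, h] at this
        cases this
      · rcases Nat.eq_or_lt_of_le h2 with h3 | h3
        · have := view_start x i tail
          rw [← hc, h3, ← hu, h] at this
          cases this
        · rcases Nat.eq_or_lt_of_le h3 with h4 | h4
          · have := view_ident x i tail
            rw [← hc, ← hu, show c + k + 1 = j from h4, h] at this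
            cases this
          · exact absurd h ((view_tail x i tail ht (j := j) (by omega)).2 f a y)
  -- The first four registers.
  have e0 : view u p = (p, last) := by
    rw [view, ← hlast, hlen]
  obtain ⟨j1, hj1⟩ : ∃ j, j = rightmost (fun j => (view u j).1 + 1 = p) p := ⟨_, rfl⟩
  have e1 : view u j1 = (c + k + tail.length, prev) := by
    have h : j1 + 1 = p := by
      rw [hj1]
      exact rightmost_spec (P := fun j => (view u j).1 + 1 = p) (j := c + k + tail.length)
        (by omega) (by simp only [view]; omega)
    obtain rfl : j1 = c + k + tail.length := by omega
    rw [view, hprev]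
  obtain ⟨j2, hj2⟩ : ∃ j, j = rightmost (fun j => ∃ n, (view u j).2 = .ident n) p := ⟨_, rfl⟩
  have e2 : view u j2 = (c + k + 1, .ident i) := by
    have h : ∃ n, (view u j2).2 = .ident n := by
      rw [hj2]
      exact rightmost_spec (P := fun j => ∃ n, (view u j).2 = .ident n) (j := c + k + 1)
        (by omega) ⟨i, view_ident x i tail⟩
    obtain ⟨n, h⟩ := h
    rw [hident _ _ h]
    exact Prod.ext rfl (view_ident x i tail)
  obtain ⟨j3, hj3⟩ : ∃ j, j = rightmost (fun j => (view u j).1 + 1 = (view u j2).1) p := ⟨_, rfl⟩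
  have e3 : view u j3 = (c + k, .sym (.obj x.start)) := by
    have h : j3 + 1 = c + k + 1 := by
      rw [hj3, e2]
      exact rightmost_spec (P := fun j => (view u j).1 + 1 = c + k + 1) (j := c + k)
        (by omega) rfl
    obtain rfl : j3 = c + k := by omega
    exact Prod.ext rfl (view_start x i tail)
  -- The function name.
  set s := focusStep last prev with hs
  let isQ : View → Prop := fun v => v.1 + s + 1 = c + k + 1 ∧ ∃ f, v.2 = .sym (.fn f)
  obtain ⟨j4, hj4⟩ : ∃ j, j = rightmost (fun j => isQ (view u j)) p := ⟨_, rfl⟩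
  have hquery : ∀ j, isQ (view u j) ↔ ∃ j' : Fin k, j'.1 + s = k ∧ j = c + j' := by
    intro j
    constructor
    · rintro ⟨h1, f, h2⟩
      have h1' : j + s + 1 = c + k + 1 := h1
      rcases Nat.lt_or_ge j c with h3 | h3
      · obtain ⟨σ, h5, h4⟩ := view_chunk x i tail h3
        rw [← hu, h2] at h4
        cases h4
        obtain ⟨r, -, h6⟩ := (x.fact_mem_chunk i).1 h5
        cases h6
      · rcases Nat.eq_or_lt_of_le (show j ≤ c + k by omega) with h4 | h4
        · have := view_start x i tail
          rw [← hc, ← h4, ← hu, h2] at this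
          cases this
        · exact ⟨⟨j - c, by omega⟩, by simp only; omega, by simp only; omega⟩
    · rintro ⟨j', h1, rfl⟩
      exact ⟨by simp only [view]; omega, _, view_query x i tail j'.2⟩
  have hmore : isQ (view u j4) ↔ (1 ≤ s ∧ s ≤ k) := by
    constructor
    · intro h
      obtain ⟨j', h1, -⟩ := (hquery _).1 h
      have := j'.2
      omega
    · rintro ⟨h1, h2⟩
      rw [hj4]
      exact rightmost_spec (P := fun j => isQ (view u j)) (j := c + (k - s)) (by omega)
        ((hquery _).2 ⟨⟨k - s, by omega⟩, by simp only; omega, rfl⟩)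
  -- The fact.
  let isF : View → Prop := fun v => isQ (view u j4) ∧ ∃ f y, (view u j4).2 = .sym (.fn f) ∧
    v.2 = .sym (.fact f (focusObject last prev) y)
  obtain ⟨j5, hj5⟩ : ∃ j, j = rightmost (fun j => isF (view u j)) p := ⟨_, rfl⟩
  have hreg : registers protocolLookups u p =
      [view u p, view u j1, view u j2, view u j3, view u j4, view u j5] := by
    simp only [registers, protocolLookups, List.foldl_cons, List.foldl_nil, isQuery, isFact, reg,
      List.cons_append, List.nil_append, List.getD_cons_zero, List.getD_cons_succ, hj5, isF]
    rw [← hj2, ← hj3]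
    simp only [e0, e2, ← hj1]
    simp only [e1, ← hs, ← hj4, isQ]
  have hQ : isQuery [view u p, view u j1, view u j2, view u j3, view u j4, view u j5] (view u j4) ↔
      isQ (view u j4) := by
    simp only [isQuery, reg, List.getD_cons_zero, List.getD_cons_succ, e0, e1, e2, ← hs, isQ]
  have hF : isFact [view u p, view u j1, view u j2, view u j3, view u j4, view u j5] (view u j5) ↔
      isF (view u j5) := by
    have : reg [view u p, view u j1, view u j2, view u j3, view u j4, view u j5] 4 = view u j4 := rfl
    simp only [isFact, this, hQ]
    simp only [reg, List.getD_cons_zero, List.getD_cons_succ, e0, e1, isF]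
  have hQj : isQ (view u j4) → ∃ j' : Fin k, j'.1 + s = k ∧ (view u j4).2 = .sym (.fn (x.query j')) := by
    intro h
    obtain ⟨j', h1, h2⟩ := (hquery _).1 h
    exact ⟨j', h1, by rw [h2]; exact view_query x i tail j'.2⟩
  have hval : ∀ f a y, isF (view u j5) → (view u j5).2 = .sym (.fact f a y) → found = some y := by
    rintro f a y ⟨hq, f', y', h1, h2⟩ h
    obtain ⟨j', h3, h4⟩ := hQj hq
    rw [h1] at h4
    rw [h2] at h
    cases h4
    cases h
    obtain ⟨r, h5, h6⟩ := (x.fact_mem_chunk i).1 (hfact _ _ _ _ h2)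
    simp only [Sym.fact.injEq] at h6
    exact (hfound _).2 ⟨j', r, h3, h5, Fin.ext h6.1, h6.2.1, h6.2.2⟩
  have hnone : ¬ isF (view u j5) → found = none := by
    intro h
    by_contra hne
    obtain ⟨y, hy⟩ := Option.ne_none_iff_exists'.1 hne
    obtain ⟨j', r, h1, h2, h3, h4, h5⟩ := (hfound y).1 hy
    have hq : isQ (view u j4) := hmore.2 (by have := j'.2; omega)
    obtain ⟨j'', h6, h7⟩ := hQj hq
    obtain rfl : j' = j'' := Fin.ext (by omega)
    obtain ⟨l, hl, hl'⟩ := List.getElem_of_mem ((x.fact_mem_chunk i).2 ⟨r, h2, rfl⟩)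
    apply h
    rw [hj5]
    refine rightmost_spec (P := fun j => isF (view u j)) (j := l) (by omega)
      ⟨hq, x.query j', x.val r, h7, ?_⟩
    rw [← h4, ← h3, ← hl']
    simp [hu, view, KHop.context, List.getElem?_append_left, hl]
  rw [hreg, protocolOutput]
  have hr : ∀ l0 l1 l2 l3 l4 l5 : View, reg [l0, l1, l2, l3, l4, l5] 0 = l0 ∧
      reg [l0, l1, l2, l3, l4, l5] 1 = l1 ∧ reg [l0, l1, l2, l3, l4, l5] 2 = l2 ∧
      reg [l0, l1, l2, l3, l4, l5] 3 = l3 ∧ reg [l0, l1, l2, l3, l4, l5] 4 = l4 ∧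
      reg [l0, l1, l2, l3, l4, l5] 5 = l5 := fun _ _ _ _ _ _ => ⟨rfl, rfl, rfl, rfl, rfl, rfl⟩
  obtain ⟨r0, r1, r2, r3, r4, r5⟩ := hr (view u p) (view u j1) (view u j2) (view u j3) (view u j4)
    (view u j5)
  rw [r0, r1, r2, r3, r4, r5, propext (hQ.trans hmore)]
  classical
  have hfnd : (if isFact [view u p, view u j1, view u j2, view u j3, view u j4, view u j5]
      (view u j5) then match (view u j5).2 with | .sym (.fact _ _ y) => some y | _ => none
      else none) = found := by
    by_cases h : isF (view u j5)
    · rw [if_pos (hF.2 h)]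
      obtain ⟨-, f, y, -, h2⟩ := id h
      rw [hval _ _ _ h h2, h2]
    · rw [if_neg (fun h' => h (hF.1 h')), hnone h]
  rw [hfnd, e0, e1, e2, e3]

end context

/-! ### The facts needed for a query -/

/-- The intermediate values of a term. -/
theorem EvalsTo.exists_values {F D : Type} {R : F → D → D → Prop} {q : List F} {x y : D}
    (h : EvalsTo R q x y) : ∃ z : ℕ → D, z 0 = x ∧ z q.length = y ∧
      ∀ j s (hj : j < q.length), j + s + 1 = q.length → R q[j] (z s) (z (s + 1)) := by
  induction q generalizing y with
  | nil => exact ⟨fun _ => x, rfl, h.symm, fun j s hj => absurd hj (Nat.not_lt_zero _)⟩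
  | cons f q ih =>
    obtain ⟨y', h1, h2⟩ := h
    obtain ⟨z, hz0, hz1, hz2⟩ := ih h1
    refine ⟨fun s => if s ≤ q.length then z s else y, by simp [hz0], by simp, ?_⟩
    intro j s hj hs
    simp only [List.length_cons] at hs hj
    rcases j with _ | j
    · obtain rfl : s = q.length := by omega
      simpa [hz1] using h2
    · have e1 : s ≤ q.length := by omega
      have e2 : s + 1 ≤ q.length := by omega
      simpa [e1, e2] using hz2 j s (by omega) (by omega)

/-- Agent `0`. -/
def boss {w : ℕ} (hw : 1 ≤ w) : Fin w := ⟨0, hw⟩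

/-- Agent `1`; agent `0` if there is only one agent.  When agent `0`
broadcasts a question, it sends a message without content to agent `0`, whose next node needs an
incoming edge. -/
def helper {w : ℕ} (hw : 1 ≤ w) : Fin w := ⟨min 1 (w - 1), by omega⟩

/-- A finite set of labels that suffices for the protocol on inputs of size `n`. -/
def labels (d : ℕ → ℕ) (n : ℕ) : Set Sym :=
  {σ | (∃ μ : Msg, σ = μ.sym ∧ μ.step ≤ n ∧ μ.object < d n + 1) ∨ ∃ y < d n, σ = .obj y}

theorem msg_mem_labels {d : ℕ → ℕ} {n : ℕ} (μ : Msg) (h1 : μ.step ≤ n) (h2 : μ.object < d n + 1) :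
    μ.sym ∈ labels d n := Or.inl ⟨μ, rfl, h1, h2⟩

namespace KHop

variable {d m : ℕ → ℕ} {N k : ℕ} (x : KHop d m N k)

theorem exists_values : ∃ z : ℕ → Fin (d N), z 0 = x.start ∧ z k = x.answer ∧
    ∀ (j : Fin k) s, j.1 + s + 1 = k →
      ∃ r, x.fn r = x.query j ∧ x.arg r = z s ∧ x.val r = z (s + 1) := by
  obtain ⟨z, h1, h2, h3⟩ := x.evalsTo_answer.exists_values
  refine ⟨z, h1, by simpa using h2, fun j s hs => ?_⟩
  simpa using h3 j s (by simp) (by simpa using hs)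

/-- The value after the first `s` hops. -/
noncomputable def value (s : ℕ) : Fin (d N) := x.exists_values.choose s

theorem value_zero : x.value 0 = x.start := x.exists_values.choose_spec.1

theorem value_last : x.value k = x.answer := x.exists_values.choose_spec.2.1

theorem exists_fact (j : Fin k) (s : ℕ) (h : j.1 + s + 1 = k) :
    ∃ r, x.fn r = x.query j ∧ x.arg r = x.value s ∧ x.val r = x.value (s + 1) :=
  x.exists_values.choose_spec.2.2 j s h

open Classical in
/-- The agent whose block contains the fact for the `s`-th hop. -/
noncomputable def holder {w : ℕ} (hw : 1 ≤ w) (s : ℕ) : Fin w :=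
  if h : ∃ (j : Fin k) (r : Fin N), j.1 + s = k ∧ x.fn r = x.query j ∧ x.arg r = x.value (s - 1)
  then owner hw h.choose_spec.choose else ⟨0, hw⟩

/-- The fact for the hop number `s` from the object `a` is in the block of agent `i`, and `y` is its
value. -/
def HasFact {w : ℕ} (i : Fin w) (s a y : ℕ) : Prop :=
  ∃ (j : Fin k) (r : Fin N), j.1 + s = k ∧
    (i.val * N / w ≤ r.val ∧ r.val < (i.val + 1) * N / w) ∧ x.fn r = x.query j ∧
    (x.arg r : ℕ) = a ∧ (x.val r : ℕ) = y

open Classical in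
/-- The value of the fact for the hop number `s` from the object `a`, if agent `i` has this fact. -/
noncomputable def found {w : ℕ} (i : Fin w) (s a : ℕ) : Option ℕ :=
  if h : ∃ y, x.HasFact i s a y then some h.choose else none

theorem HasFact.unique {x : KHop d m N k} {w : ℕ} {i i' : Fin w} {s a y y' : ℕ}
    (h : x.HasFact i s a y) (h' : x.HasFact i' s a y') : i = i' ∧ y = y' := by
  obtain ⟨j, r, h1, h2, h3, h4, h5⟩ := h
  obtain ⟨j', r', h1', h2', h3', h4', h5'⟩ := h'
  obtain rfl : j = j' := Fin.ext (by omega)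
  obtain rfl : r = r' := x.key_injective (Prod.ext (h3.trans h3'.symm) (Fin.ext (h4.trans h4'.symm)))
  exact ⟨Fin.ext (le_antisymm (block_disjoint h2.1 h2'.2) (block_disjoint h2'.1 h2.2)),
    h5.symm.trans h5'⟩

theorem found_eq_some_iff {w : ℕ} (i : Fin w) (s a y : ℕ) :
    x.found i s a = some y ↔ x.HasFact i s a y := by
  unfold found
  split_ifs with h
  · rw [Option.some.injEq]
    constructor
    · rintro rfl
      exact h.choose_spec
    · exact fun h' => (h.choose_spec.unique h').2
  · simp only [false_iff]
    exact fun h' => h ⟨y, h'⟩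

theorem hasFact_holder {w : ℕ} (hw : 1 ≤ w) {s : ℕ} (h1 : 1 ≤ s) (h2 : s ≤ k) :
    x.HasFact (x.holder hw s) s (x.value (s - 1)) (x.value s) := by
  have hs : s - 1 + 1 = s := by omega
  obtain ⟨r, e1, e2, e3⟩ := x.exists_fact ⟨k - s, by omega⟩ (s - 1) (by simp only; omega)
  have h : ∃ (j : Fin k) (r : Fin N), j.1 + s = k ∧ x.fn r = x.query j ∧
      x.arg r = x.value (s - 1) := ⟨⟨k - s, by omega⟩, r, by simp only; omega, e1, e2⟩
  obtain ⟨g1, g2, g3⟩ := h.choose_spec.choose_spec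
  have hj : h.choose = ⟨k - s, by omega⟩ := Fin.ext (by simp only; omega)
  have hr : h.choose_spec.choose = r :=
    x.key_injective (Prod.ext ((g2.trans (congrArg x.query hj)).trans e1.symm)
      (g3.trans e2.symm))
  have hh : x.holder hw s = owner hw h.choose_spec.choose := by
    unfold holder
    rw [dif_pos h]
  refine ⟨h.choose, h.choose_spec.choose, g1, (owner_eq_iff hw _ _).1 hh.symm, g2,
    by rw [g3], ?_⟩
  rw [hr, e3, hs]

/-- Exactly the holder finds the fact for a hop. -/
theorem found_value {w : ℕ} (hw : 1 ≤ w) (i : Fin w) {s : ℕ} (h1 : 1 ≤ s) (h2 : s ≤ k) :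
    x.found i s (x.value (s - 1)) = if i = x.holder hw s then some (x.value s : ℕ) else none := by
  have h := x.hasFact_holder hw h1 h2
  split_ifs with hi
  · rw [found_eq_some_iff, hi]
    exact h
  · by_contra hne
    obtain ⟨y, hy⟩ := Option.ne_none_iff_exists'.1 hne
    exact hi (((x.found_eq_some_iff i s _ y).1 hy).unique h).1

/-! ### The run of the protocol -/

section run

variable {w : ℕ} (hw : 1 ≤ w)

/-- Agent `0` has the facts for all hops before the hop number `t`. -/
def SoloUpTo (t : ℕ) : Prop := ∀ s, 1 ≤ s → s < t → x.holder hw s = boss hw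

open Classical in
/-- What agent `0` writes at the times `t ≤ k + 2`. -/
noncomputable def bossNote (t : ℕ) : Sym :=
  if t = k + 2 then
    if x.SoloUpTo hw (k + 1) then .obj (x.value k) else (Msg.reply 1 (x.value 0)).sym
  else if x.SoloUpTo hw t then (Msg.solo t (x.value (t - 1))).sym else (Msg.miss t).sym

/-- The round in which agent `0` asks for the fact for the `s`-th hop.  The message to agent `0` is only
needed to keep agent `0` alive. -/
noncomputable def askRound (s : ℕ) : Round w :=
  .exchange (Msg.ask s (x.value (s - 1))).sym (helper hw) Msg.ping.sym

open Classical in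
/-- The round in which the `s`-th hop is done. -/
noncomputable def answerRound (s : ℕ) : Round w :=
  if x.holder hw s = boss hw then
    .quiet fun i => if i = boss hw then (Msg.reply (s + 1) (x.value s)).sym
      else (Msg.ready (s + 1)).sym
  else .exchange (Msg.ready (s + 1)).sym (x.holder hw s) (Msg.reply (s + 1) (x.value s)).sym

open Classical in
/-- The rounds: in the first `k + 2` rounds agent `0` tries to answer the query alone; then two rounds
are spent on each hop. -/
noncomputable def round (t : ℕ) : Round w :=
  if t ≤ k + 2 then .quiet fun i => if i = boss hw then x.bossNote hw t else (Msg.wait (t - 1)).sym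
  else if (t - (k + 3)) % 2 = 0 then x.askRound hw ((t - (k + 3)) / 2 + 1)
  else x.answerRound hw ((t - (k + 3)) / 2 + 1)

theorem round_ask {s : ℕ} (h : 1 ≤ s) : x.round hw (k + 1 + 2 * s) = x.askRound hw s := by
  rw [round, if_neg (by omega), if_pos (by omega)]
  congr 1
  omega

theorem round_answer {s : ℕ} (h : 1 ≤ s) : x.round hw (k + 2 + 2 * s) = x.answerRound hw s := by
  rw [round, if_neg (by omega), if_neg (by omega)]
  congr 1
  omega

theorem helper_ne_boss (h : ¬ x.SoloUpTo hw (k + 1)) : helper hw ≠ boss hw := by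
  intro h'
  apply h
  intro s _ _
  have h1 : min 1 (w - 1) = 0 := congrArg Fin.val h'
  have := (x.holder hw s).2
  exact Fin.ext (show (x.holder hw s).1 = 0 by omega)

open Classical in
/-- The schedule of the run. -/
noncomputable def schedule : Schedule w where
  boss := boss hw
  T := if x.SoloUpTo hw (k + 1) then k + 2 else 3 * k + 2
  round := x.round hw
  final :=
    if x.SoloUpTo hw (k + 1) then
      if helper hw = boss hw then none else some (helper hw, Msg.ping.sym)
    else some (boss hw, .obj (x.value k))
  ne_boss t ht σ r ρ h := by
    by_cases hs : x.SoloUpTo hw (k + 1)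
    · rw [if_pos hs] at ht
      rw [round, if_pos ht] at h
      cases h
    · unfold round at h
      split_ifs at h
      · unfold askRound at h
        cases h
        exact x.helper_ne_boss hw hs
      · unfold answerRound at h
        split_ifs at h with h4
        cases h
        exact h4

theorem label_mem_labels (hd : Monotone d) (hN : 1 ≤ N) (i : Fin w) (t : ℕ) (s : Sym)
    (h : (x.schedule hw).out i t = .cot s ∨ (∃ j, (x.schedule hw).out i t = .send s j) ∨
      (x.schedule hw).out i t = .broadcast s) : s ∈ labels d (N + k) := by
  have hv : ∀ s, (x.value s : ℕ) < d (N + k) := fun s =>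
    (x.value s).2.trans_le (hd (Nat.le_add_right N k))
  have hv' : ∀ s, (x.value s : ℕ) < d (N + k) + 1 := fun s => (hv s).trans (Nat.lt_succ_self _)
  -- All steps that occur are at most `k + 1`.
  have hobj : ∀ s, Sym.obj (x.value s) ∈ labels d (N + k) := fun s => Or.inr ⟨_, hv s, rfl⟩
  have hping : Msg.ping.sym ∈ labels d (N + k) :=
    msg_mem_labels _ (Nat.zero_le _) (Nat.succ_pos _)
  have hact : ∀ t, 1 ≤ t → t ≤ 3 * k + 2 → ∀ s, (((x.round hw t).action (boss hw) i = .cot s ∨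
      (∃ j, (x.round hw t).action (boss hw) i = .send s j) ∨
      (x.round hw t).action (boss hw) i = .broadcast s)) → s ∈ labels d (N + k) := by
    intro t ht1 ht s h
    unfold round at h
    split_ifs at h with h1 h2
    · simp only [Round.action, Action.cot.injEq, reduceCtorEq, exists_false, or_false] at h
      subst h
      split_ifs with hi
      · unfold bossNote
        split_ifs
        · exact hobj _
        · exact msg_mem_labels _ (by simp only [Msg.step]; omega) (hv' _)
        · exact msg_mem_labels _ (by simp only [Msg.step]; omega) (hv' _)
        · exact msg_mem_labels _ (by simp only [Msg.step]; omega) (Nat.succ_pos _)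
      · exact msg_mem_labels _ (by simp only [Msg.step]; omega) (Nat.succ_pos _)
    · simp only [askRound, Round.action] at h
      split_ifs at h
      · simp only [exists_false, false_or, Action.broadcast.injEq] at h
        subst h
        exact msg_mem_labels _ (by simp only [Msg.step]; omega) (hv' _)
      · simp only [or_false, false_or, Action.send.injEq] at h
        obtain ⟨j, rfl, -⟩ := h
        exact hping
      · simp at h
    · unfold answerRound at h
      split_ifs at h
      · simp only [Round.action, Action.cot.injEq, reduceCtorEq, exists_false, or_false] at h
        subst h
        split_ifs
        · exact msg_mem_labels _ (by simp only [Msg.step]; omega) (hv' _)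
        · exact msg_mem_labels _ (by simp only [Msg.step]; omega) (Nat.succ_pos _)
      · simp only [Round.action] at h
        split_ifs at h
        · simp only [exists_false, false_or, Action.broadcast.injEq] at h
          subst h
          exact msg_mem_labels _ (by simp only [Msg.step]; omega) (Nat.succ_pos _)
        · simp only [or_false, false_or, Action.send.injEq] at h
          obtain ⟨j, rfl, -⟩ := h
          exact msg_mem_labels _ (by simp only [Msg.step]; omega) (hv' _)
        · simp at h
  unfold Schedule.out at h
  split_ifs at h with h1 h2
  · have hT : (x.schedule hw).T ≤ 3 * k + 2 := by
      simp only [schedule]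
      split_ifs <;> omega
    exact hact t h1.1 (h1.2.trans hT) s h
  · unfold Schedule.finalAction at h
    split at h
    · simp at h
    · rename_i r σ hf
      have hσ : σ ∈ labels d (N + k) := by
        simp only [schedule] at hf
        split_ifs at hf
        · cases hf
          exact hping
        · cases hf
          exact hobj _
      split_ifs at h
      · simp only [Action.cot.injEq, exists_false, or_false] at h
        exact h ▸ hσ
      · simp only [or_false, false_or, Action.send.injEq] at h
        obtain ⟨j, rfl, -⟩ := h
        exact hσ
      · simp at h
  · simp at h

end run

end KHop

/-! ### Predictions along a run -/

/-- The next token after the token list `u`, as computed by the lookup transformer of the protocol. -/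
noncomputable def nextToken (u : List Token) : Token :=
  protocolOutput (registers protocolLookups u (u.length - 1))

namespace KHop

variable {d m : ℕ → ℕ} {N k : ℕ} (x : KHop d m N k)

section predictions

variable {w : ℕ}

/-- The list `u` extends the initial context of agent `i` as in a run. -/
def Extends (i : Fin w) (u : List Token) : Prop :=
  ∃ tail : List Token, (∀ a ∈ tail, a.IsPlain) ∧ u = x.context w i ++ tail

theorem Extends.nextToken_eq {x : KHop d m N k} {i : Fin w} {u l : List Token} {prev last : Token}
    (h : x.Extends i u) (hu : u = l ++ [prev, last]) : nextToken u =
      protocol i last prev (x.value 0) (1 ≤ focusStep last prev ∧ focusStep last prev ≤ k)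
        (x.found i (focusStep last prev) (focusObject last prev)) := by
  obtain ⟨tail, ht, rfl⟩ := h
  have hlen := context_length x i tail
  have hlen' := congrArg List.length hu
  rw [hlen, List.length_append, List.length_cons, List.length_singleton] at hlen'
  rw [nextToken, value_zero]
  apply protocolOutput_registers x i tail ht
  · rw [hu, List.getD_append_right _ _ _ _ (by omega),
      show (x.chunk w i).length + k + 1 + tail.length - l.length = 1 by omega]
    rfl
  · rw [hu, List.getD_append_right _ _ _ _ (by omega),
      show (x.chunk w i).length + k + tail.length - l.length = 0 by omega]
    rfl
  · intro y
    exact x.found_eq_some_iff i _ _ y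

/-- The last token alone matters unless it is a message without content. -/
theorem Extends.exists_nextToken_eq {x : KHop d m N k} {i : Fin w} {u l : List Token} {last : Token}
    (h : x.Extends i u) (hu : u = l ++ [last]) (hl : last.msg ≠ some .ping) :
    ∃ prev, nextToken u = protocol i last prev (x.value 0)
        (1 ≤ last.msg.elim 0 Msg.step ∧ last.msg.elim 0 Msg.step ≤ k)
        (x.found i (last.msg.elim 0 Msg.step) (last.msg.elim 0 Msg.object)) := by
  obtain ⟨l', prev, rfl⟩ : ∃ l' prev, l = l' ++ [prev] := by
    rcases List.eq_nil_or_concat' l with rfl | h'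
    · obtain ⟨tail, -, rfl⟩ := h
      have hlen := context_length x i tail
      rw [hu] at hlen
      simp at hlen
      omega
    · exact h'
  refine ⟨prev, ?_⟩
  rw [h.nextToken_eq (l := l') (prev := prev) (last := last) (by simp [hu])]
  simp [focusStep, focusObject, focus, hl]

theorem Extends.append {x : KHop d m N k} {i : Fin w} {u : List Token} (h : x.Extends i u)
    {l : List Token} (hl : ∀ a ∈ l, a.IsPlain) : x.Extends i (u ++ l) := by
  obtain ⟨tail, ht, rfl⟩ := h
  refine ⟨tail ++ l, ?_, by simp⟩
  intro a ha
  rcases List.mem_append.1 ha with ha | ha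
  · exact ht a ha
  · exact hl a ha

end predictions

section run

variable {w : ℕ} (hw : 1 ≤ w)

/-- The context of agent `i` at time `t`. -/
noncomputable def runContext (i : Fin w) (t : ℕ) : List Token :=
  (x.schedule hw).graph.before (x.context w i) i t

theorem exists_runContext_eq (hd : Monotone d) (hN : 1 ≤ N) (i : Fin w) (t : ℕ) :
    ∃ tail, x.runContext hw i t = x.context w i ++ tail ∧ tail.length ≤ 2 * t ∧
      ∀ a ∈ tail, ∃ s ∈ labels d (N + k),
        a = .sym s ∨ a = .receive s ∨ a = .broadcast s ∨ ∃ j : Fin w, a = .send s j :=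
  (x.schedule hw).graph.before_eq_append (x.label_mem_labels hw hd hN) _ _ _

theorem extends_runContext (hd : Monotone d) (hN : 1 ≤ N) (i : Fin w) (t : ℕ) :
    x.Extends i (x.runContext hw i t) := by
  obtain ⟨tail, h, -, h'⟩ := x.exists_runContext_eq hw hd hN i t
  refine ⟨tail, fun a ha => ?_, h⟩
  obtain ⟨s, hs, h1⟩ := h' a ha
  constructor
  · rintro n rfl
    simp at h1
  · rintro f y z rfl
    simp only [Token.sym.injEq, reduceCtorEq, exists_false, or_false] at h1
    subst h1
    rcases hs with ⟨μ, h2, -⟩ | ⟨y, -, h2⟩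
    · cases μ <;> cases h2
    · cases h2

theorem soloUpTo_succ {t : ℕ} (ht : 1 ≤ t) :
    x.SoloUpTo hw (t + 1) ↔ x.SoloUpTo hw t ∧ x.holder hw t = boss hw := by
  constructor
  · exact fun h => ⟨fun s h1 h2 => h s h1 (by omega), h t ht (Nat.lt_succ_self t)⟩
  · rintro ⟨h1, h2⟩ s h3 h4
    rcases Nat.lt_or_ge s t with h5 | h5
    · exact h1 s h3 h5
    · obtain rfl : s = t := by omega
      exact h2

theorem le_schedule_T (hk : 1 ≤ k) : k + 2 ≤ (x.schedule hw).T := by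
  simp only [schedule]
  split_ifs <;> omega

open Classical in
/-- What an agent writes at the times `t ≤ k + 2`. -/
noncomputable def note (i : Fin w) (t : ℕ) : Sym :=
  if i = boss hw then x.bossNote hw t else (Msg.wait (t - 1)).sym

theorem round_of_le {t : ℕ} (ht : t ≤ k + 2) :
    x.round hw t = .quiet fun i => x.note hw i t := by
  rw [round, if_pos ht]
  rfl

theorem runContext_succ_of_le (hk : 1 ≤ k) (i : Fin w) {t : ℕ} (h1 : 1 ≤ t) (h2 : t ≤ k + 2) :
    x.runContext hw i (t + 1) = x.runContext hw i t ++ [.sym (x.note hw i t)] :=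
  (x.schedule hw).before_succ_quiet h1 (h2.trans (x.le_schedule_T hw hk))
    (x.round_of_le hw h2) _ _

theorem eq_boss_iff (i : Fin w) : i = boss hw ↔ i.1 = 0 := Fin.ext_iff

theorem eq_helper_iff {i : Fin w} (hi : i ≠ boss hw) : i = helper hw ↔ i.1 = 1 := by
  have h0 : i.1 ≠ 0 := fun h => hi ((eq_boss_iff hw i).2 h)
  have := i.2
  rw [Fin.ext_iff, helper]
  simp only
  omega

/-- In the first `k + 2` rounds every agent predicts what it writes. -/
theorem nextToken_of_le (hd : Monotone d) (hN : 1 ≤ N) (hk : 1 ≤ k) (i : Fin w) {t : ℕ}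
    (h1 : 1 ≤ t) (h2 : t ≤ k + 2) : nextToken (x.runContext hw i t) = .sym (x.note hw i t) := by
  have hext := x.extends_runContext hw hd hN i t
  rcases Nat.eq_or_lt_of_le h1 with rfl | h3
  · have hu : x.runContext hw i 1 =
        ((x.chunk w i ++ (List.ofFn fun j => Sym.fn (x.query j)) ++ [Sym.obj x.start]).map
          Token.sym) ++ [.ident i] := (x.schedule hw).before_one _ _
    obtain ⟨prev, h⟩ := hext.exists_nextToken_eq hu (by simp [Token.msg])
    rw [h]
    have hs : x.SoloUpTo hw 1 := fun s h1 h2 => by omega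
    have hk' : 1 ≠ k + 2 := by omega
    by_cases hi : i = boss hw
    · have h0 := (eq_boss_iff hw i).1 hi
      have h0' : (boss hw : ℕ) = 0 := rfl
      simp [protocol, note, bossNote, hi, hs, h0', value_zero]
    · have h0 : i.1 ≠ 0 := fun h => hi ((eq_boss_iff hw i).2 h)
      simp [protocol, note, h0, hi]
  · obtain ⟨t, rfl⟩ : ∃ t', t = t' + 1 := ⟨t - 1, by omega⟩
    have ht1 : 1 ≤ t := by omega
    have hu := x.runContext_succ_of_le hw hk i ht1 (by omega)
    by_cases hi : i = boss hw
    · subst hi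
      have ht2 : t ≠ k + 2 := by omega
      simp only [note, if_true, bossNote, ht2, if_false] at hu ⊢
      by_cases hs : x.SoloUpTo hw t
      · rw [if_pos hs] at hu
        obtain ⟨prev, h⟩ := hext.exists_nextToken_eq hu (by simp [Token.msg])
        rw [h]
        simp only [Token.msg, Msg.msg_sym, Option.elim_some, Msg.step, Msg.object, protocol, ht1,
          true_and, soloUpTo_succ x hw ht1, hs]
        rcases Nat.lt_or_ge k t with h4 | h4
        · obtain rfl : t = k + 1 := by omega
          simp [hs]
        · have h5 : ¬ t + 1 = k + 2 := by omega
          rw [x.found_value hw _ ht1 h4]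
          simp only [h4, if_true, h5, if_false, eq_comm (a := boss hw)]
          by_cases h6 : x.holder hw t = boss hw <;> simp [h6]
      · rw [if_neg hs] at hu
        obtain ⟨prev, h⟩ := hext.exists_nextToken_eq hu (by simp [Token.msg])
        rw [h]
        simp only [Token.msg, Msg.msg_sym, Option.elim_some, Msg.step, protocol, ht1,
          true_and, soloUpTo_succ x hw ht1, hs, false_and, if_false]
        rcases Nat.lt_or_ge k t with h4 | h4
        · obtain rfl : t = k + 1 := by omega
          simp [hs]
        · have h5 : ¬ t + 1 = k + 2 := by omega
          rw [if_pos h4, if_neg h5]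
    · simp only [note, hi, if_false] at hu ⊢
      obtain ⟨prev, h⟩ := hext.exists_nextToken_eq hu (by simp [Token.msg])
      rw [h]
      simp only [Token.msg, Msg.msg_sym, Option.elim_some, Msg.step, protocol]
      rw [if_pos (by omega)]
      congr 3
      omega

/-- After the attempt of agent `0` to work alone, agent `1` sends its first message without content.  It
does so in any case, since it does not know whether the attempt has succeeded. -/
theorem nextToken_wait (hd : Monotone d) (hN : 1 ≤ N) {i : Fin w} (hi : i ≠ boss hw) {t : ℕ}
    {l : List Token} (h : x.runContext hw i t = l ++ [.sym (Msg.wait (k + 1)).sym]) :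
    nextToken (x.runContext hw i t) = if i = helper hw then .send Msg.ping.sym 0 else .eos := by
  obtain ⟨prev, h⟩ := (x.extends_runContext hw hd hN i t).exists_nextToken_eq h
    (by simp [Token.msg])
  rw [h]
  simp [Token.msg, Msg.step, protocol, eq_helper_iff hw hi]

/-! ### Predictions when agent `0` needs help -/

theorem runContext_helped_succ (hs : ¬ x.SoloUpTo hw (k + 1)) {i : Fin w} {t : ℕ} (h1 : 1 ≤ t)
    (h2 : t ≤ 3 * k + 2) {σ ρ : Sym} {r : Fin w} (hr : x.round hw t = .exchange σ r ρ) :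
    x.runContext hw i (t + 1) =
      x.runContext hw i t ++ Schedule.exchangeTokens (boss hw) σ r ρ i :=
  (x.schedule hw).before_succ_exchange h1 (by simpa [schedule, hs] using h2) hr _ _

/-- The contexts before agent `0` asks for the `s`-th fact. -/
theorem exists_runContext_ask (hk : 1 ≤ k) (hs : ¬ x.SoloUpTo hw (k + 1)) (i : Fin w) {s : ℕ}
    (h1 : 1 ≤ s) (h2 : s ≤ k + 1) : ∃ l,
      (i = boss hw → x.runContext hw i (k + 1 + 2 * s) =
          l ++ [.sym (Msg.reply s (x.value (s - 1))).sym] ∨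
        x.runContext hw i (k + 1 + 2 * s) = l ++ [.receive (Msg.reply s (x.value (s - 1))).sym]) ∧
      (i ≠ boss hw → x.runContext hw i (k + 1 + 2 * s) = l ++ [.sym (Msg.ready s).sym] ∨
        x.runContext hw i (k + 1 + 2 * s) = l ++ [.receive (Msg.ready s).sym] ∨
        (s = 1 ∧ x.runContext hw i (k + 1 + 2 * s) = l ++ [.sym (Msg.wait (k + 1)).sym])) := by
  rcases Nat.eq_or_lt_of_le h1 with rfl | h3
  · have hu := x.runContext_succ_of_le hw hk i (t := k + 2) (by omega) le_rfl
    refine ⟨x.runContext hw i (k + 2), fun hi => Or.inl ?_, fun hi => Or.inr (Or.inr ⟨rfl, ?_⟩)⟩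
    · simpa [note, hi, bossNote, hs] using hu
    · simpa [note, hi] using hu
  · obtain ⟨s, rfl⟩ : ∃ s', s = s' + 1 := ⟨s - 1, by omega⟩
    have hs1 : 1 ≤ s := by omega
    have hr := x.round_answer hw hs1
    have e : k + 1 + 2 * (s + 1) = k + 2 + 2 * s + 1 := by ring
    unfold answerRound at hr
    rw [e]
    by_cases hh : x.holder hw s = boss hw
    · rw [if_pos hh] at hr
      have hu : x.runContext hw i (k + 2 + 2 * s + 1) = _ :=
        (x.schedule hw).before_succ_quiet (by omega) (by simp [schedule, hs]; omega) hr _ i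
      refine ⟨x.runContext hw i (k + 2 + 2 * s), fun hi => Or.inl ?_, fun hi => Or.inl ?_⟩
      · rw [hu, if_pos hi]
        rfl
      · rw [hu, if_neg hi]
        rfl
    · rw [if_neg hh] at hr
      have hu := x.runContext_helped_succ hw hs (i := i) (by omega) (by omega) hr
      rw [hu]
      by_cases hi : i = boss hw
      · refine ⟨x.runContext hw i (k + 2 + 2 * s) ++ [.broadcast (Msg.ready (s + 1)).sym],
          fun _ => Or.inr ?_, fun h => absurd hi h⟩
        simp [Schedule.exchangeTokens, hi]
      · by_cases hi' : i = x.holder hw s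
        · refine ⟨x.runContext hw i (k + 2 + 2 * s) ++
            [.send (Msg.reply (s + 1) (x.value s)).sym (boss hw)],
            fun h => absurd h hi, fun h => Or.inr (Or.inl ?_)⟩
          rw [Schedule.exchangeTokens, if_neg hi, if_pos hi']
          simp
        · refine ⟨x.runContext hw i (k + 2 + 2 * s),
            fun h => absurd h hi, fun h => Or.inr (Or.inl ?_)⟩
          rw [Schedule.exchangeTokens, if_neg hi, if_neg hi']

theorem nextToken_ask_boss (hd : Monotone d) (hN : 1 ≤ N) (hk : 1 ≤ k)
    (hs : ¬ x.SoloUpTo hw (k + 1)) {s : ℕ} (h1 : 1 ≤ s) (h2 : s ≤ k + 1) :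
    nextToken (x.runContext hw (boss hw) (k + 1 + 2 * s)) =
      if s ≤ k then .broadcast (Msg.ask s (x.value (s - 1))).sym else .sym (.obj (x.value k)) := by
  obtain ⟨l, hl, -⟩ := x.exists_runContext_ask hw hk hs (boss hw) h1 h2
  have hext := x.extends_runContext hw hd hN (boss hw) (k + 1 + 2 * s)
  have hobj : ¬ s ≤ k → x.value (s - 1) = x.value k := fun h => by
    rw [show s = k + 1 by omega, Nat.add_sub_cancel]
  rcases hl rfl with hu | hu <;>
  · obtain ⟨prev, h⟩ := hext.exists_nextToken_eq hu (by simp [Token.msg])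
    rw [h]
    simp only [Token.msg, Msg.msg_sym, Option.elim_some, Msg.step, protocol, h1, true_and]
    split_ifs with h3
    · rfl
    · rw [hobj h3]

theorem nextToken_ask (hd : Monotone d) (hN : 1 ≤ N) (hk : 1 ≤ k)
    (hs : ¬ x.SoloUpTo hw (k + 1)) {i : Fin w} (hi : i ≠ boss hw) {s : ℕ} (h1 : 1 ≤ s)
    (h2 : s ≤ k + 1) : nextToken (x.runContext hw i (k + 1 + 2 * s)) =
      if s ≤ k ∧ i = helper hw then .send Msg.ping.sym 0 else .eos := by
  obtain ⟨l, -, hl⟩ := x.exists_runContext_ask hw hk hs i h1 h2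
  have hext := x.extends_runContext hw hd hN i (k + 1 + 2 * s)
  rcases hl hi with hu | hu | ⟨rfl, hu⟩
  · obtain ⟨prev, h⟩ := hext.exists_nextToken_eq hu (by simp [Token.msg])
    rw [h]
    simp [Token.msg, Msg.step, protocol, h1, eq_helper_iff hw hi]
  · obtain ⟨prev, h⟩ := hext.exists_nextToken_eq hu (by simp [Token.msg])
    rw [h]
    simp [Token.msg, Msg.step, protocol, h1, eq_helper_iff hw hi]
  · rw [x.nextToken_wait hw hd hN hi hu]
    simp [hk]

theorem runContext_answer (hs : ¬ x.SoloUpTo hw (k + 1)) (i : Fin w) {s : ℕ} (h1 : 1 ≤ s)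
    (h2 : s ≤ k) : x.runContext hw i (k + 2 + 2 * s) = x.runContext hw i (k + 1 + 2 * s) ++
      Schedule.exchangeTokens (boss hw) (Msg.ask s (x.value (s - 1))).sym (helper hw)
        Msg.ping.sym i := by
  have := x.runContext_helped_succ hw hs (i := i) (t := k + 1 + 2 * s) (by omega) (by omega)
    (x.round_ask hw h1)
  rwa [show k + 1 + 2 * s + 1 = k + 2 + 2 * s by ring] at this

theorem nextToken_answer_boss (hd : Monotone d) (hN : 1 ≤ N)
    (hs : ¬ x.SoloUpTo hw (k + 1)) {s : ℕ} (h1 : 1 ≤ s) (h2 : s ≤ k) :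
    nextToken (x.runContext hw (boss hw) (k + 2 + 2 * s)) =
      if x.holder hw s = boss hw then .sym (Msg.reply (s + 1) (x.value s)).sym
      else .broadcast (Msg.ready (s + 1)).sym := by
  have hext := x.extends_runContext hw hd hN (boss hw) (k + 2 + 2 * s)
  rw [hext.nextToken_eq (l := x.runContext hw (boss hw) (k + 1 + 2 * s))
    (prev := .broadcast (Msg.ask s (x.value (s - 1))).sym) (last := .receive Msg.ping.sym)
    (by rw [x.runContext_answer hw hs _ h1 h2, Schedule.exchangeTokens, if_pos rfl])]
  simp only [focusStep, focusObject, focus, Token.msg, Msg.msg_sym, if_true, Option.elim_some,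
    Msg.step, Msg.object, protocol]
  rw [x.found_value hw _ h1 h2]
  by_cases h : x.holder hw s = boss hw
  · simp [h]
  · simp [h, Ne.symm h]

theorem nextToken_answer (hd : Monotone d) (hN : 1 ≤ N)
    (hs : ¬ x.SoloUpTo hw (k + 1)) {i : Fin w} (hi : i ≠ boss hw) {s : ℕ} (h1 : 1 ≤ s)
    (h2 : s ≤ k) : nextToken (x.runContext hw i (k + 2 + 2 * s)) =
      if i = x.holder hw s then .send (Msg.reply (s + 1) (x.value s)).sym 0
      else .sym (Msg.ready (s + 1)).sym := by
  have hext := x.extends_runContext hw hd hN i (k + 2 + 2 * s)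
  obtain ⟨l, hu⟩ : ∃ l, x.runContext hw i (k + 2 + 2 * s) =
      l ++ [.receive (Msg.ask s (x.value (s - 1))).sym] := by
    rw [x.runContext_answer hw hs _ h1 h2, Schedule.exchangeTokens, if_neg hi]
    split_ifs
    · exact ⟨x.runContext hw i (k + 1 + 2 * s) ++ [.send Msg.ping.sym (boss hw)], by simp⟩
    · exact ⟨_, rfl⟩
  obtain ⟨prev, h⟩ := hext.exists_nextToken_eq hu (by simp [Token.msg])
  rw [h]
  simp only [Token.msg, Msg.msg_sym, Option.elim_some, Msg.step, Msg.object, protocol]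
  rw [x.found_value hw _ h1 h2]
  by_cases h : i = x.holder hw s
  · simp [h]
  · simp [h]

end run

end KHop

namespace KHop

variable {d m : ℕ → ℕ} {N k : ℕ} (x : KHop d m N k) {w : ℕ} (hw : 1 ≤ w)

/-! ### The predictions agree with the run -/

/-- At time `t` agent `i` does what it predicts, or it does nothing and predicts the end of the sequence,
or an incoming message overrides the note that it predicts. -/
def Consistent (i : Fin w) (t : ℕ) : Prop :=
  ((x.schedule hw).out i t).token = some (nextToken (x.runContext hw i t)) ∨
    ((x.schedule hw).out i t = .idle ∧ (nextToken (x.runContext hw i t) = .eos ∨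
      (t < (x.schedule hw).len i ∧
        ∃ s ≤ k, nextToken (x.runContext hw i t) = .sym (Msg.ready (s + 1)).sym)))

theorem consistent_of_le (hd : Monotone d) (hN : 1 ≤ N) (hk : 1 ≤ k) (i : Fin w) {t : ℕ}
    (h1 : 1 ≤ t) (h2 : t ≤ k + 2) : x.Consistent hw i t := by
  left
  rw [x.nextToken_of_le hw hd hN hk i h1 h2,
    (x.schedule hw).out_of_le h1 (h2.trans (x.le_schedule_T hw hk)),
    show (x.schedule hw).round t = _ from x.round_of_le hw h2]
  rfl

section solo

variable (hs : x.SoloUpTo hw (k + 1))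

include hs

theorem schedule_T_of_solo : (x.schedule hw).T = k + 2 := by
  simp [schedule, hs]

theorem finalAction_of_solo (i : Fin w) : (x.schedule hw).finalAction i =
    if i ≠ boss hw ∧ i = helper hw then .send Msg.ping.sym (boss hw) else .idle := by
  by_cases h : helper hw = boss hw
  · have hf : (x.schedule hw).final = none := by simp [schedule, hs, h]
    rw [Schedule.finalAction, hf, if_neg]
    rintro ⟨h1, rfl⟩
    exact h1 h
  · have hf : (x.schedule hw).final = some (helper hw, Msg.ping.sym) := by simp [schedule, hs, h]
    rw [Schedule.finalAction, hf]
    simp only [show (x.schedule hw).boss = boss hw from rfl, h, if_false]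
    by_cases hi : i = helper hw
    · subst hi
      simp [h]
    · simp [hi]

theorem runContext_boss_of_solo (hk : 1 ≤ k) : x.runContext hw (boss hw) (k + 3) =
    x.runContext hw (boss hw) (k + 2) ++ [.sym (.obj (x.value k))] := by
  have := x.runContext_succ_of_le hw hk (boss hw) (t := k + 2) (by omega) le_rfl
  simpa [note, bossNote, hs] using this

theorem consistent_of_solo (hd : Monotone d) (hN : 1 ≤ N) (hk : 1 ≤ k) (i : Fin w) {t : ℕ}
    (h1 : k + 3 ≤ t) (h2 : t ≤ (x.schedule hw).len i) : x.Consistent hw i t := by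
  have hT := x.schedule_T_of_solo hw hs
  have hext := x.extends_runContext hw hd hN i t
  rcases Nat.eq_or_lt_of_le h1 with rfl | h3
  · have hout : (x.schedule hw).out i (k + 3) = (x.schedule hw).finalAction i := by
      rw [show k + 3 = (x.schedule hw).T + 1 by rw [hT]]
      exact (x.schedule hw).out_final i
    rw [x.finalAction_of_solo hw hs] at hout
    unfold Consistent
    rw [hout]
    by_cases hi : i = boss hw
    · subst hi
      obtain ⟨prev, h⟩ := hext.exists_nextToken_eq (x.runContext_boss_of_solo hw hs hk)
        (by simp [Token.msg])
      right
      rw [h]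
      simp [protocol]
    · rw [x.nextToken_wait hw hd hN hi (l := x.runContext hw i (k + 2))]
      · by_cases hi' : i = helper hw
        · left
          rw [if_pos ⟨hi, hi'⟩, if_pos hi']
          rfl
        · right
          simp [hi']
      · have := x.runContext_succ_of_le hw hk i (t := k + 2) (by omega) le_rfl
        simpa [note, hi] using this
  · have hl := (x.schedule hw).len_le i
    obtain rfl : t = k + 4 := by omega
    unfold Schedule.len at h2
    split_ifs at h2 with hb
    · obtain ⟨rfl, hf⟩ : i = boss hw ∧ _ := hb
      have hne : helper hw ≠ boss hw := by
        intro h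
        simp [schedule, hs, h] at hf
      have hu : x.runContext hw (boss hw) (k + 4) = x.runContext hw (boss hw) (k + 3) ++
          [.receive Msg.ping.sym] := by
        have := (x.schedule hw).before_final_send (r := helper hw) (σ := Msg.ping.sym) hne
          (by simp [schedule, hs, hne]) (x.context w (boss hw))
        rwa [hT] at this
      rw [x.runContext_boss_of_solo hw hs hk, List.append_assoc] at hu
      right
      refine ⟨(x.schedule hw).out_eq_idle (by omega) _, Or.inl ?_⟩
      rw [hext.nextToken_eq hu]
      simp [protocol, Token.msg]
    · omega

end solo

section helped

variable (hs : ¬ x.SoloUpTo hw (k + 1))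

include hs

theorem schedule_T_of_helped : (x.schedule hw).T = 3 * k + 2 := by
  simp [schedule, hs]

theorem finalAction_of_helped (i : Fin w) : (x.schedule hw).finalAction i =
    if i = boss hw then .cot (.obj (x.value k)) else .idle := by
  have hf : (x.schedule hw).final = some (boss hw, .obj (x.value k)) := by simp [schedule, hs]
  rw [Schedule.finalAction, hf]
  simp [show (x.schedule hw).boss = boss hw from rfl]

theorem consistent_ask (hd : Monotone d) (hN : 1 ≤ N) (hk : 1 ≤ k) (i : Fin w) {s : ℕ}
    (h1 : 1 ≤ s) (h2 : s ≤ k) : x.Consistent hw i (k + 1 + 2 * s) := by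
  have hT := x.schedule_T_of_helped hw hs
  have hout : (x.schedule hw).out i (k + 1 + 2 * s) = _ :=
    (x.schedule hw).out_of_le (by omega) (by omega) i
  rw [show (x.schedule hw).round _ = _ from x.round_ask hw h1] at hout
  unfold Consistent
  rw [hout, askRound, Round.action, show (x.schedule hw).boss = boss hw from rfl]
  by_cases hi : i = boss hw
  · subst hi
    left
    rw [x.nextToken_ask_boss hw hd hN hk hs h1 (by omega), if_pos rfl, if_pos h2]
    rfl
  · rw [x.nextToken_ask hw hd hN hk hs hi h1 (by omega), if_neg hi]
    by_cases hi' : i = helper hw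
    · left
      rw [if_pos hi', if_pos ⟨h2, hi'⟩]
      rfl
    · right
      simp [hi']

theorem consistent_answer (hd : Monotone d) (hN : 1 ≤ N) (i : Fin w) {s : ℕ}
    (h1 : 1 ≤ s) (h2 : s ≤ k) : x.Consistent hw i (k + 2 + 2 * s) := by
  have hT := x.schedule_T_of_helped hw hs
  have hout : (x.schedule hw).out i (k + 2 + 2 * s) = _ :=
    (x.schedule hw).out_of_le (by omega) (by omega) i
  rw [show (x.schedule hw).round _ = _ from x.round_answer hw h1] at hout
  unfold Consistent
  rw [hout, answerRound, show (x.schedule hw).boss = boss hw from rfl]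
  by_cases hh : x.holder hw s = boss hw
  · left
    rw [if_pos hh, Round.action]
    by_cases hi : i = boss hw
    · subst hi
      rw [x.nextToken_answer_boss hw hd hN hs h1 h2, if_pos hh, if_pos rfl]
      rfl
    · rw [x.nextToken_answer hw hd hN hs hi h1 h2, if_neg hi, if_neg (by rwa [hh])]
      rfl
  · rw [if_neg hh, Round.action]
    by_cases hi : i = boss hw
    · subst hi
      left
      rw [x.nextToken_answer_boss hw hd hN hs h1 h2, if_neg hh, if_pos rfl]
      rfl
    · rw [x.nextToken_answer hw hd hN hs hi h1 h2, if_neg hi]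
      by_cases hi' : i = x.holder hw s
      · left
        rw [if_pos hi', if_pos hi']
        rfl
      · right
        rw [if_neg hi', if_neg hi']
        have := (x.schedule hw).le_len i
        exact ⟨rfl, Or.inr ⟨by omega, s, h2, rfl⟩⟩

theorem consistent_end (hd : Monotone d) (hN : 1 ≤ N) (hk : 1 ≤ k) (i : Fin w) {t : ℕ}
    (h1 : 3 * k + 3 ≤ t) (h2 : t ≤ (x.schedule hw).len i) : x.Consistent hw i t := by
  have hT := x.schedule_T_of_helped hw hs
  rcases Nat.eq_or_lt_of_le h1 with rfl | h3
  · have hout : (x.schedule hw).out i (3 * k + 3) = (x.schedule hw).finalAction i := by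
      rw [show 3 * k + 3 = (x.schedule hw).T + 1 by rw [hT]]
      exact (x.schedule hw).out_final i
    rw [x.finalAction_of_helped hw hs] at hout
    unfold Consistent
    rw [hout, show 3 * k + 3 = k + 1 + 2 * (k + 1) by ring]
    by_cases hi : i = boss hw
    · subst hi
      left
      rw [x.nextToken_ask_boss hw hd hN hk hs (by omega) le_rfl, if_pos rfl, if_neg (by omega)]
      rfl
    · right
      rw [x.nextToken_ask hw hd hN hk hs hi (by omega) le_rfl]
      simp [hi]
  · have hl := (x.schedule hw).len_le i
    obtain rfl : t = 3 * k + 4 := by omega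
    unfold Schedule.len at h2
    split_ifs at h2 with hb
    · obtain ⟨rfl, -⟩ : i = boss hw ∧ _ := hb
      have hu : x.runContext hw (boss hw) (3 * k + 4) = x.runContext hw (boss hw) (3 * k + 3) ++
          [.sym (.obj (x.value k))] := by
        have := (x.schedule hw).before_final_cot (σ := .obj (x.value k))
          (by simp [schedule, hs]) (x.context w (boss hw))
        rwa [hT] at this
      obtain ⟨prev, h⟩ := (x.extends_runContext hw hd hN _ _).exists_nextToken_eq hu
        (by simp [Token.msg])
      right
      refine ⟨(x.schedule hw).out_eq_idle (by omega) _, Or.inl ?_⟩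
      rw [h]
      simp [protocol]
    · omega

end helped

theorem consistent (hd : Monotone d) (hN : 1 ≤ N) (hk : 1 ≤ k) (i : Fin w) {t : ℕ}
    (h1 : 1 ≤ t) (h2 : t ≤ (x.schedule hw).len i) : x.Consistent hw i t := by
  by_cases h3 : t ≤ k + 2
  · exact x.consistent_of_le hw hd hN hk i h1 h3
  by_cases hs : x.SoloUpTo hw (k + 1)
  · exact x.consistent_of_solo hw hs hd hN hk i (by omega) h2
  by_cases h4 : 3 * k + 3 ≤ t
  · exact x.consistent_end hw hs hd hN hk i h4 h2
  rcases Nat.even_or_odd' (t - (k + 3)) with ⟨s, h | h⟩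
  · rw [show t = k + 1 + 2 * (s + 1) by omega]
    exact x.consistent_ask hw hs hd hN hk i (by omega) (by omega)
  · rw [show t = k + 2 + 2 * (s + 1) by omega]
    exact x.consistent_answer hw hs hd hN i (by omega) (by omega)

/-- At the end of its life an agent predicts the end of the sequence. -/
theorem nextToken_tokens (hd : Monotone d) (hN : 1 ≤ N) (hk : 1 ≤ k) (i : Fin w) :
    nextToken ((x.schedule hw).graph.tokens (x.context w i) i) = .eos := by
  have hext := x.extends_runContext hw hd hN i ((x.schedule hw).len i)
  have hlen := (x.schedule hw).le_len i
  -- An agent that is idle at its last node.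
  have hidle : (x.schedule hw).out i ((x.schedule hw).len i) = .idle →
      nextToken ((x.schedule hw).graph.tokens (x.context w i) i) = .eos := by
    intro h
    have h' : (x.schedule hw).graph.tokens (x.context w i) i =
        x.runContext hw i ((x.schedule hw).len i) := by
      rw [AgentGraph.tokens, show (x.schedule hw).graph.out i ((x.schedule hw).graph.len i) = _ from h]
      simp only [Action.token, Option.toList_none, List.append_nil]
      rfl
    rw [h']
    rcases x.consistent hw hd hN hk i (by omega) le_rfl with h1 | ⟨-, h1 | h1⟩
    · rw [h] at h1
      simp [Action.token] at h1
    · exact h1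
    · exact absurd h1.1 (lt_irrefl _)
  by_cases hl : (x.schedule hw).len i = (x.schedule hw).T + 1
  · have hout := (x.schedule hw).out_final i
    by_cases hs : x.SoloUpTo hw (k + 1)
    · by_cases hi : i ≠ boss hw ∧ i = helper hw
      · -- The last edge of the run starts at this agent.
        rw [x.finalAction_of_solo hw hs, if_pos hi, ← hl] at hout
        have h' : (x.schedule hw).graph.tokens (x.context w i) i =
            x.runContext hw i ((x.schedule hw).len i) ++ [.send Msg.ping.sym 0] := by
          rw [AgentGraph.tokens,
            show (x.schedule hw).graph.out i ((x.schedule hw).graph.len i) = _ from hout]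
          rfl
        have hext' := hext.append (l := [.send Msg.ping.sym 0]) (by
          simp [Token.IsPlain])
        rw [h']
        obtain ⟨prev, h⟩ := hext'.exists_nextToken_eq rfl (by simp [Token.msg])
        rw [h]
        rfl
      · rw [x.finalAction_of_solo hw hs, if_neg hi, ← hl] at hout
        exact hidle hout
    · by_cases hi : i = boss hw
      · subst hi
        have : (x.schedule hw).len (boss hw) = (x.schedule hw).T + 2 := by
          simp [Schedule.len, schedule, hs]
        omega
      · rw [x.finalAction_of_helped hw hs, if_neg hi, ← hl] at hout
        exact hidle hout
  · exact hidle ((x.schedule hw).out_eq_idle (by omega) i)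

theorem lastCoT_boss (hk : 1 ≤ k) :
    (x.schedule hw).graph.LastCoT (boss hw) (.obj x.answer) := by
  rw [← x.value_last]
  by_cases hs : x.SoloUpTo hw (k + 1)
  · have hT := x.schedule_T_of_solo hw hs
    refine ⟨k + 2, ?_, fun t ht s h => ?_⟩
    · refine ((x.schedule hw).out_of_le (by omega) (by omega) _).trans ?_
      rw [show (x.schedule hw).round _ = _ from x.round_of_le hw le_rfl]
      simp [Round.action, note, bossNote, hs]
    · rcases Nat.eq_or_lt_of_le (show k + 3 ≤ t by omega) with rfl | h3
      · have hout := (x.schedule hw).out_final (boss hw)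
        rw [x.finalAction_of_solo hw hs, if_neg (by simp), hT] at hout
        rw [show (x.schedule hw).graph.out _ _ = _ from hout] at h
        cases h
      · rw [show (x.schedule hw).graph.out _ _ = _ from
          (x.schedule hw).out_eq_idle (by omega) _] at h
        cases h
  · have hT := x.schedule_T_of_helped hw hs
    refine ⟨3 * k + 3, ?_, fun t ht s h => ?_⟩
    · have hout := (x.schedule hw).out_final (boss hw)
      rwa [x.finalAction_of_helped hw hs, if_pos rfl, hT] at hout
    · rw [show (x.schedule hw).graph.out _ _ = _ from
          (x.schedule hw).out_eq_idle (by omega) _] at h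
      cases h

end KHop

/-! ### The multi-agent system -/

open Classical in
/-- The CoT alphabet: the input symbols and the labels of the protocol. -/
noncomputable def alphabet (d m : ℕ → ℕ) (n : ℕ) : Finset Sym :=
  ((Finset.range (m n) ×ˢ Finset.range (d n) ×ˢ Finset.range (d n)).image
      fun q => Sym.fact q.1 q.2.1 q.2.2) ∪
    (Finset.range (m n)).image Sym.fn ∪ (Finset.range (d n)).image Sym.obj ∪
    (Finset.range 7 ×ˢ Finset.range (n + 1) ×ˢ Finset.range (d n + 1)).image
      fun q => Sym.aux (Nat.pair q.1 (Nat.pair q.2.1 q.2.2))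

theorem mem_alphabet {d m : ℕ → ℕ} {n : ℕ} {σ : Sym} : σ ∈ alphabet d m n ↔
    σ ∈ inputAlphabet d m n ∨ ∃ g < 7, ∃ s < n + 1, ∃ x < d n + 1,
      σ = .aux (Nat.pair g (Nat.pair s x)) := by
  simp only [alphabet, inputAlphabet, Finset.mem_union, Finset.mem_image, Finset.mem_product,
    Finset.mem_range, Prod.exists, Set.mem_ofPred_eq, or_assoc]
  constructor
  · rintro (⟨f, x, y, ⟨h1, h2, h3⟩, rfl⟩ | ⟨f, h, rfl⟩ | ⟨y, h, rfl⟩ | ⟨g, s, y, ⟨h1, h2, h3⟩, rfl⟩)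
    · exact Or.inl ⟨f, x, y, h1, h2, h3, rfl⟩
    · exact Or.inr (Or.inl ⟨f, h, rfl⟩)
    · exact Or.inr (Or.inr (Or.inl ⟨y, h, rfl⟩))
    · exact Or.inr (Or.inr (Or.inr ⟨g, h1, s, h2, y, h3, rfl⟩))
  · rintro (⟨f, x, y, h1, h2, h3, rfl⟩ | ⟨f, h, rfl⟩ | ⟨y, h, rfl⟩ | ⟨g, h1, s, h2, y, h3, rfl⟩)
    · exact Or.inl ⟨f, x, y, ⟨h1, h2, h3⟩, rfl⟩
    · exact Or.inr (Or.inl ⟨f, h, rfl⟩)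
    · exact Or.inr (Or.inr (Or.inl ⟨y, h, rfl⟩))
    · exact Or.inr (Or.inr (Or.inr ⟨g, s, y, ⟨h1, h2, h3⟩, rfl⟩))

theorem labels_subset_alphabet {d m : ℕ → ℕ} {n : ℕ} {σ : Sym} (h : σ ∈ labels d n) :
    σ ∈ alphabet d m n := by
  rw [mem_alphabet]
  rcases h with ⟨μ, rfl, h1, h2⟩ | ⟨y, h, rfl⟩
  · right
    cases μ
    all_goals
      refine ⟨_, ?_, _, ?_, _, ?_, rfl⟩
      all_goals simp only [Msg.step, Msg.object] at h1 h2 ⊢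
      all_goals omega
  · exact Or.inl (Or.inr (Or.inr ⟨y, h, rfl⟩))

theorem alphabet_mono {d m : ℕ → ℕ} (hd : Monotone d) (hm : Monotone m) :
    Monotone (alphabet d m) := by
  intro n n' h σ hσ
  have h1 := hd h
  have h2 := hm h
  rw [mem_alphabet] at hσ ⊢
  rcases hσ with (⟨f, x, y, g1, g2, g3, rfl⟩ | ⟨f, g, rfl⟩ | ⟨y, g, rfl⟩) | ⟨g, g1, s, g2, y, g3, rfl⟩
  · exact Or.inl (Or.inl ⟨f, x, y, by omega, by omega, by omega, rfl⟩)
  · exact Or.inl (Or.inr (Or.inl ⟨f, by omega, rfl⟩))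
  · exact Or.inl (Or.inr (Or.inr ⟨y, by omega, rfl⟩))
  · exact Or.inr ⟨g, g1, s, by omega, y, by omega, rfl⟩

theorem card_alphabet_le {d m : ℕ → ℕ} {p n : ℕ} (hd : d n ≤ (n + 2) ^ p)
    (hm : m n ≤ (n + 2) ^ p) : (alphabet d m n).card ≤ (n + 2) ^ (3 * p + 6) := by
  have h : (alphabet d m n).card ≤ m n * (d n * d n) + m n + d n + 7 * ((n + 1) * (d n + 1)) := by
    classical
    unfold alphabet
    refine (Finset.card_union_le _ _).trans (add_le_add ((Finset.card_union_le _ _).trans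
      (add_le_add ((Finset.card_union_le _ _).trans (add_le_add ?_ ?_)) ?_)) ?_)
    all_goals exact Finset.card_image_le.trans (by simp)
  refine h.trans ?_
  obtain ⟨D, hD⟩ : ∃ D, D = (n + 2) ^ p := ⟨_, rfl⟩
  have hD1 : 1 ≤ D := hD ▸ Nat.one_le_pow _ _ (by omega)
  rw [← hD] at hd hm
  have hD3 : D ≤ D * (D * D) := Nat.le_mul_of_pos_right _ (by positivity)
  have e : (n + 2) ^ (3 * p + 6) = (n + 2) ^ 5 * ((n + 2) * (D * (D * D))) := by
    rw [hD]
    ring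
  have h32 : 32 ≤ (n + 2) ^ 5 := (Nat.pow_le_pow_left (show 2 ≤ n + 2 by omega) 5)
  calc m n * (d n * d n) + m n + d n + 7 * ((n + 1) * (d n + 1))
      ≤ D * (D * D) + D + D + 7 * ((n + 2) * (D + D)) := by gcongr; omega
    _ ≤ (n + 2) * (D * (D * D)) + (n + 2) * (D * (D * D)) + (n + 2) * (D * (D * D)) +
          7 * ((n + 2) * (D * (D * D) + D * (D * D))) := by
        have : D ≤ (n + 2) * (D * (D * D)) := hD3.trans (Nat.le_mul_of_pos_left _ (by omega))
        have : D * (D * D) ≤ (n + 2) * (D * (D * D)) := Nat.le_mul_of_pos_left _ (by omega)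
        gcongr
    _ = 17 * ((n + 2) * (D * (D * D))) := by ring
    _ ≤ (n + 2) ^ 5 * ((n + 2) * (D * (D * D))) := by
        gcongr
        omega
    _ = _ := e.symm

theorem chunk_length_le {d m : ℕ → ℕ} {N k w : ℕ} (x : KHop d m N k) (i : Fin w) :
    (x.chunk w i).length ≤ N := by
  rw [KHop.chunk, List.length_map]
  exact (List.length_filter_le _ _).trans (by simp)

theorem context_subset_tokenAlphabet {d m : ℕ → ℕ} (hd : Monotone d) (hm : Monotone m) {N k w n : ℕ}
    (hw : w ≤ N) (hn : N + k ≤ n) (x : KHop d m N k) (i : Fin w) :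
    ∀ a ∈ x.context w i, a ∈ tokenAlphabet (alphabet d m n) n := by
  have hd' := hd (show N ≤ n by omega)
  have hm' := hm (show N ≤ n by omega)
  intro a ha
  simp only [KHop.context, List.mem_append, List.mem_map, List.mem_singleton] at ha
  rcases ha with ⟨σ, (h | h) | rfl, rfl⟩ | rfl
  · obtain ⟨r, -, rfl⟩ := (x.fact_mem_chunk i).1 h
    exact mem_alphabet.2 (Or.inl (Or.inl ⟨_, _, _, (x.fn r).2.trans_le hm',
      (x.arg r).2.trans_le hd', (x.val r).2.trans_le hd', rfl⟩))
  · obtain ⟨j, rfl⟩ := List.mem_ofFn.1 h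
    exact mem_alphabet.2 (Or.inl (Or.inr (Or.inl ⟨_, (x.query j).2.trans_le hm', rfl⟩)))
  · exact mem_alphabet.2 (Or.inl (Or.inr (Or.inr ⟨_, x.start.2.trans_le hd', rfl⟩)))
  · exact show i.1 < n by omega

/-- A transformer that computes `nextToken` implements the run.  The context size is linear, since a block
has at most `N` facts and each of the `O(k)` time steps appends at most two tokens. -/
theorem KHop.implements {d m : ℕ → ℕ} (hd : Monotone d) (hm : Monotone m) {n : ℕ} {T : UHAT}
    (hc : T.contextSize = 20 * (n + 1))
    (hT : ∀ u : List Token, u ≠ [] → u.length ≤ 20 * (n + 1) →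
      (∀ a ∈ u, a ∈ tokenAlphabet (alphabet d m n) n) →
      nextToken u ∈ tokenAlphabet (alphabet d m n) n →
        T.Predicts (tokenAlphabet (alphabet d m n) n) u (nextToken u))
    {N k w : ℕ} (hN : 1 ≤ N) (hk : 1 ≤ k) (hw : 1 ≤ w) (hwN : w ≤ N) (hn : N + k ≤ n)
    (x : KHop d m N k) :
    (x.schedule hw).graph.Implements T (tokenAlphabet (alphabet d m n) n) (x.context w) := by
  intro i
  have hlab : ∀ σ ∈ labels d (N + k), σ ∈ alphabet d m n := fun σ h =>
    alphabet_mono hd hm hn (labels_subset_alphabet h)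
  have hTk : (x.schedule hw).T ≤ 3 * k + 2 := by
    simp only [schedule]
    split_ifs <;> omega
  have hlen := (x.schedule hw).len_le i
  have htok : ∀ t a, ((x.schedule hw).out i t).token = some a →
      a ∈ tokenAlphabet (alphabet d m n) n := by
    intro t a h
    have hl := x.label_mem_labels hw hd hN i t
    rcases hout : (x.schedule hw).out i t with _ | s | ⟨s, j⟩ | s
    · simp [hout, Action.token] at h
    · simp only [hout, Action.token, Option.some.injEq] at h
      subst h
      exact hlab _ (hl s (by simp [hout]))
    · simp only [hout, Action.token, Option.some.injEq] at h
      subst h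
      exact ⟨hlab _ (hl s (by simp [hout])), by omega⟩
    · simp only [hout, Action.token, Option.some.injEq] at h
      subst h
      exact hlab _ (hl s (by simp [hout]))
  have hmem : ∀ t, ∀ a ∈ x.runContext hw i t, a ∈ tokenAlphabet (alphabet d m n) n := by
    intro t a ha
    obtain ⟨tail, h1, -, h2⟩ := x.exists_runContext_eq hw hd hN i t
    rw [h1, List.mem_append] at ha
    rcases ha with ha | ha
    · exact context_subset_tokenAlphabet hd hm hwN hn x i a ha
    · obtain ⟨s, hs, rfl | rfl | rfl | ⟨j, rfl⟩⟩ := h2 a ha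
      · exact hlab _ hs
      · exact hlab _ hs
      · exact hlab _ hs
      · exact ⟨hlab _ hs, by omega⟩
  have hlength : ∀ t ≤ (x.schedule hw).len i, (x.runContext hw i t).length + 2 ≤ 20 * (n + 1) ∧
      x.runContext hw i t ≠ [] := by
    intro t ht
    obtain ⟨tail, h1, h2, -⟩ := x.exists_runContext_eq hw hd hN i t
    have h3 := context_length x i tail
    have h4 := chunk_length_le x i
    rw [← h1] at h3
    refine ⟨by omega, ?_⟩
    rw [ne_eq, ← List.length_eq_zero_iff]
    omega
  have hpred : ∀ t, IsNode (x.schedule hw).len (i, t) →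
      nextToken (x.runContext hw i t) ∈ tokenAlphabet (alphabet d m n) n →
        T.Predicts (tokenAlphabet (alphabet d m n) n) (x.runContext hw i t)
          (nextToken (x.runContext hw i t)) := by
    intro t ht h
    obtain ⟨h1, h2⟩ := hlength t ht.2
    exact hT _ h2 (by omega) (hmem t) h
  have hcon : ∀ t, IsNode (x.schedule hw).len (i, t) → x.Consistent hw i t := fun t ht =>
    x.consistent hw hd hN hk i ht.1 ht.2
  obtain ⟨h1, h2⟩ := hlength _ le_rfl
  have hl : ((x.schedule hw).out i ((x.schedule hw).len i)).token.toList.length ≤ 1 :=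
    Option.length_toList_le
  have htl : ((x.schedule hw).graph.tokens (x.context w i) i).length + 1 ≤ 20 * (n + 1) := by
    rw [AgentGraph.tokens, List.length_append]
    change (x.runContext hw i ((x.schedule hw).len i)).length +
      ((x.schedule hw).out i ((x.schedule hw).len i)).token.toList.length + 1 ≤ _
    omega
  refine ⟨hc ▸ htl, ?_, ?_, ?_⟩
  · intro t ht a ha
    rcases hcon t ht with h | ⟨h, -⟩
    · have e : a = nextToken (x.runContext hw i t) := Option.some.inj (ha.symm.trans h)
      rw [e]
      exact hpred t ht (e ▸ htok t a ha)
    · rw [show (x.schedule hw).graph.out i t = _ from h] at ha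
      simp [Action.token] at ha
  · rw [← x.nextToken_tokens hw hd hN hk i]
    refine hT _ ?_ (by omega) ?_ ?_
    · exact fun h => h2 (List.append_eq_nil_iff.1 h).1
    · intro a ha
      rcases List.mem_append.1 ha with ha | ha
      · exact hmem _ a ha
      · exact htok _ a (Option.mem_toList.1 ha)
    · rw [x.nextToken_tokens hw hd hN hk i]
      trivial
  · intro t ht _ hidle a ha hp
    rcases hcon t ht with h | ⟨-, h | ⟨-, s, hs, h⟩⟩
    · rw [show (x.schedule hw).out i t = _ from hidle] at h
      simp [Action.token] at h
    · have := hp.unique (h ▸ hpred t ht (by rw [h]; trivial))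
      rw [this] at ha
      exact ha
    · have := hp.unique (h ▸ hpred t ht (by
        rw [h]
        exact hlab _ (msg_mem_labels _ (by simp only [Msg.step]; omega) (Nat.succ_pos _))))
      rw [this] at ha
      exact ha

/-- The run without edges, with one node for each agent. -/
def AgentGraph.edgeless (w : ℕ) : AgentGraph w where
  len _ := 1
  out _ _ := .idle
  len_pos _ := le_rfl
  out_idle _ _ _ := rfl
  send_ne _ _ _ _ h := nomatch h
  target_isNode _ _ h := by simp [CommEdge, CoTEdge, Action.message] at h
  incoming v h h' := absurd (h'.trans h.2) (Nat.not_succ_le_self 1)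

open Classical in
/-- The system that runs the protocol.  There are no requirements on inputs without facts. -/
noncomputable def protocolSystem (w d m : ℕ → ℕ) (hw : ∀ N, 1 ≤ N → 1 ≤ w N ∧ w N ≤ N)
    (hd : Monotone d) (hm : Monotone m)
    (hp : ∃ p : ℕ, ∀ n, d n ≤ (n + 2) ^ p ∧ m n ≤ (n + 2) ^ p) : MultiAgentSystem w d m where
  Ξ := alphabet d m
  Ξ_mono := alphabet_mono hd hm
  Ξ_input _ _ h := mem_alphabet.2 (Or.inl h)
  Ξ_poly := hp.imp' (fun p => 3 * p + 6) fun _ h n => card_alphabet_le (h n).1 (h n).2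
  graph {N _} x := if h : 1 ≤ N then (x.schedule (hw N h).1).graph else .edgeless _
  label_mem {N k} x i t s h := by
    by_cases hN : 1 ≤ N
    · rw [dif_pos hN] at h
      exact labels_subset_alphabet (x.label_mem_labels _ hd hN i t s h)
    · rw [dif_neg hN] at h
      simp [AgentGraph.edgeless] at h

/-- The protocol needs six layers and two heads. -/
theorem realizability : ∃ C : ℕ, ∀ (w d m : ℕ → ℕ), (∀ N, 1 ≤ N → 1 ≤ w N ∧ w N ≤ N) → Monotone d →
    Monotone m → (∃ p : ℕ, ∀ n, d n ≤ (n + 2) ^ p ∧ m n ≤ (n + 2) ^ p) →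
      ∃ A : MultiAgentSystem w d m, A.Expressible ∧ A.Computes ∧
        ∀ N k : ℕ, 1 ≤ N → 1 ≤ k → ∀ x : KHop d m N k,
          (A.graph x).depth ≤ C * k ∧ (A.graph x).comm ≤ C * k ∧
            (A.graph x).size ≤ C * (w N * k) := by
  refine ⟨16, fun w d m hw hd hm hp => ⟨protocolSystem w d m hw hd hm hp, ?_, ?_, ?_⟩⟩
  · refine ⟨6, 2, fun n => ?_⟩
    obtain ⟨T, h1, h2, h3, h4⟩ := exists_uhat_of_lookups protocolLookups protocolOutput
      (finite_tokenAlphabet (alphabet d m n) n) True.intro (20 * (n + 1))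
    refine ⟨T, h2.le, h3, fun N k hN hk hn x => ?_⟩
    rw [show (protocolSystem w d m hw hd hm hp).graph x = (x.schedule (hw N hN).1).graph from
      dif_pos hN]
    exact x.implements hd hm h1 h4 hN hk (hw N hN).1 (hw N hN).2 hn
  · intro N k hN hk
    refine ⟨boss (hw N hN).1, fun x => ?_⟩
    rw [show (protocolSystem w d m hw hd hm hp).graph x = (x.schedule (hw N hN).1).graph from
      dif_pos hN]
    exact x.lastCoT_boss _ hk
  · intro N k hN hk x
    rw [show (protocolSystem w d m hw hd hm hp).graph x = (x.schedule (hw N hN).1).graph from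
      dif_pos hN]
    obtain ⟨Z, hZ⟩ : ∃ Z, Z = x.schedule (hw N hN).1 := ⟨_, rfl⟩
    have hT : Z.T ≤ 3 * k + 2 := by
      rw [hZ]
      simp only [KHop.schedule]
      split_ifs <;> omega
    rw [← hZ]
    refine ⟨Z.depth_le.trans (by omega), Z.comm_le.trans (by omega), Z.size_le.trans ?_⟩
    calc w N * (Z.T + 2) ≤ w N * (16 * k) := Nat.mul_le_mul_left _ (by omega)
      _ = 16 * (w N * k) := by ring

end KHopAgents

theorem mainTheorem1 :
    -- realizability
    (∃ C : ℕ, ∀ (w d m : ℕ → ℕ), (∀ N, 1 ≤ N → 1 ≤ w N ∧ w N ≤ N) → Monotone d → Monotone m →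
      (∃ p : ℕ, ∀ n, d n ≤ (n + 2) ^ p ∧ m n ≤ (n + 2) ^ p) →
      ∃ A : KHopAgents.MultiAgentSystem w d m, A.Expressible ∧ A.Computes ∧
        ∀ N k : ℕ, 1 ≤ N → 1 ≤ k → ∀ x : KHopAgents.KHop d m N k,
          (A.graph x).depth ≤ C * k ∧ (A.graph x).comm ≤ C * k ∧
            (A.graph x).size ≤ C * (w N * k)) ∧
    -- optimality of the communication budget
    (∀ p : ℕ, ∃ c : ℝ, 0 < c ∧ ∃ K : ℕ, ∀ (w d m : ℕ → ℕ),
      (∀ N, 1 ≤ N → 1 ≤ w N ∧ w N ≤ N) → Monotone d → Monotone m →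
      (∀ n, n ≤ d n) → (∀ n, 1 ≤ m n) →
      ∀ A : KHopAgents.MultiAgentSystem w d m, A.Expressible → A.Computes →
        (∀ n, (A.Ξ n).card ≤ (n + 2) ^ p) →
        ∀ N k : ℕ, 1 ≤ k → 2 ≤ w N → (k + 1) ^ K ≤ N →
          (∀ x : KHopAgents.KHop d m N k, (A.graph x).depth ≤ (N + k + 2) ^ p) →
          ∃ x : KHopAgents.KHop d m N k, c * k ≤ ((A.graph x).comm : ℝ)) ∧
    -- optimality of the depth up to a logarithmic factor
    (∀ p : ℕ, ∃ c : ℝ, 0 < c ∧ ∃ K : ℕ, ∀ (w d m : ℕ → ℕ),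
      (∀ N, 1 ≤ N → 1 ≤ w N ∧ w N ≤ N) → Monotone d → Monotone m →
      (∀ n, n ≤ d n) → (∀ n, 1 ≤ m n) →
      ∀ A : KHopAgents.MultiAgentSystem w d m, A.Expressible → A.Computes →
        (∀ n, (A.Ξ n).card ≤ (n + 2) ^ p) →
        ∀ N k : ℕ, 1 ≤ k → 2 ≤ w N → K * (k * w N) ≤ N →
          ∃ x : KHopAgents.KHop d m N k,
            c * k / Real.log ((N : ℝ) + k) ≤ ((A.graph x).depth : ℝ)) := by
  exact ⟨KHopAgents.realizability,
    fun p => by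
      obtain ⟨c, hc, K, h⟩ := KHopAgents.communication_lower_bound p
      exact ⟨c, hc, K, fun w d m hw _ _ => h w d m hw⟩,
    fun p => by
      obtain ⟨c, hc, K, h⟩ := KHopAgents.depth_lower_bound p
      exact ⟨c, hc, K, fun w d m hw _ _ => h w d m hw⟩⟩
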